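/- For $p\in\mathbb C$ with $|p|<1$ and $z\in\mathbb C^{\ast}=\mathbb C\setminus\{0\}$ let \[ \theta(z)=\theta(z;p)=\prod_{k=0}^{\infty}\bigl(1-zp^k\bigr)\bigl(1-z^{-1}p^{k+1}\bigr), \qquad (a)_m=(a;q,p)_m=\prod_{k=0}^{m-1}\theta(aq^k;p), \qquad (a,b)_m=(a)_m(b)_m , \] and let $[n]=\{1,\dots,n\}$. Let $n$ be a nonnegative integer and let $v,w,q,t,x_1,\dots,x_n\in\mathbb C^{\ast}$. Put $x=(x_1,\dots,x_n)$, \[ L(x;v,w,q,t;p)=\sum_{r=0}^n \frac{(v,w)_r}{(qv/t,qw/t)_r} \sum_{\substack{I\subseteq [n] \\ |I|=r}} \prod_{i\in I}\frac{q\,\theta(vx_i/tw)\,\theta(tq^{-r}x_i/qw)}{t\,\theta(vx_i/qw)\,\theta(q^{-r}x_i/w)} \prod_{j\in[n]\setminus I}\frac{\theta(x_j/q)\,\theta(q^{-r}x_j/tw)}{\theta(x_j/t)\,\theta(q^{-r}x_j/qw)} \prod_{\substack{i\in I \\ j\in[n]\setminus I}}\frac{\theta(tx_i/qx_j)\,\theta(qx_i/x_j)}{\theta(x_i/x_j)\,\theta(tx_i/x_j)}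 \] and \[ R(x;v,w,q,t;p)=\sum_{r=0}^n \frac{(v,w)_r}{(qv/t,qw/t)_r} \sum_{\substack{I\subseteq [n] \\ |I|=r}} \prod_{i\in I}\frac{q\,\theta(x_i/q)\,\theta(q^{r}vx_i/t^2)}{t\,\theta(x_i/t)\,\theta(q^{r}vx_i/tq)} \prod_{j\in[n]\setminus I}\frac{\theta(vx_j/tw)\,\theta(q^{r}vx_j/q)}{\theta(vx_j/qw)\,\theta(q^{r}vx_j/t)} \prod_{\substack{i\in I \\ j\in[n]\setminus I}}\frac{\theta(tx_j/qx_i)\,\theta(qx_j/x_i)}{\theta(x_j/x_i)\,\theta(tx_j/x_i)}, \] where $ab/cd$ means $(ab)/(cd)$. Suppose that both expressions are well defined, that is, no denominator in any of their summands vanishes. Then \[ L(x;v,w,q,t;p)=R(x;v,w,q,t;p). \] Equivalently, $L$ has the symmetry \[ L(x;v,w,q,t;p)=L\bigl(q^{-1}t^{-1}vw^{-1}x;\,v^{-1},w^{-1},q^{-1},t^{-1};\,p\bigr). \] -/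

import Mathlib

open scoped BigOperators

noncomputable section

namespace ThetaIdentity

/-- The normalised theta function `θ(z; p) = ∏_{k ≥ 0} (1 - z p^k) (1 - z⁻¹ p^(k+1))`
(for `‖p‖ < 1` and `z ≠ 0`). -/
def theta (p z : ℂ) : ℂ :=
  ∏' k : ℕ, (1 - z * p ^ k) * (1 - z⁻¹ * p ^ (k + 1))

/-- The theta shifted factorial `(a; q, p)_m = ∏_{k=0}^{m-1} θ(a q^k; p)`. -/
def thetaPoch (q p a : ℂ) (m : ℕ) : ℂ :=
  ∏ k ∈ Finset.range m, theta p (a * q ^ k)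

/-- The sum `L(x; v, w, q, t; p)`. -/
def L {n : ℕ} (x : Fin n → ℂ) (v w q t p : ℂ) : ℂ :=
  ∑ r ∈ Finset.range (n + 1),
    (thetaPoch q p v r * thetaPoch q p w r) /
      (thetaPoch q p (q * v / t) r * thetaPoch q p (q * w / t) r) *
    ∑ I ∈ Finset.powersetCard r (Finset.univ : Finset (Fin n)),
      (∏ i ∈ I,
        (q * theta p (v * x i / (t * w)) * theta p (t * q ^ (-(r : ℤ)) * x i / (q * w))) /
          (t * theta p (v * x i / (q * w)) * theta p (q ^ (-(r : ℤ)) * x i / w))) *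
      (∏ j ∈ Iᶜ,
        (theta p (x j / q) * theta p (q ^ (-(r : ℤ)) * x j / (t * w))) /
          (theta p (x j / t) * theta p (q ^ (-(r : ℤ)) * x j / (q * w)))) *
      (∏ i ∈ I, ∏ j ∈ Iᶜ,
        (theta p (t * x i / (q * x j)) * theta p (q * x i / x j)) /
          (theta p (x i / x j) * theta p (t * x i / x j)))

/-- The dual sum `R(x; v, w, q, t; p)`. -/
def R {n : ℕ} (x : Fin n → ℂ) (v w q t p : ℂ) : ℂ :=
  ∑ r ∈ Finset.range (n + 1),
    (thetaPoch q p v r * thetaPoch q p w r) /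
      (thetaPoch q p (q * v / t) r * thetaPoch q p (q * w / t) r) *
    ∑ I ∈ Finset.powersetCard r (Finset.univ : Finset (Fin n)),
      (∏ i ∈ I,
        (q * theta p (x i / q) * theta p (q ^ r * v * x i / t ^ 2)) /
          (t * theta p (x i / t) * theta p (q ^ r * v * x i / (t * q)))) *
      (∏ j ∈ Iᶜ,
        (theta p (v * x j / (t * w)) * theta p (q ^ r * v * x j / q)) /
          (theta p (v * x j / (q * w)) * theta p (q ^ r * v * x j / t))) *
      (∏ i ∈ I, ∏ j ∈ Iᶜ,
        (theta p (t * x j / (q * x i)) * theta p (q * x j / x i)) /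
          (theta p (x j / x i) * theta p (t * x j / x i)))

/-- `L(x; v, w, q, t; p)` is well defined: no denominator in the summand of any subset `I`
of the index set (with `r = |I|`) vanishes. -/
def LWellDefined {n : ℕ} (x : Fin n → ℂ) (v w q t p : ℂ) : Prop :=
  ∀ r : ℕ, ∀ I : Finset (Fin n), I.card = r →
    thetaPoch q p (q * v / t) r ≠ 0 ∧ thetaPoch q p (q * w / t) r ≠ 0 ∧
    (∀ i ∈ I, theta p (v * x i / (q * w)) ≠ 0 ∧ theta p (q ^ (-(r : ℤ)) * x i / w) ≠ 0) ∧
    (∀ j ∉ I, theta p (x j / t) ≠ 0 ∧ theta p (q ^ (-(r : ℤ)) * x j / (q * w)) ≠ 0) ∧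
    (∀ i ∈ I, ∀ j ∉ I, theta p (x i / x j) ≠ 0 ∧ theta p (t * x i / x j) ≠ 0)

/-- `R(x; v, w, q, t; p)` is well defined: no denominator in the summand of any subset `I`
of the index set (with `r = |I|`) vanishes. -/
def RWellDefined {n : ℕ} (x : Fin n → ℂ) (v w q t p : ℂ) : Prop :=
  ∀ r : ℕ, ∀ I : Finset (Fin n), I.card = r →
    thetaPoch q p (q * v / t) r ≠ 0 ∧ thetaPoch q p (q * w / t) r ≠ 0 ∧
    (∀ i ∈ I, theta p (x i / t) ≠ 0 ∧ theta p (q ^ r * v * x i / (t * q)) ≠ 0) ∧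
    (∀ j ∉ I, theta p (v * x j / (q * w)) ≠ 0 ∧ theta p (q ^ r * v * x j / t) ≠ 0) ∧
    (∀ i ∈ I, ∀ j ∉ I, theta p (x j / x i) ≠ 0 ∧ theta p (t * x j / x i) ≠ 0)

end ThetaIdentity

end

open Filter Topology

/-! The identity is proved by induction on the number of variables, with all parameters left free.
One variable z is singled out, and the difference f(z) = L − R is studied as a function of z on
ℂ∖{0} (`sumDiff`). Every weight is a quotient of two theta products whose arguments have the same
product, so f(pz) = f(z). If f also has no poles, it descends to a holomorphic function on a compact
torus and is constant (`eq_of_mul_periodic`). At z = q a factor θ(1) = 0 forces z into the subset in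
L and out of it in R. What remains on both sides is one common factor times the identity in one
variable fewer, with v replaced by qv and x by x/q (`LSumInsert_at_q`, `RSumInsert_at_q`). Hence
f(q) = 0, and f vanishes identically.

Up to powers of p, the possible poles are treated as follows. At z = t, L and R have residues equal
to a common factor times the two sides of the identity with w, x replaced by qw, qx, so induction
applies. At z = t x_m the residues are a common factor times the two sides for the variables other
than z and x_m, with v, w replaced by qv, qw, so induction applies again. At z = x_m the terms in
which exactly one of z, x_m lies in the subset cancel in pairs, separately in L and in R. At z = w
q^(s+1), which concerns only L, subsets of size s omitting z cancel against the same subsets with z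
adjoined (`noPole_LSumInsert_at_shift`). The remaining candidates qw/v, x_m/t and t/(v q^r) are
images of these under the duality that inverts v, w, q, t and rescales x. It exchanges L and R term
by term (`LSum_dual`, `LSumInsert_dual`).

This argument needs p ≠ 0 and parameters in general position, so that the poles are simple and do
not collide (`Generic`). Both sides are continuous, jointly in the nome and the parameters, at every
well-defined point, and generic parameters accumulate at every admissible point, including those
with p = 0. The general case follows by passing to the limit. -/

namespace ThetaIdentity

/-! ### Theta function: functional equations, zeros, analyticity, joint continuity -/

/-- The infinite shifted factorial `(a; p)_∞`. -/
noncomputable def qPochInf (p a : ℂ) : ℂ := ∏' k : ℕ, (1 - a * p ^ k)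

lemma summable_norm_mul_pow {p : ℂ} (hp : ‖p‖ < 1) (a : ℂ) :
    Summable fun k : ℕ => ‖-(a * p ^ k)‖ := by
  simpa using (summable_geometric_of_lt_one (norm_nonneg p) hp).mul_left ‖a‖

lemma multipliable_one_sub_mul_pow {p : ℂ} (hp : ‖p‖ < 1) (a : ℂ) :
    Multipliable fun k : ℕ => 1 - a * p ^ k := by
  simpa [sub_eq_add_neg] using multipliable_one_add_of_summable (summable_norm_mul_pow hp a)

lemma qPochInf_eq_mul {p : ℂ} (hp : ‖p‖ < 1) (a : ℂ) :
    qPochInf p a = (1 - a) * qPochInf p (a * p) := by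
  have h := multipliable_one_sub_mul_pow hp (a * p)
  unfold qPochInf
  rw [tprod_eq_zero_mul' (by simpa [pow_succ', mul_assoc] using h)]
  simp [pow_succ', mul_assoc]

lemma qPochInf_ne_zero {p : ℂ} (hp : ‖p‖ < 1) {a : ℂ} (h : ∀ k : ℕ, a * p ^ k ≠ 1) :
    qPochInf p a ≠ 0 := by
  have := tprod_one_add_ne_zero_of_summable (f := fun k : ℕ => -(a * p ^ k))
    (fun k => by rw [← sub_eq_add_neg]; exact sub_ne_zero.mpr (h k).symm)
    (summable_norm_mul_pow hp a)
  simpa [qPochInf, sub_eq_add_neg] using this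

lemma theta_eq_qPochInf {p : ℂ} (hp : ‖p‖ < 1) (z : ℂ) :
    theta p z = qPochInf p z * qPochInf p (z⁻¹ * p) := by
  have h1 := multipliable_one_sub_mul_pow hp z
  have h2 := multipliable_one_sub_mul_pow hp (z⁻¹ * p)
  unfold theta qPochInf
  rw [← h1.tprod_mul h2]
  simp [pow_succ', mul_assoc]

lemma theta_inv {p : ℂ} (hp : ‖p‖ < 1) {z : ℂ} (hz : z ≠ 0) :
    theta p z⁻¹ = -z⁻¹ * theta p z := by
  rw [theta_eq_qPochInf hp, theta_eq_qPochInf hp, qPochInf_eq_mul hp z⁻¹, qPochInf_eq_mul hp z,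
    inv_inv]
  field_simp
  ring

lemma theta_mul_left {p : ℂ} (hp : ‖p‖ < 1) (hp0 : p ≠ 0) {z : ℂ} (hz : z ≠ 0) :
    theta p (p * z) = -z⁻¹ * theta p z := by
  rw [← theta_inv hp hz, theta_eq_qPochInf hp, theta_eq_qPochInf hp, inv_inv, mul_comm p z]
  rw [show (z * p)⁻¹ * p = z⁻¹ by
    rw [mul_inv, inv_mul_cancel_right₀ hp0]]
  ring

lemma theta_one {p : ℂ} (hp : ‖p‖ < 1) : theta p 1 = 0 := by
  rw [theta_eq_qPochInf hp, qPochInf_eq_mul hp]; simp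

/-- An absolutely convergent product vanishes only if one of its factors does, so the zeros of θ lie
in the single orbit of 1 under multiplication by p. -/
lemma exists_zpow_of_theta_eq_zero {p : ℂ} (hp : ‖p‖ < 1) (_hp0 : p ≠ 0) {z : ℂ} (hz : z ≠ 0)
    (h : theta p z = 0) : ∃ k : ℤ, z = p ^ k := by
  rw [theta_eq_qPochInf hp] at h
  by_contra! hk
  rcases mul_eq_zero.mp h with h | h
  · refine qPochInf_ne_zero hp (fun k hk' => hk (-k) ?_) h
    rw [zpow_neg, zpow_natCast]; exact eq_inv_of_mul_eq_one_left hk'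
  · refine qPochInf_ne_zero hp (fun k hk' => hk (k + 1) ?_) h
    have : p ^ (k + 1) = z := by
      field_simp at hk'
      rw [pow_succ']; exact hk'
    rw [← this]; norm_cast

lemma continuousAt_qPochInf {p a : ℂ} (hp : ‖p‖ < 1) :
    ContinuousAt (fun y : ℂ × ℂ => qPochInf y.1 y.2) (p, a) := by
  -- The nome has to vary too: ρ strictly between ‖p‖ and 1 gives a geometric majorant valid for all
  -- nearby nomes.
  obtain ⟨ρ, h1, h2⟩ := exists_between hp
  set K : Set (ℂ × ℂ) := {y | ‖y.1‖ < ρ ∧ ‖y.2‖ < ‖a‖ + 1}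
  have hK : IsOpen K := (isOpen_lt (f := fun y : ℂ × ℂ => ‖y.1‖) (by fun_prop)
    continuous_const).inter (isOpen_lt (f := fun y : ℂ × ℂ => ‖y.2‖) (by fun_prop) continuous_const)
  have hu : Summable fun k : ℕ => (‖a‖ + 1) * ρ ^ k :=
    (summable_geometric_of_lt_one ((norm_nonneg p).trans h1.le) h2).mul_left _
  have H := hu.hasProdLocallyUniformlyOn_nat_one_add (f := fun k (y : ℂ × ℂ) => -(y.2 * y.1 ^ k)) hK
    (.of_forall fun k y hy => by
      rw [norm_neg, norm_mul, norm_pow]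
      have := hy.1.le
      have := hy.2.le
      gcongr) (fun k => by fun_prop)
  rw [hasProdLocallyUniformlyOn_iff_tendstoLocallyUniformlyOn] at H
  have hc := H.continuousOn (.of_forall fun s => by fun_prop)
  simpa [qPochInf, sub_eq_add_neg] using hc.continuousAt (hK.mem_nhds ⟨h1, by simp⟩)

lemma analyticAt_qPochInf {p : ℂ} (hp : ‖p‖ < 1) (a : ℂ) : AnalyticAt ℂ (qPochInf p) a := by
  set K : Set ℂ := {y | ‖y‖ < ‖a‖ + 1}
  have hK : IsOpen K := isOpen_lt (by fun_prop) (by fun_prop)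
  have hu : Summable fun k : ℕ => (‖a‖ + 1) * ‖p‖ ^ k :=
    (summable_geometric_of_lt_one (norm_nonneg p) hp).mul_left _
  have H := hu.hasProdLocallyUniformlyOn_nat_one_add (f := fun k (y : ℂ) => -(y * p ^ k)) hK
    (.of_forall fun k y hy => by
      rw [norm_neg, norm_mul, norm_pow]
      have : ‖y‖ ≤ ‖a‖ + 1 := le_of_lt hy
      gcongr) (fun k => by fun_prop)
  rw [hasProdLocallyUniformlyOn_iff_tendstoLocallyUniformlyOn] at H
  have hc := H.differentiableOn (.of_forall fun s => by fun_prop) hK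
  have := hc.analyticAt (hK.mem_nhds (show ‖a‖ < ‖a‖ + 1 by simp))
  have e : qPochInf p = fun y => ∏' i : ℕ, (1 + -(y * p ^ i)) := by
    ext y; simp [qPochInf, sub_eq_add_neg]
  rw [e]; exact this

lemma theta_eq_fun {p : ℂ} (hp : ‖p‖ < 1) :
    theta p = fun z => qPochInf p z * qPochInf p (z⁻¹ * p) :=
  funext fun z => theta_eq_qPochInf hp z

lemma analyticAt_theta {p : ℂ} (hp : ‖p‖ < 1) {z : ℂ} (hz : z ≠ 0) : AnalyticAt ℂ (theta p) z := by
  rw [theta_eq_fun hp]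
  have h : AnalyticAt ℂ (fun z : ℂ => z⁻¹ * p) z := (analyticAt_inv hz).mul analyticAt_const
  exact (analyticAt_qPochInf hp z).mul ((analyticAt_qPochInf hp _).comp h)

/-- `θ` is jointly continuous in the nome and the variable. -/
lemma continuousAt_theta {p z : ℂ} (hp : ‖p‖ < 1) (hz : z ≠ 0) :
    ContinuousAt (fun y : ℂ × ℂ => theta y.1 y.2) (p, z) := by
  have h1 : ContinuousAt (fun y : ℂ × ℂ => qPochInf y.1 y.2 * qPochInf y.1 (y.2⁻¹ * y.1)) (p, z) := by
    refine (continuousAt_qPochInf hp).mul ?_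
    have h2 : ContinuousAt (fun y : ℂ × ℂ => (y.1, y.2⁻¹ * y.1)) (p, z) := by
      have : ContinuousAt (fun y : ℂ × ℂ => y.2⁻¹) (p, z) := continuousAt_snd.inv₀ hz
      fun_prop
    exact ContinuousAt.comp (f := fun y : ℂ × ℂ => (y.1, y.2⁻¹ * y.1))
      (g := fun y : ℂ × ℂ => qPochInf y.1 y.2) (continuousAt_qPochInf hp) h2
  refine h1.congr ?_
  have : ∀ᶠ y : ℂ × ℂ in 𝓝 (p, z), ‖y.1‖ < 1 :=
    (continuous_fst.norm).continuousAt.eventually_lt continuousAt_const hp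
  filter_upwards [this] with y hy
  exact (theta_eq_qPochInf hy _).symm

/-- `θ` has a simple zero at `1`. -/
lemma exists_theta_eq_mul {p : ℂ} (hp : ‖p‖ < 1) :
    ∃ h : ℂ → ℂ, ContinuousAt h 1 ∧ h 1 ≠ 0 ∧ ∀ z, theta p z = (1 - z) * h z := by
  refine ⟨fun z => qPochInf p (z * p) * qPochInf p (z⁻¹ * p), ?_, ?_, fun z => ?_⟩
  · have h1 : ContinuousAt (fun z : ℂ => z⁻¹ * p) 1 :=
      (continuousAt_inv₀ one_ne_zero).mul continuousAt_const
    have h2 : ContinuousAt (fun z : ℂ => z * p) 1 := by fun_prop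
    exact ((analyticAt_qPochInf hp _).continuousAt.comp h2).mul
      ((analyticAt_qPochInf hp _).continuousAt.comp h1)
  · have : qPochInf p p ≠ 0 := qPochInf_ne_zero hp fun k hk => by
      rw [← pow_succ'] at hk
      have h3 := congrArg norm hk
      rw [norm_pow, norm_one] at h3
      exact (pow_lt_one₀ (norm_nonneg p) hp k.succ_ne_zero).ne h3
    simpa using this
  · rw [theta_eq_qPochInf hp, qPochInf_eq_mul hp z]; ring

/-! ### Removable poles and Liouville's theorem for multiplicatively periodic functions -/

/-- The function `f` has no pole at `c` (for `f` meromorphic at `c`). -/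
def NoPole (f : ℂ → ℂ) (c : ℂ) : Prop := Tendsto (fun z => (z - c) * f z) (𝓝[≠] c) (𝓝 0)

/-- Riemann's removable singularity theorem: a meromorphic f is analytic on a punctured ball, and
the hypothesis says that f − f(c) is o(1/(z − c)). -/
lemma NoPole.exists_analyticAt {f : ℂ → ℂ} {c : ℂ} (hf : MeromorphicAt f c) (h : NoPole f c) :
    ∃ G : ℂ → ℂ, AnalyticAt ℂ G c ∧ ∀ᶠ u in 𝓝[≠] c, f u = G u := by
  have h1 := hf.eventually_analyticAt
  rw [eventually_nhdsWithin_iff, Metric.eventually_nhds_iff_ball] at h1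
  obtain ⟨ε, hε, h2⟩ := h1
  have hs := Metric.ball_mem_nhds c hε
  have hd : DifferentiableOn ℂ f (Metric.ball c ε \ {c}) := fun u hu =>
    (h2 u hu.1 hu.2).differentiableAt.differentiableWithinAt
  have hne : ∀ᶠ z in 𝓝[≠] c, z ≠ c := eventually_mem_nhdsWithin
  have ho : (fun z => f z - f c) =o[𝓝[≠] c] fun z => (z - c)⁻¹ := by
    rw [Asymptotics.isLittleO_iff_tendsto']
    · have h3 : Tendsto (fun z : ℂ => (z - c) * f c) (𝓝[≠] c) (𝓝 0) := by
        have : ContinuousAt (fun z : ℂ => (z - c) * f c) c := by fun_prop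
        simpa [ContinuousAt] using this.tendsto.mono_left (nhdsWithin_le_nhds (s := {c}ᶜ))
      have h4 := Tendsto.sub h h3
      rw [sub_zero] at h4
      refine h4.congr' (.of_forall fun z => ?_)
      show _ = (f z - f c) / (z - c)⁻¹
      rw [div_inv_eq_mul]; ring
    · filter_upwards [hne] with z hz h0
      exact absurd h0 (inv_ne_zero (sub_ne_zero.mpr hz))
  have h5 := Complex.differentiableOn_update_limUnder_of_isLittleO hs hd ho
  refine ⟨_, h5.analyticAt hs, ?_⟩
  filter_upwards [hne] with z hz
  rw [Function.update_of_ne hz]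

lemma exists_annulus_rep {p : ℂ} (hp : ‖p‖ < 1) (hp0 : p ≠ 0) {z : ℂ} (hz : z ≠ 0) :
    ∃ k : ℤ, ‖p‖ ≤ ‖p ^ k * z‖ ∧ ‖p ^ k * z‖ ≤ 1 := by
  have hpp := norm_pos_iff.mpr hp0
  obtain ⟨n, h1, h2⟩ := exists_mem_Ico_zpow (norm_pos_iff.mpr hz) ((one_lt_inv₀ hpp).mpr hp)
  refine ⟨n + 1, ?_⟩
  rw [inv_zpow] at h1 h2
  have hn : 0 < ‖p‖ ^ n := zpow_pos hpp _
  rw [inv_le_iff_one_le_mul₀ hn] at h1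
  rw [zpow_add_one₀ hpp.ne', ← one_div, lt_div_iff₀ (by positivity)] at h2
  rw [norm_mul, norm_zpow, zpow_add_one₀ hpp.ne']
  constructor
  · nlinarith
  · linarith

lemma zpow_mul_periodic {p : ℂ} (hp0 : p ≠ 0) {f : ℂ → ℂ} (hper : ∀ z ≠ 0, f (p * z) = f z)
    (k : ℤ) : ∀ z ≠ 0, f (p ^ k * z) = f z := by
  induction k with
  | zero => simp
  | succ k ih =>
    intro z hz
    rw [zpow_add_one₀ hp0, mul_assoc, ih _ (mul_ne_zero hp0 hz), hper z hz]
  | pred k ih =>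
    intro z hz
    rw [← hper _ (mul_ne_zero (zpow_ne_zero _ hp0) hz), ← mul_assoc, ← zpow_one_add₀ hp0,
      ← ih z hz]
    congr 3; ring

/-- A pole-free meromorphic function on `ℂ \ {0}` with `f (p z) = f z` is constant. -/
lemma eq_of_mul_periodic {p : ℂ} (hp : ‖p‖ < 1) (hp0 : p ≠ 0) {f : ℂ → ℂ}
    (hf : ∀ z ≠ 0, MeromorphicAt f z) (hper : ∀ z ≠ 0, f (p * z) = f z)
    (hn : ∀ z ≠ 0, NoPole f z) {y z : ℂ} (hy : y ≠ 0) (hz : z ≠ 0)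
    (hcy : ContinuousAt f y) (hcz : ContinuousAt f z) : f y = f z := by
  -- F is f with its removable singularities filled in; it agrees with f wherever f is continuous.
  set F : ℂ → ℂ := fun z => limUnder (𝓝[≠] z) f with hF
  have key : ∀ z ≠ 0, AnalyticAt ℂ F z ∧ Tendsto f (𝓝[≠] z) (𝓝 (F z)) := by
    intro z hz
    obtain ⟨G, hG, he⟩ := (hn z hz).exists_analyticAt (hf z hz)
    have hlim : Tendsto f (𝓝[≠] z) (𝓝 (G z)) :=
      (hG.continuousAt.tendsto.mono_left nhdsWithin_le_nhds).congr' (he.mono fun _ h => h.symm)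
    have hz' : F z = G z := hlim.limUnder_eq
    refine ⟨hG.congr ?_, hz' ▸ hlim⟩
    have h1 := (hf z hz).eventually_analyticAt
    rw [eventually_nhdsWithin_iff] at h1 he
    filter_upwards [h1, he] with u hu1 hu2
    rcases eq_or_ne u z with rfl | hne
    · exact hz'.symm
    · rw [← hu2 hne]
      exact ((hu1 hne).continuousAt.tendsto.mono_left nhdsWithin_le_nhds).limUnder_eq.symm
  have hFc : ∀ u ≠ 0, ContinuousAt f u → F u = f u := fun u _ hc =>
    (hc.tendsto.mono_left nhdsWithin_le_nhds).limUnder_eq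
  have hFper : ∀ z ≠ 0, F (p * z) = F z := by
    intro z hz
    have h1 : Tendsto (fun u => p * u) (𝓝[≠] z) (𝓝[≠] (p * z)) := by
      refine tendsto_nhdsWithin_of_tendsto_nhds_of_eventually_within _ ?_ ?_
      · exact (continuous_const_mul p).continuousAt.tendsto.mono_left nhdsWithin_le_nhds
      · filter_upwards [eventually_mem_nhdsWithin] with u hu
        simpa [hp0] using hu
    have h2 := (key (p * z) (mul_ne_zero hp0 hz)).2.comp h1
    refine tendsto_nhds_unique (h2.congr' ?_) (key z hz).2
    have : ∀ᶠ u in 𝓝[≠] z, u ≠ 0 := (eventually_ne_nhds hz).filter_mono nhdsWithin_le_nhds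
    filter_upwards [this] with u hu using hper u hu
  -- Pulling back along exp removes the puncture at 0 and gives an entire function.
  have hdiff : Differentiable ℂ (fun s => F (Complex.exp s)) := fun s =>
    ((key _ (Complex.exp_ne_zero s)).1.differentiableAt).comp s Complex.differentiableAt_exp
  -- The compact annulus ‖p‖ ≤ ‖z‖ ≤ 1 meets every orbit of z ↦ pz, so the values of F are already
  -- attained there.
  have hbdd : Bornology.IsBounded (Set.range fun s => F (Complex.exp s)) := by
    set K : Set ℂ := {z | ‖p‖ ≤ ‖z‖ ∧ ‖z‖ ≤ 1} with hK
    have hKc : IsCompact K := by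
      refine Metric.isCompact_of_isClosed_isBounded ?_ ?_
      · exact (isClosed_le continuous_const continuous_norm).inter
          (isClosed_le continuous_norm continuous_const)
      · exact (Metric.isBounded_closedBall (x := (0 : ℂ)) (r := 1)).subset
          fun z hz => by simpa using hz.2
    have hKF : ContinuousOn F K := fun z hz => by
      have : z ≠ 0 := norm_pos_iff.mp ((norm_pos_iff.mpr hp0).trans_le hz.1)
      exact (key z this).1.continuousAt.continuousWithinAt
    refine (hKc.image_of_continuousOn hKF).isBounded.subset ?_
    rintro _ ⟨s, rfl⟩
    obtain ⟨k, hk⟩ := exists_annulus_rep hp hp0 (Complex.exp_ne_zero s)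
    exact ⟨_, hk, zpow_mul_periodic hp0 hFper k _ (Complex.exp_ne_zero s)⟩
  have := hdiff.apply_eq_apply_of_bounded hbdd (Complex.log y) (Complex.log z)
  simp only [Complex.exp_log hy, Complex.exp_log hz] at this
  rw [← hFc y hy hcy, ← hFc z hz hcz, this]

lemma NoPole.of_continuousAt {f : ℂ → ℂ} {c : ℂ} (h : ContinuousAt f c) : NoPole f c := by
  have : ContinuousAt (fun z => (z - c) * f z) c := by fun_prop
  simpa [ContinuousAt, NoPole] using this.tendsto.mono_left (nhdsWithin_le_nhds (s := {c}ᶜ))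

lemma NoPole.comp_mul {f g : ℂ → ℂ} {k c : ℂ} (hk : k ≠ 0) (hc : c ≠ 0)
    (hfg : ∀ z ≠ 0, g z = f (k * z)) (h : NoPole f (k * c)) : NoPole g c := by
  have h1 : Tendsto (fun u => k * u) (𝓝[≠] c) (𝓝[≠] (k * c)) := by
    refine tendsto_nhdsWithin_of_tendsto_nhds_of_eventually_within _ ?_ ?_
    · exact (continuous_const_mul k).continuousAt.tendsto.mono_left nhdsWithin_le_nhds
    · filter_upwards [eventually_mem_nhdsWithin] with u hu
      simpa [hk] using hu
  have h2 := (Tendsto.comp h h1).const_mul k⁻¹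
  rw [mul_zero] at h2
  refine h2.congr' ?_
  have : ∀ᶠ u in 𝓝[≠] c, u ≠ 0 := (eventually_ne_nhds hc).filter_mono nhdsWithin_le_nhds
  filter_upwards [this] with u hu
  simp only [Function.comp]
  rw [hfg u hu]; field_simp

lemma NoPole.zpow_mul {p : ℂ} (hp0 : p ≠ 0) {f : ℂ → ℂ} (hper : ∀ z ≠ 0, f (p * z) = f z)
    {c : ℂ} (hc : c ≠ 0) (k : ℤ) (h : NoPole f c) : NoPole f (p ^ k * c) := by
  have hk : (p ^ k)⁻¹ ≠ 0 := inv_ne_zero (zpow_ne_zero _ hp0)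
  refine NoPole.comp_mul (f := f) hk (mul_ne_zero (zpow_ne_zero _ hp0) hc) (fun z hz => ?_) ?_
  · rw [← zpow_neg, zpow_mul_periodic hp0 hper _ z hz]
  · rwa [inv_mul_cancel_left₀ (zpow_ne_zero _ hp0)]

lemma NoPole.sub {f g : ℂ → ℂ} {c : ℂ} (hf : NoPole f c) (hg : NoPole g c) :
    NoPole (fun z => f z - g z) c := by
  have := Tendsto.sub hf hg
  rw [sub_zero] at this
  exact this.congr fun z => by ring

lemma NoPole.neg {f : ℂ → ℂ} {c : ℂ} (hf : NoPole f c) : NoPole (fun z => - f z) c := by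
  have := Tendsto.neg hf
  rw [neg_zero] at this
  exact this.congr fun z => by ring

lemma eventually_theta_div_ne_zero {p : ℂ} (hp : ‖p‖ < 1) {s : ℂ} (hs : s ≠ 0) :
    ∀ᶠ z in 𝓝[≠] s, theta p (z / s) ≠ 0 := by
  obtain ⟨h, h1, h2, h3⟩ := exists_theta_eq_mul hp
  have hc : ContinuousAt (fun z => h (z / s)) s := by
    have : ContinuousAt h (s / s) := by rwa [div_self hs]
    exact this.comp (f := fun z : ℂ => z / s) (by fun_prop)
  have h4 : ∀ᶠ z in 𝓝 s, h (z / s) ≠ 0 := hc.eventually_ne (by simpa [div_self hs] using h2)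
  filter_upwards [eventually_mem_nhdsWithin, h4.filter_mono nhdsWithin_le_nhds] with z hz hz'
  rw [h3]
  refine mul_ne_zero (fun h0 => hz ?_) hz'
  have : z / s = 1 := (sub_eq_zero.mp h0).symm
  simpa using (div_eq_one_iff_eq hs).mp this

/-- θ(z/s) has a simple zero at s and can therefore replace z − s as the local parameter. All
residues below are normalised this way, which keeps them products of theta values. -/
lemma NoPole.of_theta {p : ℂ} (hp : ‖p‖ < 1) {s : ℂ} (hs : s ≠ 0) {f : ℂ → ℂ}
    (hf : Tendsto (fun z => theta p (z / s) * f z) (𝓝[≠] s) (𝓝 0)) : NoPole f s := by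
  obtain ⟨h, h1, h2, h3⟩ := exists_theta_eq_mul hp
  have hc : ContinuousAt (fun z => h (z / s)) s := by
    have : ContinuousAt h (s / s) := by rwa [div_self hs]
    exact this.comp (f := fun z : ℂ => z / s) (by fun_prop)
  have h2' : h (s / s) ≠ 0 := by rwa [div_self hs]
  have h4 := (hc.inv₀ h2').tendsto.mono_left (nhdsWithin_le_nhds (s := {s}ᶜ))
  have h5 := (hf.mul h4).const_mul (-s)
  rw [zero_mul, mul_zero] at h5
  refine h5.congr' ?_
  have h6 : ∀ᶠ z in 𝓝[≠] s, h (z / s) ≠ 0 :=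
    (hc.eventually_ne h2').filter_mono nhdsWithin_le_nhds
  filter_upwards [h6] with z hz
  rw [h3, Pi.inv_apply]; field_simp; ring

/-- The residue of `g z / θ(z / s)` at `s`, normalised by `θ`. -/
lemma tendsto_theta_mul {p : ℂ} (hp : ‖p‖ < 1) {s : ℂ} (hs : s ≠ 0) {f g : ℂ → ℂ} {ρ : ℂ}
    (hg : ContinuousAt g s) (hfg : ∀ z ≠ 0, f z = g z / theta p (z / s)) (hρ : g s = ρ) :
    Tendsto (fun z => theta p (z / s) * f z) (𝓝[≠] s) (𝓝 ρ) := by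
  subst hρ
  refine (hg.tendsto.mono_left nhdsWithin_le_nhds).congr' ?_
  have : ∀ᶠ u in 𝓝[≠] s, u ≠ 0 := (eventually_ne_nhds hs).filter_mono nhdsWithin_le_nhds
  filter_upwards [this, eventually_theta_div_ne_zero hp hs] with z hz hz'
  rw [hfg z hz]; field_simp

lemma tendsto_theta_mul_of_continuousAt {p : ℂ} (hp : ‖p‖ < 1) {s : ℂ} (hs : s ≠ 0) {f : ℂ → ℂ}
    (hf : ContinuousAt f s) :
    Tendsto (fun z => theta p (z / s) * f z) (𝓝[≠] s) (𝓝 0) := by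
  have h1 : ContinuousAt (theta p) (s / s) := by
    rw [div_self hs]; exact (analyticAt_theta hp one_ne_zero).continuousAt
  have h2 : ContinuousAt (fun z => theta p (z / s) * f z) s :=
    (h1.comp (f := fun z : ℂ => z / s) (by fun_prop)).mul hf
  have := h2.tendsto.mono_left (nhdsWithin_le_nhds (s := {s}ᶜ))
  simpa [div_self hs, theta_one hp] using this

/-! ### Weighted sums over subsets -/

/-- A sum over the subsets `I` of `S` of a coefficient depending on `|I|`, single-element weights
for the elements inside and outside `I`, and pair weights between `I` and its complement. -/
noncomputable def subsetSum {ι : Type*} [DecidableEq ι] (c : ℕ → ℂ) (A B : ℕ → ι → ℂ)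
    (X : ι → ι → ℂ) (S : Finset ι) : ℂ :=
  ∑ I ∈ S.powerset, c I.card * (∏ i ∈ I, A I.card i) * (∏ j ∈ S \ I, B I.card j) *
    ∏ i ∈ I, ∏ j ∈ S \ I, X i j

section subsetSum

variable {ι : Type*} [DecidableEq ι]

/-- Split according to whether a belongs to the subset. The pair weights involving a are absorbed
into the single-element weights, so both halves are again sums of the same type. When a belongs to
it, r counts the other elements, whence the shift to r + 1. -/
lemma subsetSum_insert (c : ℕ → ℂ) (A B : ℕ → ι → ℂ) (X : ι → ι → ℂ) {S : Finset ι} {a : ι}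
    (ha : a ∉ S) :
    subsetSum c A B X (insert a S) =
      subsetSum (fun r => c r * B r a) (fun r i => A r i * X i a) B X S +
      subsetSum (fun r => c (r + 1) * A (r + 1) a) (fun r => A (r + 1))
        (fun r j => B (r + 1) j * X a j) X S := by
  unfold subsetSum
  rw [Finset.sum_powerset_insert ha]
  congr 1 <;> refine Finset.sum_congr rfl fun I hI => ?_
  · have hI := Finset.mem_powerset.mp hI
    have haI : a ∉ I := fun h => ha (hI h)
    have haS : a ∉ S \ I := fun h => ha (Finset.mem_sdiff.mp h).1
    rw [Finset.insert_sdiff_of_notMem _ haI, Finset.prod_insert haS,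
      Finset.prod_congr rfl (fun i _ => Finset.prod_insert (f := fun j => X i j) haS),
      Finset.prod_mul_distrib, Finset.prod_mul_distrib]
    ring
  · have hI := Finset.mem_powerset.mp hI
    have haI : a ∉ I := fun h => ha (hI h)
    have e : insert a S \ insert a I = S \ I := by
      ext j; simp only [Finset.mem_sdiff, Finset.mem_insert]
      constructor
      · rintro ⟨h1, h2⟩; tauto
      · rintro ⟨h1, h2⟩
        exact ⟨Or.inr h1, fun h => h.elim (fun h => ha (h ▸ h1)) h2⟩
    rw [e, Finset.prod_insert haI, Finset.prod_insert haI, Finset.card_insert_of_notMem haI,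
      Finset.prod_mul_distrib]
    ring

/-- If elements inside and outside the subset carry the same extra factor g, these factors multiply
to the product over all of S, whatever the subset. The weights need comparing only at cardinalities
whose coefficient is nonzero, which is essential when a residue retains a single cardinality. -/
lemma subsetSum_congr_scale {c c' : ℕ → ℂ} {A B A' B' : ℕ → ι → ℂ} {X X' : ι → ι → ℂ}
    {S : Finset ι} (K : ℂ) (g : ι → ℂ) (hc : ∀ r, c r = K * c' r)
    (hA : ∀ r, c' r ≠ 0 → ∀ i ∈ S, A r i = g i * A' r i)
    (hB : ∀ r, c' r ≠ 0 → ∀ i ∈ S, B r i = g i * B' r i)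
    (hX : ∀ i ∈ S, ∀ j ∈ S, i ≠ j → X i j = X' i j) :
    subsetSum c A B X S = (K * ∏ i ∈ S, g i) * subsetSum c' A' B' X' S := by
  unfold subsetSum
  rw [Finset.mul_sum]
  refine Finset.sum_congr rfl fun I hI => ?_
  have hI := Finset.mem_powerset.mp hI
  by_cases h0 : c' I.card = 0
  · simp [hc, h0]
  rw [hc, Finset.prod_congr rfl (fun i hi => hA _ h0 i (hI hi)),
    Finset.prod_congr rfl (fun j hj => hB _ h0 j (Finset.mem_sdiff.mp hj).1),
    Finset.prod_congr rfl (fun i hi => Finset.prod_congr rfl fun j hj =>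
      hX i (hI hi) j (Finset.mem_sdiff.mp hj).1
        (fun h => (Finset.mem_sdiff.mp hj).2 (h ▸ hi))),
    Finset.prod_mul_distrib, Finset.prod_mul_distrib, ← Finset.prod_sdiff hI]
  ring

lemma subsetSum_congr {c c' : ℕ → ℂ} {A B A' B' : ℕ → ι → ℂ} {X X' : ι → ι → ℂ}
    {S : Finset ι} (hc : ∀ r, c r = c' r)
    (hA : ∀ r, ∀ i ∈ S, A r i = A' r i) (hB : ∀ r, ∀ i ∈ S, B r i = B' r i)
    (hX : ∀ i ∈ S, ∀ j ∈ S, i ≠ j → X i j = X' i j) :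
    subsetSum c A B X S = subsetSum c' A' B' X' S := by
  simpa using subsetSum_congr_scale (S := S) (c := c) (c' := c') (A := A) (A' := A') (B := B)
    (B' := B') (X := X) (X' := X') 1 (fun _ => 1) (by simpa using hc)
    (fun r _ => by simpa using hA r) (fun r _ => by simpa using hB r) hX

/-- A factor l on each chosen element contributes l to the power of the cardinality. This absorbs
the powers of q²/t² arising in the duality. -/
lemma subsetSum_twist {k l : ℂ} (hk : k * l = 1) (c : ℕ → ℂ) (A B : ℕ → ι → ℂ)
    (X : ι → ι → ℂ) (S : Finset ι) :
    subsetSum (fun r => k ^ r * c r) (fun r i => l * A r i) B X S = subsetSum c A B X S := by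
  unfold subsetSum
  refine Finset.sum_congr rfl fun I _ => ?_
  rw [Finset.prod_mul_distrib, Finset.prod_const]
  have : k ^ I.card * l ^ I.card = 1 := by rw [← mul_pow, hk, one_pow]
  linear_combination (c I.card * (∏ i ∈ I, A I.card i) * (∏ j ∈ S \ I, B I.card j) *
    ∏ i ∈ I, ∏ j ∈ S \ I, X i j) * this

lemma subsetSum_congr_twist {k l : ℂ} (hk : k * l = 1) {c c' : ℕ → ℂ} {A B A' B' : ℕ → ι → ℂ}
    {X X' : ι → ι → ℂ} {S : Finset ι} (hc : ∀ r, c r = k ^ r * c' r)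
    (hA : ∀ r, ∀ i ∈ S, A r i = l * A' r i) (hB : ∀ r, ∀ i ∈ S, B r i = B' r i)
    (hX : ∀ i ∈ S, ∀ j ∈ S, i ≠ j → X i j = X' i j) :
    subsetSum c A B X S = subsetSum c' A' B' X' S :=
  (subsetSum_congr hc hA hB hX).trans (subsetSum_twist hk c' A' B' X' S)

lemma mul_subsetSum (k : ℂ) (c : ℕ → ℂ) (A B : ℕ → ι → ℂ) (X : ι → ι → ℂ) (S : Finset ι) :
    k * subsetSum c A B X S = subsetSum (fun r => k * c r) A B X S := by
  unfold subsetSum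
  rw [Finset.mul_sum]
  exact Finset.sum_congr rfl fun I _ => by ring

lemma subsetSum_zero {c : ℕ → ℂ} (hc : ∀ r, c r = 0) (A B : ℕ → ι → ℂ) (X : ι → ι → ℂ)
    (S : Finset ι) : subsetSum c A B X S = 0 := by
  simp [subsetSum, hc]

lemma tendsto_subsetSum {α : Type*} {l : Filter α} {c : α → ℕ → ℂ} {A B : α → ℕ → ι → ℂ}
    {X : α → ι → ι → ℂ} {c' : ℕ → ℂ} {A' B' : ℕ → ι → ℂ} {X' : ι → ι → ℂ} {S : Finset ι}
    (hc : ∀ I ⊆ S, Tendsto (fun z => c z I.card) l (𝓝 (c' I.card)))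
    (hA : ∀ I ⊆ S, ∀ i ∈ I, Tendsto (fun z => A z I.card i) l (𝓝 (A' I.card i)))
    (hB : ∀ I ⊆ S, ∀ j ∈ S \ I, Tendsto (fun z => B z I.card j) l (𝓝 (B' I.card j)))
    (hX : ∀ I ⊆ S, ∀ i ∈ I, ∀ j ∈ S \ I, Tendsto (fun z => X z i j) l (𝓝 (X' i j))) :
    Tendsto (fun z => subsetSum (c z) (A z) (B z) (X z) S) l (𝓝 (subsetSum c' A' B' X' S)) := by
  refine tendsto_finsetSum _ fun I hI => ?_
  have hI := Finset.mem_powerset.mp hI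
  exact (((hc I hI).mul (tendsto_finsetProd _ (hA I hI))).mul
    (tendsto_finsetProd _ (hB I hI))).mul
    (tendsto_finsetProd _ fun i hi => tendsto_finsetProd _ (hX I hI i hi))

/-- For residue computations: k is a vanishing theta factor, placed in the coefficient because that
is where the singular weight sits. -/
lemma tendsto_mul_subsetSum {α : Type*} {l : Filter α} (k : α → ℂ) {c : α → ℕ → ℂ}
    {A B : α → ℕ → ι → ℂ} {X : α → ι → ι → ℂ} {c' : ℕ → ℂ} {A' B' : ℕ → ι → ℂ}
    {X' : ι → ι → ℂ} {S : Finset ι}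
    (hc : ∀ I ⊆ S, Tendsto (fun z => k z * c z I.card) l (𝓝 (c' I.card)))
    (hA : ∀ I ⊆ S, ∀ i ∈ I, Tendsto (fun z => A z I.card i) l (𝓝 (A' I.card i)))
    (hB : ∀ I ⊆ S, ∀ j ∈ S \ I, Tendsto (fun z => B z I.card j) l (𝓝 (B' I.card j)))
    (hX : ∀ I ⊆ S, ∀ i ∈ I, ∀ j ∈ S \ I, Tendsto (fun z => X z i j) l (𝓝 (X' i j))) :
    Tendsto (fun z => k z * subsetSum (c z) (A z) (B z) (X z) S) l
      (𝓝 (subsetSum c' A' B' X' S)) := by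
  simp_rw [mul_subsetSum]
  exact tendsto_subsetSum hc hA hB hX

lemma meromorphicAt_subsetSum {z : ℂ} {c : ℂ → ℕ → ℂ} {A B : ℂ → ℕ → ι → ℂ}
    {X : ℂ → ι → ι → ℂ} {S : Finset ι}
    (hc : ∀ r, MeromorphicAt (fun z => c z r) z)
    (hA : ∀ r i, i ∈ S → MeromorphicAt (fun z => A z r i) z)
    (hB : ∀ r i, i ∈ S → MeromorphicAt (fun z => B z r i) z)
    (hX : ∀ i j, MeromorphicAt (fun z => X z i j) z) :
    MeromorphicAt (fun z => subsetSum (c z) (A z) (B z) (X z) S) z := by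
  refine MeromorphicAt.fun_sum fun I hI => ?_
  have hI := Finset.mem_powerset.mp hI
  exact (((hc _).fun_mul (MeromorphicAt.fun_prod fun i hi => hA _ i (hI hi))).fun_mul
    (MeromorphicAt.fun_prod fun j hj => hB _ j (Finset.mem_sdiff.mp hj).1)).fun_mul
    (MeromorphicAt.fun_prod fun i _ => MeromorphicAt.fun_prod fun j _ => hX i j)

end subsetSum

/-! ### The weights of the two sums, and the sums with one distinguished variable -/

section weights

variable (p v w q t : ℂ)

/-- The coefficient depending on the cardinality `r`. -/
noncomputable def coef (r : ℕ) : ℂ :=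
  (thetaPoch q p v r * thetaPoch q p w r) /
    (thetaPoch q p (q * v / t) r * thetaPoch q p (q * w / t) r)

/-- The weight in `L` of an element of the subset. -/
noncomputable def wLin (r : ℕ) (z : ℂ) : ℂ :=
  (q * theta p (v * z / (t * w)) * theta p (t * q ^ (-(r : ℤ)) * z / (q * w))) /
    (t * theta p (v * z / (q * w)) * theta p (q ^ (-(r : ℤ)) * z / w))

/-- The weight in `L` of an element outside the subset. -/
noncomputable def wLout (r : ℕ) (z : ℂ) : ℂ :=
  (theta p (z / q) * theta p (q ^ (-(r : ℤ)) * z / (t * w))) /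
    (theta p (z / t) * theta p (q ^ (-(r : ℤ)) * z / (q * w)))

/-- The weight in `R` of an element of the subset. -/
noncomputable def wRin (r : ℕ) (z : ℂ) : ℂ :=
  (q * theta p (z / q) * theta p (q ^ r * v * z / t ^ 2)) /
    (t * theta p (z / t) * theta p (q ^ r * v * z / (t * q)))

/-- The weight in `R` of an element outside the subset. -/
noncomputable def wRout (r : ℕ) (z : ℂ) : ℂ :=
  (theta p (v * z / (t * w)) * theta p (q ^ r * v * z / q)) /
    (theta p (v * z / (q * w)) * theta p (q ^ r * v * z / t))

/-- The interaction between an element inside and an element outside the subset. -/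
noncomputable def wPair (y z : ℂ) : ℂ :=
  (theta p (t * y / (q * z)) * theta p (q * y / z)) / (theta p (y / z) * theta p (t * y / z))

variable {ι : Type*} [DecidableEq ι]

/-- The sum `L` over an arbitrary finite index set. -/
noncomputable def LSum (x : ι → ℂ) (S : Finset ι) : ℂ :=
  subsetSum (coef p v w q t) (fun r i => wLin p v w q t r (x i))
    (fun r j => wLout p w q t r (x j)) (fun i j => wPair p q t (x i) (x j)) S

/-- The sum `R` over an arbitrary finite index set. -/
noncomputable def RSum (x : ι → ℂ) (S : Finset ι) : ℂ :=
  subsetSum (coef p v w q t) (fun r i => wRin p v q t r (x i))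
    (fun r j => wRout p v w q t r (x j)) (fun i j => wPair p q t (x j) (x i)) S

/-- The sum `L` over the variables `x i`, `i ∈ S`, and one more variable `z`. -/
noncomputable def LSumInsert (x : ι → ℂ) (S : Finset ι) (z : ℂ) : ℂ :=
  subsetSum (fun r => coef p v w q t r * wLout p w q t r z)
    (fun r i => wLin p v w q t r (x i) * wPair p q t (x i) z)
    (fun r j => wLout p w q t r (x j)) (fun i j => wPair p q t (x i) (x j)) S +
  subsetSum (fun r => coef p v w q t (r + 1) * wLin p v w q t (r + 1) z)
    (fun r i => wLin p v w q t (r + 1) (x i))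
    (fun r j => wLout p w q t (r + 1) (x j) * wPair p q t z (x j))
    (fun i j => wPair p q t (x i) (x j)) S

/-- The sum `R` over the variables `x i`, `i ∈ S`, and one more variable `z`. -/
noncomputable def RSumInsert (x : ι → ℂ) (S : Finset ι) (z : ℂ) : ℂ :=
  subsetSum (fun r => coef p v w q t r * wRout p v w q t r z)
    (fun r i => wRin p v q t r (x i) * wPair p q t z (x i))
    (fun r j => wRout p v w q t r (x j)) (fun i j => wPair p q t (x j) (x i)) S +
  subsetSum (fun r => coef p v w q t (r + 1) * wRin p v q t (r + 1) z)
    (fun r i => wRin p v q t (r + 1) (x i))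
    (fun r j => wRout p v w q t (r + 1) (x j) * wPair p q t (x j) z)
    (fun i j => wPair p q t (x j) (x i)) S

lemma LSum_insert (x : ι → ℂ) {S : Finset ι} {a : ι} (ha : a ∉ S) :
    LSum p v w q t x (insert a S) = LSumInsert p v w q t x S (x a) :=
  subsetSum_insert _ _ _ _ ha

lemma RSum_insert (x : ι → ℂ) {S : Finset ι} {a : ι} (ha : a ∉ S) :
    RSum p v w q t x (insert a S) = RSumInsert p v w q t x S (x a) :=
  subsetSum_insert _ _ _ _ ha

lemma sum_range_powersetCard_eq {n : ℕ} (c : ℕ → ℂ) (A B : ℕ → Fin n → ℂ)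
    (X : Fin n → Fin n → ℂ) :
    ∑ r ∈ Finset.range (n + 1), c r *
      ∑ I ∈ Finset.powersetCard r (Finset.univ : Finset (Fin n)),
        (∏ i ∈ I, A r i) * (∏ j ∈ Iᶜ, B r j) * (∏ i ∈ I, ∏ j ∈ Iᶜ, X i j) =
    subsetSum c A B X Finset.univ := by
  unfold subsetSum
  rw [Finset.sum_powerset]
  simp only [Finset.card_univ, Fintype.card_fin]
  refine Finset.sum_congr rfl fun r _ => ?_
  rw [Finset.mul_sum]
  refine Finset.sum_congr rfl fun I hI => ?_
  rw [(Finset.mem_powersetCard.mp hI).2, Finset.compl_eq_univ_sdiff]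
  ring

lemma L_eq_LSum {n : ℕ} (x : Fin n → ℂ) : L x v w q t p = LSum p v w q t x Finset.univ :=
  sum_range_powersetCard_eq (coef p v w q t) (fun r i => wLin p v w q t r (x i))
    (fun r j => wLout p w q t r (x j)) (fun i j => wPair p q t (x i) (x j))

lemma R_eq_RSum {n : ℕ} (x : Fin n → ℂ) : R x v w q t p = RSum p v w q t x Finset.univ :=
  sum_range_powersetCard_eq (coef p v w q t) (fun r i => wRin p v q t r (x i))
    (fun r j => wRout p v w q t r (x j)) (fun i j => wPair p q t (x j) (x i))

end weights

/-! ### Duality between L and R under inversion of the parameters -/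

section duality

variable {p v w q t : ℂ}

lemma theta_of_mul_eq_one (hp : ‖p‖ < 1) {a b : ℂ} (h : a * b = 1) :
    theta p a = -a * theta p b := by
  have hb : b ≠ 0 := right_ne_zero_of_mul_eq_one h
  rw [eq_inv_of_mul_eq_one_left h, theta_inv hp hb]

lemma theta_of_eq_mul (hp : ‖p‖ < 1) (hp0 : p ≠ 0) {a b : ℂ} (hb : b ≠ 0) (h : a = p * b) :
    theta p a = -b⁻¹ * theta p b := by
  rw [h, theta_mul_left hp hp0 hb]

lemma coef_zero : coef p v w q t 0 = 1 := by simp [coef, thetaPoch]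

lemma coef_succ (r : ℕ) : coef p v w q t (r + 1) = coef p v w q t r *
    ((theta p (v * q ^ r) * theta p (w * q ^ r)) /
      (theta p (q * v / t * q ^ r) * theta p (q * w / t * q ^ r))) := by
  simp only [coef, thetaPoch, Finset.prod_range_succ]
  rw [div_mul_div_comm]
  congr 1 <;> ring

/-- Inverting the argument of each theta by θ(1/a) = −θ(a)/a leaves, for every step in r, the
monomial (qv/t)(qw/t)/(vw) = q²/t². -/
lemma coef_dual (hp : ‖p‖ < 1) (hv : v ≠ 0) (hw : w ≠ 0) (hq : q ≠ 0) (ht : t ≠ 0) (r : ℕ) :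
    coef p v⁻¹ w⁻¹ q⁻¹ t⁻¹ r = (q ^ 2 / t ^ 2) ^ r * coef p v w q t r := by
  induction r with
  | zero => simp [coef_zero]
  | succ r ih =>
    rw [coef_succ, coef_succ, ih,
      theta_of_mul_eq_one hp (show v⁻¹ * q⁻¹ ^ r * (v * q ^ r) = 1 by rw [inv_pow]; field_simp),
      theta_of_mul_eq_one hp (show w⁻¹ * q⁻¹ ^ r * (w * q ^ r) = 1 by rw [inv_pow]; field_simp),
      theta_of_mul_eq_one hp (show q⁻¹ * v⁻¹ / t⁻¹ * q⁻¹ ^ r * (q * v / t * q ^ r) = 1 by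
        rw [inv_pow]; field_simp),
      theta_of_mul_eq_one hp (show q⁻¹ * w⁻¹ / t⁻¹ * q⁻¹ ^ r * (q * w / t * q ^ r) = 1 by
        rw [inv_pow]; field_simp), pow_succ (q ^ 2 / t ^ 2)]
    field_simp

lemma wLin_dual (hv : v ≠ 0) (hw : w ≠ 0) (hq : q ≠ 0) (ht : t ≠ 0) (r : ℕ) (z : ℂ) :
    wLin p v⁻¹ w⁻¹ q⁻¹ t⁻¹ r (q⁻¹ * t⁻¹ * v * w⁻¹ * z) =
      t ^ 2 / q ^ 2 * wRin p v q t r z := by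
  unfold wLin wRin
  rw [show q⁻¹ ^ (-(r : ℤ)) = q ^ r by simp]
  rw [show v⁻¹ * (q⁻¹ * t⁻¹ * v * w⁻¹ * z) / (t⁻¹ * w⁻¹) = z / q by field_simp,
    show t⁻¹ * q ^ r * (q⁻¹ * t⁻¹ * v * w⁻¹ * z) / (q⁻¹ * w⁻¹) = q ^ r * v * z / t ^ 2 by
      field_simp,
    show v⁻¹ * (q⁻¹ * t⁻¹ * v * w⁻¹ * z) / (q⁻¹ * w⁻¹) = z / t by field_simp,
    show q ^ r * (q⁻¹ * t⁻¹ * v * w⁻¹ * z) / w⁻¹ = q ^ r * v * z / (t * q) by field_simp]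
  field_simp

lemma wLout_dual (hv : v ≠ 0) (hw : w ≠ 0) (hq : q ≠ 0) (ht : t ≠ 0) (r : ℕ) (z : ℂ) :
    wLout p w⁻¹ q⁻¹ t⁻¹ r (q⁻¹ * t⁻¹ * v * w⁻¹ * z) = wRout p v w q t r z := by
  unfold wLout wRout
  rw [show q⁻¹ ^ (-(r : ℤ)) = q ^ r by simp]
  rw [show q⁻¹ * t⁻¹ * v * w⁻¹ * z / q⁻¹ = v * z / (t * w) by field_simp,
    show q ^ r * (q⁻¹ * t⁻¹ * v * w⁻¹ * z) / (t⁻¹ * w⁻¹) = q ^ r * v * z / q by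
      field_simp,
    show (q⁻¹ * t⁻¹ * v * w⁻¹ * z) / t⁻¹ = v * z / (q * w) by field_simp,
    show q ^ r * (q⁻¹ * t⁻¹ * v * w⁻¹ * z) / (q⁻¹ * w⁻¹) = q ^ r * v * z / t by field_simp]

lemma wPair_dual (hp : ‖p‖ < 1) (hq : q ≠ 0) (ht : t ≠ 0) {k y z : ℂ} (hk : k ≠ 0) (hy : y ≠ 0)
    (hz : z ≠ 0) : wPair p q⁻¹ t⁻¹ (k * y) (k * z) = wPair p q t z y := by
  unfold wPair
  rw [theta_of_mul_eq_one hp (show t⁻¹ * (k * y) / (q⁻¹ * (k * z)) * (t * z / (q * y)) = 1 by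
      field_simp),
    theta_of_mul_eq_one hp (show q⁻¹ * (k * y) / (k * z) * (q * z / y) = 1 by field_simp),
    theta_of_mul_eq_one hp (show k * y / (k * z) * (z / y) = 1 by field_simp),
    theta_of_mul_eq_one hp (show t⁻¹ * (k * y) / (k * z) * (t * z / y) = 1 by field_simp)]
  field_simp

variable {ι : Type*} [DecidableEq ι]

/-- The two sums match term by term: the factor (q²/t²)^r from the coefficient cancels the t²/q²
carried by each element of the subset. The comparison uses only inversion of theta arguments, so it
does not require nonvanishing denominators. -/
lemma LSum_dual (hp : ‖p‖ < 1) (hv : v ≠ 0) (hw : w ≠ 0) (hq : q ≠ 0) (ht : t ≠ 0) {x : ι → ℂ}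
    {S : Finset ι} (hx : ∀ i ∈ S, x i ≠ 0) :
    LSum p v⁻¹ w⁻¹ q⁻¹ t⁻¹ (fun i => q⁻¹ * t⁻¹ * v * w⁻¹ * x i) S = RSum p v w q t x S := by
  unfold LSum RSum
  have hk : q⁻¹ * t⁻¹ * v * w⁻¹ ≠ 0 := by simp [*]
  refine Eq.trans ?_ (subsetSum_twist (show q ^ 2 / t ^ 2 * (t ^ 2 / q ^ 2) = 1 by field_simp)
    _ _ _ _ _)
  exact subsetSum_congr (coef_dual hp hv hw hq ht) (fun r i _ => wLin_dual hv hw hq ht r _)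
    (fun r i _ => wLout_dual hv hw hq ht r _)
    (fun i hi j hj _ => wPair_dual hp hq ht hk (hx i hi) (hx j hj))

/-- The same duality with the distinguished variable kept visible; it transfers periodicity and pole
statements from L to R. -/
lemma LSumInsert_dual (hp : ‖p‖ < 1) (hv : v ≠ 0) (hw : w ≠ 0) (hq : q ≠ 0) (ht : t ≠ 0)
    {x : ι → ℂ} {S : Finset ι} (hx : ∀ i ∈ S, x i ≠ 0) {z : ℂ} (hz : z ≠ 0) :
    LSumInsert p v⁻¹ w⁻¹ q⁻¹ t⁻¹ (fun i => q⁻¹ * t⁻¹ * v * w⁻¹ * x i) S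
      (q⁻¹ * t⁻¹ * v * w⁻¹ * z) = RSumInsert p v w q t x S z := by
  unfold LSumInsert RSumInsert
  have hk : q⁻¹ * t⁻¹ * v * w⁻¹ ≠ 0 := by simp [*]
  have hkl : q ^ 2 / t ^ 2 * (t ^ 2 / q ^ 2) = 1 := by field_simp
  refine congrArg₂ (· + ·) ?_ ?_
  · refine subsetSum_congr_twist hkl (fun r => ?_) (fun r i hi => ?_) (fun r i _ => ?_)
      (fun i hi j hj _ => ?_)
    · rw [coef_dual hp hv hw hq ht, wLout_dual hv hw hq ht, mul_assoc]
    · rw [wLin_dual hv hw hq ht, wPair_dual hp hq ht hk (hx i hi) hz, mul_assoc]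
    · rw [wLout_dual hv hw hq ht]
    · rw [wPair_dual hp hq ht hk (hx i hi) (hx j hj)]
  · refine subsetSum_congr_twist hkl (fun r => ?_) (fun r i _ => ?_) (fun r i hi => ?_)
      (fun i hi j hj _ => ?_)
    · rw [coef_dual hp hv hw hq ht, wLin_dual hv hw hq ht]
      rw [pow_succ]
      generalize coef p v w q t (r + 1) = c
      generalize wRin p v q t (r + 1) z = d
      generalize (q ^ 2 / t ^ 2) ^ r = e
      linear_combination e * c * d * hkl
    · rw [wLin_dual hv hw hq ht]
    · rw [wLout_dual hv hw hq ht, wPair_dual hp hq ht hk hz (hx i hi)]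
    · rw [wPair_dual hp hq ht hk (hx i hi) (hx j hj)]

end duality

/-! ### Invariance under multiplying the distinguished variable by p -/

section periodicity

variable {p v w q t : ℂ}

/-- The two theta arguments in the numerator have the same product as the two in the denominator, so
the multipliers −1/argument produced by θ(pz) cancel. The other weights work likewise. -/
lemma wLin_mul_left (hp : ‖p‖ < 1) (hp0 : p ≠ 0) (hv : v ≠ 0) (hw : w ≠ 0) (hq : q ≠ 0)
    (ht : t ≠ 0) (r : ℕ) {z : ℂ} (hz : z ≠ 0) :
    wLin p v w q t r (p * z) = wLin p v w q t r z := by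
  unfold wLin
  have hqr : q ^ (-(r : ℤ)) ≠ 0 := zpow_ne_zero _ hq
  generalize q ^ (-(r : ℤ)) = u at *
  rw [theta_of_eq_mul hp hp0 (b := v * z / (t * w)) (by positivity)
      (show v * (p * z) / (t * w) = p * (v * z / (t * w)) by ring),
    theta_of_eq_mul hp hp0 (b := t * u * z / (q * w)) (by positivity)
      (show t * u * (p * z) / (q * w) = p * (t * u * z / (q * w)) by ring),
    theta_of_eq_mul hp hp0 (b := v * z / (q * w)) (by positivity)
      (show v * (p * z) / (q * w) = p * (v * z / (q * w)) by ring),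
    theta_of_eq_mul hp hp0 (b := u * z / w) (by positivity)
      (show u * (p * z) / w = p * (u * z / w) by ring)]
  field_simp

lemma wLout_mul_left (hp : ‖p‖ < 1) (hp0 : p ≠ 0) (hw : w ≠ 0) (hq : q ≠ 0)
    (ht : t ≠ 0) (r : ℕ) {z : ℂ} (hz : z ≠ 0) :
    wLout p w q t r (p * z) = wLout p w q t r z := by
  unfold wLout
  have hqr : q ^ (-(r : ℤ)) ≠ 0 := zpow_ne_zero _ hq
  generalize q ^ (-(r : ℤ)) = u at *
  rw [theta_of_eq_mul hp hp0 (b := z / q) (by positivity)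
      (show p * z / q = p * (z / q) by ring),
    theta_of_eq_mul hp hp0 (b := u * z / (t * w)) (by positivity)
      (show u * (p * z) / (t * w) = p * (u * z / (t * w)) by ring),
    theta_of_eq_mul hp hp0 (b := z / t) (by positivity)
      (show p * z / t = p * (z / t) by ring),
    theta_of_eq_mul hp hp0 (b := u * z / (q * w)) (by positivity)
      (show u * (p * z) / (q * w) = p * (u * z / (q * w)) by ring)]
  field_simp

lemma wPair_mul_left (hp : ‖p‖ < 1) (hp0 : p ≠ 0) (hq : q ≠ 0) (ht : t ≠ 0) {y z : ℂ}
    (hy : y ≠ 0) (hz : z ≠ 0) : wPair p q t (p * y) z = wPair p q t y z := by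
  unfold wPair
  rw [theta_of_eq_mul hp hp0 (b := t * y / (q * z)) (by positivity)
      (show t * (p * y) / (q * z) = p * (t * y / (q * z)) by ring),
    theta_of_eq_mul hp hp0 (b := q * y / z) (by positivity)
      (show q * (p * y) / z = p * (q * y / z) by ring),
    theta_of_eq_mul hp hp0 (b := y / z) (by positivity)
      (show p * y / z = p * (y / z) by ring),
    theta_of_eq_mul hp hp0 (b := t * y / z) (by positivity)
      (show t * (p * y) / z = p * (t * y / z) by ring)]
  field_simp

lemma wPair_mul_mul (k : ℂ) (hk : k ≠ 0) (y z : ℂ) :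
    wPair p q t (k * y) (k * z) = wPair p q t y z := by
  unfold wPair
  rw [show t * (k * y) / (q * (k * z)) = t * y / (q * z) by field_simp,
    show q * (k * y) / (k * z) = q * y / z by field_simp,
    show k * y / (k * z) = y / z by field_simp,
    show t * (k * y) / (k * z) = t * y / z by field_simp]

lemma wPair_mul_right (hp : ‖p‖ < 1) (hp0 : p ≠ 0) (hq : q ≠ 0) (ht : t ≠ 0) {y z : ℂ}
    (hy : y ≠ 0) (hz : z ≠ 0) : wPair p q t y (p * z) = wPair p q t y z := by
  rw [← wPair_mul_mul p hp0 y z, wPair_mul_left hp hp0 hq ht hy (mul_ne_zero hp0 hz)]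

variable {ι : Type*} [DecidableEq ι]

lemma LSumInsert_mul_left (hp : ‖p‖ < 1) (hp0 : p ≠ 0) (hv : v ≠ 0) (hw : w ≠ 0) (hq : q ≠ 0)
    (ht : t ≠ 0) {x : ι → ℂ} {S : Finset ι} (hx : ∀ i ∈ S, x i ≠ 0) {z : ℂ} (hz : z ≠ 0) :
    LSumInsert p v w q t x S (p * z) = LSumInsert p v w q t x S z := by
  unfold LSumInsert
  congr 1
  · exact subsetSum_congr (fun r => by rw [wLout_mul_left hp hp0 hw hq ht r hz])
      (fun r i hi => by rw [wPair_mul_right hp hp0 hq ht (hx i hi) hz]) (fun _ _ _ => rfl)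
      (fun _ _ _ _ _ => rfl)
  · exact subsetSum_congr (fun r => by rw [wLin_mul_left hp hp0 hv hw hq ht _ hz])
      (fun _ _ _ => rfl) (fun r i hi => by rw [wPair_mul_left hp hp0 hq ht hz (hx i hi)])
      (fun _ _ _ _ _ => rfl)

lemma RSumInsert_mul_left (hp : ‖p‖ < 1) (hp0 : p ≠ 0) (hv : v ≠ 0) (hw : w ≠ 0) (hq : q ≠ 0)
    (ht : t ≠ 0) {x : ι → ℂ} {S : Finset ι} (hx : ∀ i ∈ S, x i ≠ 0) {z : ℂ} (hz : z ≠ 0) :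
    RSumInsert p v w q t x S (p * z) = RSumInsert p v w q t x S z := by
  rw [← LSumInsert_dual hp hv hw hq ht hx (mul_ne_zero hp0 hz),
    ← LSumInsert_dual hp hv hw hq ht hx hz, mul_left_comm]
  exact LSumInsert_mul_left hp hp0 (inv_ne_zero hv) (inv_ne_zero hw) (inv_ne_zero hq)
    (inv_ne_zero ht) (fun i hi => by simp [*]) (by simp [*])

end periodicity

/-! ### Meromorphy, and the list of possible poles -/

section regularity

variable {p v w q t : ℂ}

lemma analyticAt_theta_comp (hp : ‖p‖ < 1) {g : ℂ → ℂ} {z : ℂ} (hg : AnalyticAt ℂ g z)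
    (h0 : g z ≠ 0) : AnalyticAt ℂ (fun z => theta p (g z)) z :=
  (analyticAt_theta hp h0).comp hg

lemma analyticAt_theta_mul_div (hp : ‖p‖ < 1) {a b z : ℂ} (ha : a ≠ 0) (hb : b ≠ 0) (hz : z ≠ 0) :
    AnalyticAt ℂ (fun z => theta p (a * z / b)) z :=
  analyticAt_theta_comp hp (by fun_prop) (by positivity)

lemma analyticAt_theta_div (hp : ‖p‖ < 1) {b z : ℂ} (hb : b ≠ 0) (hz : z ≠ 0) :
    AnalyticAt ℂ (fun z => theta p (z / b)) z :=
  analyticAt_theta_comp hp (by fun_prop) (by positivity)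

lemma analyticAt_theta_div_mul (hp : ‖p‖ < 1) {a b z : ℂ} (ha : a ≠ 0) (hb : b ≠ 0) (hz : z ≠ 0) :
    AnalyticAt ℂ (fun z => theta p (a / (b * z))) z := by
  refine analyticAt_theta_comp hp ?_ (by positivity)
  exact analyticAt_const.div (by fun_prop) (by positivity)

lemma analyticAt_theta_const_div (hp : ‖p‖ < 1) {a z : ℂ} (ha : a ≠ 0) (hz : z ≠ 0) :
    AnalyticAt ℂ (fun z => theta p (a / z)) z := by
  refine analyticAt_theta_comp hp ?_ (by positivity)
  exact analyticAt_const.div (by fun_prop) (by positivity)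

lemma wLin_regular (hp : ‖p‖ < 1) (hv : v ≠ 0) (hw : w ≠ 0) (hq : q ≠ 0) (ht : t ≠ 0) (r : ℕ)
    {z : ℂ} (hz : z ≠ 0) : MeromorphicAt (wLin p v w q t r) z ∧
      (theta p (v * z / (q * w)) ≠ 0 → theta p (q ^ (-(r : ℤ)) * z / w) ≠ 0 →
        ContinuousAt (wLin p v w q t r) z) := by
  have hqr : q ^ (-(r : ℤ)) ≠ 0 := zpow_ne_zero _ hq
  have h1 : AnalyticAt ℂ (fun z => q * theta p (v * z / (t * w)) *
      theta p (t * q ^ (-(r : ℤ)) * z / (q * w))) z :=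
    (analyticAt_const.mul (analyticAt_theta_mul_div hp hv (by positivity) hz)).mul
      (analyticAt_theta_mul_div hp (by positivity) (by positivity) hz)
  have h2 : AnalyticAt ℂ (fun z => t * theta p (v * z / (q * w)) *
      theta p (q ^ (-(r : ℤ)) * z / w)) z :=
    (analyticAt_const.mul (analyticAt_theta_mul_div hp hv (by positivity) hz)).mul
      (analyticAt_theta_mul_div hp hqr hw hz)
  exact ⟨h1.meromorphicAt.div h2.meromorphicAt, fun h3 h4 =>
    h1.continuousAt.div h2.continuousAt (by positivity)⟩

lemma wLout_regular (hp : ‖p‖ < 1) (hw : w ≠ 0) (hq : q ≠ 0) (ht : t ≠ 0) (r : ℕ)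
    {z : ℂ} (hz : z ≠ 0) : MeromorphicAt (wLout p w q t r) z ∧
      (theta p (z / t) ≠ 0 → theta p (q ^ (-(r : ℤ)) * z / (q * w)) ≠ 0 →
        ContinuousAt (wLout p w q t r) z) := by
  have hqr : q ^ (-(r : ℤ)) ≠ 0 := zpow_ne_zero _ hq
  have h1 : AnalyticAt ℂ (fun z => theta p (z / q) *
      theta p (q ^ (-(r : ℤ)) * z / (t * w))) z :=
    (analyticAt_theta_div hp hq hz).mul
      (analyticAt_theta_mul_div hp hqr (by positivity) hz)
  have h2 : AnalyticAt ℂ (fun z => theta p (z / t) *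
      theta p (q ^ (-(r : ℤ)) * z / (q * w))) z :=
    (analyticAt_theta_div hp ht hz).mul (analyticAt_theta_mul_div hp hqr (by positivity) hz)
  exact ⟨h1.meromorphicAt.div h2.meromorphicAt, fun h3 h4 =>
    h1.continuousAt.div h2.continuousAt (by positivity)⟩

lemma wRin_regular (hp : ‖p‖ < 1) (hv : v ≠ 0) (hq : q ≠ 0) (ht : t ≠ 0) (r : ℕ)
    {z : ℂ} (hz : z ≠ 0) : MeromorphicAt (wRin p v q t r) z ∧
      (theta p (z / t) ≠ 0 → theta p (q ^ r * v * z / (t * q)) ≠ 0 →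
        ContinuousAt (wRin p v q t r) z) := by
  have h1 : AnalyticAt ℂ (fun z => q * theta p (z / q) *
      theta p (q ^ r * v * z / t ^ 2)) z :=
    (analyticAt_const.mul (analyticAt_theta_div hp hq hz)).mul
      (analyticAt_theta_mul_div hp (by positivity) (by positivity) hz)
  have h2 : AnalyticAt ℂ (fun z => t * theta p (z / t) *
      theta p (q ^ r * v * z / (t * q))) z :=
    (analyticAt_const.mul (analyticAt_theta_div hp ht hz)).mul
      (analyticAt_theta_mul_div hp (by positivity) (by positivity) hz)
  exact ⟨h1.meromorphicAt.div h2.meromorphicAt, fun h3 h4 =>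
    h1.continuousAt.div h2.continuousAt (by positivity)⟩

lemma wRout_regular (hp : ‖p‖ < 1) (hv : v ≠ 0) (hw : w ≠ 0) (hq : q ≠ 0) (ht : t ≠ 0) (r : ℕ)
    {z : ℂ} (hz : z ≠ 0) : MeromorphicAt (wRout p v w q t r) z ∧
      (theta p (v * z / (q * w)) ≠ 0 → theta p (q ^ r * v * z / t) ≠ 0 →
        ContinuousAt (wRout p v w q t r) z) := by
  have h1 : AnalyticAt ℂ (fun z => theta p (v * z / (t * w)) *
      theta p (q ^ r * v * z / q)) z :=
    (analyticAt_theta_mul_div hp hv (by positivity) hz).mul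
      (analyticAt_theta_mul_div hp (by positivity) hq hz)
  have h2 : AnalyticAt ℂ (fun z => theta p (v * z / (q * w)) *
      theta p (q ^ r * v * z / t)) z :=
    (analyticAt_theta_mul_div hp hv (by positivity) hz).mul
      (analyticAt_theta_mul_div hp (by positivity) ht hz)
  exact ⟨h1.meromorphicAt.div h2.meromorphicAt, fun h3 h4 =>
    h1.continuousAt.div h2.continuousAt (by positivity)⟩

lemma wPair_regular_left (hp : ‖p‖ < 1) (hq : q ≠ 0) (ht : t ≠ 0)
    {y z : ℂ} (hy : y ≠ 0) (hz : z ≠ 0) : MeromorphicAt (fun z => wPair p q t z y) z ∧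
      (theta p (z / y) ≠ 0 → theta p (t * z / y) ≠ 0 →
        ContinuousAt (fun z => wPair p q t z y) z) := by
  have h1 : AnalyticAt ℂ (fun z => theta p (t * z / (q * y)) * theta p (q * z / y)) z :=
    (analyticAt_theta_mul_div hp ht (by positivity) hz).mul
      (analyticAt_theta_mul_div hp hq hy hz)
  have h2 : AnalyticAt ℂ (fun z => theta p (z / y) * theta p (t * z / y)) z :=
    (analyticAt_theta_div hp hy hz).mul (analyticAt_theta_mul_div hp ht hy hz)
  exact ⟨h1.meromorphicAt.div h2.meromorphicAt, fun h3 h4 =>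
    h1.continuousAt.div h2.continuousAt (by positivity)⟩

lemma wPair_regular_right (hp : ‖p‖ < 1) (hq : q ≠ 0) (ht : t ≠ 0)
    {y z : ℂ} (hy : y ≠ 0) (hz : z ≠ 0) : MeromorphicAt (fun z => wPair p q t y z) z ∧
      (theta p (y / z) ≠ 0 → theta p (t * y / z) ≠ 0 →
        ContinuousAt (fun z => wPair p q t y z) z) := by
  have h1 : AnalyticAt ℂ (fun z => theta p (t * y / (q * z)) * theta p (q * y / z)) z :=
    (analyticAt_theta_div_mul hp (by positivity) hq hz).mul
      (analyticAt_theta_const_div hp (by positivity) hz)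
  have h2 : AnalyticAt ℂ (fun z => theta p (y / z) * theta p (t * y / z)) z :=
    (analyticAt_theta_const_div hp hy hz).mul (analyticAt_theta_const_div hp (by positivity) hz)
  exact ⟨h1.meromorphicAt.div h2.meromorphicAt, fun h3 h4 =>
    h1.continuousAt.div h2.continuousAt (by positivity)⟩

lemma theta_ne_zero_of_mul_eq_one (hp : ‖p‖ < 1) {a b : ℂ} (h : a * b = 1)
    (hb : theta p b ≠ 0) : theta p a ≠ 0 := by
  rw [theta_of_mul_eq_one hp h]
  exact mul_ne_zero (neg_ne_zero.mpr (left_ne_zero_of_mul_eq_one h)) hb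

variable {ι : Type*} [DecidableEq ι] {x : ι → ℂ} {S : Finset ι}

lemma meromorphicAt_LSumInsert (hp : ‖p‖ < 1) (hv : v ≠ 0) (hw : w ≠ 0) (hq : q ≠ 0) (ht : t ≠ 0)
    (hx : ∀ i ∈ S, x i ≠ 0) {z : ℂ} (hz : z ≠ 0) :
    MeromorphicAt (LSumInsert p v w q t x S) z := by
  refine MeromorphicAt.fun_add (meromorphicAt_subsetSum (fun r => ?_) (fun r i hi => ?_)
    (fun r i _ => .const _ _) (fun i j => .const _ _))
    (meromorphicAt_subsetSum (fun r => ?_) (fun r i hi => .const _ _)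
    (fun r i hi => ?_) (fun i j => .const _ _))
  · exact (MeromorphicAt.const _ _).fun_mul (wLout_regular hp hw hq ht r hz).1
  · exact (MeromorphicAt.const _ _).fun_mul (wPair_regular_right hp hq ht (hx i hi) hz).1
  · exact (MeromorphicAt.const _ _).fun_mul (wLin_regular hp hv hw hq ht _ hz).1
  · exact (MeromorphicAt.const _ _).fun_mul (wPair_regular_left hp hq ht (hx i hi) hz).1

lemma meromorphicAt_RSumInsert (hp : ‖p‖ < 1) (hv : v ≠ 0) (hw : w ≠ 0) (hq : q ≠ 0) (ht : t ≠ 0)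
    (hx : ∀ i ∈ S, x i ≠ 0) {z : ℂ} (hz : z ≠ 0) :
    MeromorphicAt (RSumInsert p v w q t x S) z := by
  refine MeromorphicAt.fun_add (meromorphicAt_subsetSum (fun r => ?_) (fun r i hi => ?_)
    (fun r i _ => .const _ _) (fun i j => .const _ _))
    (meromorphicAt_subsetSum (fun r => ?_) (fun r i hi => .const _ _)
    (fun r i hi => ?_) (fun i j => .const _ _))
  · exact (MeromorphicAt.const _ _).fun_mul (wRout_regular hp hv hw hq ht r hz).1
  · exact (MeromorphicAt.const _ _).fun_mul (wPair_regular_left hp hq ht (hx i hi) hz).1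
  · exact (MeromorphicAt.const _ _).fun_mul (wRin_regular hp hv hq ht _ hz).1
  · exact (MeromorphicAt.const _ _).fun_mul (wPair_regular_right hp hq ht (hx i hi) hz).1

/-- The hypotheses enumerate the candidate poles of L up to powers of p: t, qw/v, w q^(r+1), x_i,
x_i/t and t x_i. -/
lemma continuousAt_LSumInsert (hp : ‖p‖ < 1) (hv : v ≠ 0) (hw : w ≠ 0) (hq : q ≠ 0) (ht : t ≠ 0)
    (hx : ∀ i ∈ S, x i ≠ 0) {z : ℂ} (hz : z ≠ 0) (h1 : theta p (z / t) ≠ 0)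
    (h2 : theta p (v * z / (q * w)) ≠ 0)
    (h3 : ∀ r : ℕ, theta p (q ^ (-(r : ℤ)) * z / (q * w)) ≠ 0)
    (h4 : ∀ i ∈ S, theta p (z / x i) ≠ 0) (h5 : ∀ i ∈ S, theta p (t * z / x i) ≠ 0)
    (h6 : ∀ i ∈ S, theta p (z / (t * x i)) ≠ 0) :
    ContinuousAt (LSumInsert p v w q t x S) z := by
  refine Tendsto.add (tendsto_subsetSum (fun I _ => ?_) (fun I hI i hi => ?_)
    (fun I _ j _ => tendsto_const_nhds) (fun I _ i _ j _ => tendsto_const_nhds))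
    (tendsto_subsetSum (fun I _ => ?_) (fun I _ i _ => tendsto_const_nhds)
    (fun I hI j hj => ?_) (fun I _ i _ j _ => tendsto_const_nhds))
  · exact ((wLout_regular hp hw hq ht _ hz).2 h1 (h3 _)).const_mul _
  · have hi := hI hi
    have := hx i hi
    refine ((wPair_regular_right hp hq ht this hz).2 ?_ ?_).const_mul _
    · exact theta_ne_zero_of_mul_eq_one hp (by field_simp) (h4 i hi)
    · exact theta_ne_zero_of_mul_eq_one hp (by field_simp) (h6 i hi)
  · refine ((wLin_regular hp hv hw hq ht _ hz).2 h2 ?_).const_mul _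
    -- With z inside, the cardinality is r + 1, and q^(−(r+1)) z/w is the argument q^(−r) z/(qw) of
    -- the outside weight at r. The value z = w is therefore not a candidate.
    convert h3 I.card using 2
    push_cast
    rw [neg_add, zpow_add₀ hq]
    field_simp
  · have hj := (Finset.mem_sdiff.mp hj).1
    exact ((wPair_regular_left hp hq ht (hx j hj) hz).2 (h4 j hj) (h5 j hj)).const_mul _

/-- The candidates are those of L, with the family w q^(r+1) replaced by t/(v q^r). -/
lemma continuousAt_RSumInsert (hp : ‖p‖ < 1) (hv : v ≠ 0) (hw : w ≠ 0) (hq : q ≠ 0) (ht : t ≠ 0)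
    (hx : ∀ i ∈ S, x i ≠ 0) {z : ℂ} (hz : z ≠ 0) (h1 : theta p (z / t) ≠ 0)
    (h2 : theta p (v * z / (q * w)) ≠ 0)
    (h3 : ∀ r : ℕ, theta p (q ^ r * v * z / t) ≠ 0)
    (h4 : ∀ i ∈ S, theta p (z / x i) ≠ 0) (h5 : ∀ i ∈ S, theta p (t * z / x i) ≠ 0)
    (h6 : ∀ i ∈ S, theta p (z / (t * x i)) ≠ 0) :
    ContinuousAt (RSumInsert p v w q t x S) z := by
  refine Tendsto.add (tendsto_subsetSum (fun I _ => ?_) (fun I hI i hi => ?_)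
    (fun I _ j _ => tendsto_const_nhds) (fun I _ i _ j _ => tendsto_const_nhds))
    (tendsto_subsetSum (fun I _ => ?_) (fun I _ i _ => tendsto_const_nhds)
    (fun I hI j hj => ?_) (fun I _ i _ j _ => tendsto_const_nhds))
  · exact ((wRout_regular hp hv hw hq ht _ hz).2 h2 (h3 _)).const_mul _
  · have hi := hI hi
    exact ((wPair_regular_left hp hq ht (hx i hi) hz).2 (h4 i hi) (h5 i hi)).const_mul _
  · refine ((wRin_regular hp hv hq ht _ hz).2 h1 ?_).const_mul _
    -- The factor q in the denominator of the inside weight compensates for the cardinality r + 1.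
    convert h3 I.card using 2
    field_simp
    ring
  · have hj := (Finset.mem_sdiff.mp hj).1
    have := hx j hj
    refine ((wPair_regular_right hp hq ht this hz).2 ?_ ?_).const_mul _
    · exact theta_ne_zero_of_mul_eq_one hp (by field_simp) (h4 j hj)
    · exact theta_ne_zero_of_mul_eq_one hp (by field_simp) (h6 j hj)

end regularity

/-! ### Parameters in general position -/

/-- The parameters are in general position: no nontrivial Laurent monomial of the relevant shape
is a zero of `θ`. -/
structure Generic {ι : Type*} (p v w q t : ℂ) (x : ι → ℂ) (S : Finset ι) : Prop where
  hp : ‖p‖ < 1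
  p0 : p ≠ 0
  v0 : v ≠ 0
  w0 : w ≠ 0
  q0 : q ≠ 0
  t0 : t ≠ 0
  x0 : ∀ i ∈ S, x i ≠ 0
  const : ∀ a b c d : ℤ, (a ≠ 0 ∨ b ≠ 0 ∨ c ≠ 0 ∨ d ≠ 0) →
    theta p (v ^ a * w ^ b * q ^ c * t ^ d) ≠ 0
  single : ∀ i ∈ S, ∀ a b c d : ℤ, theta p (v ^ a * w ^ b * q ^ c * t ^ d * x i) ≠ 0
  pair : ∀ i ∈ S, ∀ j ∈ S, i ≠ j → ∀ a b c d : ℤ,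
    theta p (v ^ a * w ^ b * q ^ c * t ^ d * x i / x j) ≠ 0

namespace Generic

variable {ι : Type*} {p v w q t : ℂ} {x : ι → ℂ} {S : Finset ι}

lemma const' (h : Generic p v w q t x S) (a b c d : ℤ) {u : ℂ}
    (hu : u = v ^ a * w ^ b * q ^ c * t ^ d) (h0 : a ≠ 0 ∨ b ≠ 0 ∨ c ≠ 0 ∨ d ≠ 0) :
    theta p u ≠ 0 := hu ▸ h.const a b c d h0

lemma single' (h : Generic p v w q t x S) {i : ι} (hi : i ∈ S) (a b c d : ℤ) {u : ℂ}
    (hu : u = v ^ a * w ^ b * q ^ c * t ^ d * x i) : theta p u ≠ 0 := hu ▸ h.single i hi a b c d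

lemma single_inv (h : Generic p v w q t x S) {i : ι} (hi : i ∈ S) (a b c d : ℤ) {u : ℂ}
    (hu : u * (v ^ a * w ^ b * q ^ c * t ^ d * x i) = 1) : theta p u ≠ 0 :=
  theta_ne_zero_of_mul_eq_one h.hp hu (h.single i hi a b c d)

lemma pair' (h : Generic p v w q t x S) {i j : ι} (hi : i ∈ S) (hj : j ∈ S) (hij : i ≠ j)
    (a b c d : ℤ) {u : ℂ}
    (hu : u = v ^ a * w ^ b * q ^ c * t ^ d * x i / x j) : theta p u ≠ 0 :=
  hu ▸ h.pair i hi j hj hij a b c d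

lemma mono (h : Generic p v w q t x S) {T : Finset ι} (hT : T ⊆ S) : Generic p v w q t x T where
  hp := h.hp
  p0 := h.p0
  v0 := h.v0
  w0 := h.w0
  q0 := h.q0
  t0 := h.t0
  x0 i hi := h.x0 i (hT hi)
  const := h.const
  single i hi := h.single i (hT hi)
  pair i hi j hj := h.pair i (hT hi) j (hT hj)

/-- General position is preserved when every variable is multiplied by a Laurent monomial in the
parameters, `v` and `w` by powers of `q`. -/
lemma shift (h : Generic p v w q t x S) (k l m : ℤ) :
    Generic p (q ^ k * v) (q ^ l * w) q t (fun i => q ^ m * x i) S where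
  hp := h.hp
  p0 := h.p0
  v0 := mul_ne_zero (zpow_ne_zero _ h.q0) h.v0
  w0 := mul_ne_zero (zpow_ne_zero _ h.q0) h.w0
  q0 := h.q0
  t0 := h.t0
  x0 i hi := mul_ne_zero (zpow_ne_zero _ h.q0) (h.x0 i hi)
  const a b c d h0 := h.const' a b (c + k * a + l * b) d (by
    simp only [mul_zpow, ← zpow_mul, zpow_add₀ h.q0]; ring) (by
    -- If all new exponents vanish, then a = b = d = 0, so the new q-exponent is c itself.
    by_contra! h1
    obtain ⟨rfl, rfl, h1, rfl⟩ := h1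
    simp at h0 h1
    exact h0 h1)
  single i hi a b c d := h.single' hi a b (c + k * a + l * b + m) d (by
    simp only [mul_zpow, ← zpow_mul, zpow_add₀ h.q0]; ring)
  pair i hi j hj hij a b c d := h.pair' hi hj hij a b (c + k * a + l * b) d (by
    have := zpow_ne_zero m h.q0
    rw [← mul_assoc, mul_right_comm, mul_comm _ (q ^ m), mul_assoc, mul_div_mul_left _ _ this]
    simp only [mul_zpow, ← zpow_mul, zpow_add₀ h.q0]; ring)

/-- Stability under the duality substitution lets each pole argument be reused for the dual pole. -/
lemma dual (h : Generic p v w q t x S) :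
    Generic p v⁻¹ w⁻¹ q⁻¹ t⁻¹ (fun i => q⁻¹ * t⁻¹ * v * w⁻¹ * x i) S where
  hp := h.hp
  p0 := h.p0
  v0 := inv_ne_zero h.v0
  w0 := inv_ne_zero h.w0
  q0 := inv_ne_zero h.q0
  t0 := inv_ne_zero h.t0
  x0 i hi := by simp [h.v0, h.w0, h.q0, h.t0, h.x0 i hi]
  const a b c d h0 := h.const' (-a) (-b) (-c) (-d) (by simp only [inv_zpow, zpow_neg])
    (by simpa using h0)
  single i hi a b c d := h.single' hi (-a + 1) (-b + -1) (-c + -1) (-d + -1) (by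
    simp only [inv_zpow, zpow_neg, zpow_add₀ h.v0, zpow_add₀ h.w0, zpow_add₀ h.q0, zpow_add₀ h.t0,
      zpow_one]
    ring)
  pair i hi j hj hij a b c d := h.pair' hi hj hij (-a) (-b) (-c) (-d) (by
    have : q⁻¹ * t⁻¹ * v * w⁻¹ ≠ 0 := by simp [h.v0, h.w0, h.q0, h.t0]
    generalize q⁻¹ * t⁻¹ * v * w⁻¹ = k at this
    rw [← mul_assoc, mul_right_comm, mul_comm _ k, mul_assoc, mul_div_mul_left _ _ this]
    simp only [inv_zpow, zpow_neg, mul_assoc])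

end Generic

/-! ### Evaluation at z = q -/

section coefficients

variable {p v w q t : ℂ}

/-- The quotient `(a)_r / (q a / t)_r`. -/
noncomputable def pochRatio (p q t a : ℂ) (r : ℕ) : ℂ :=
  thetaPoch q p a r / thetaPoch q p (q * a / t) r

lemma coef_eq_mul (r : ℕ) : coef p v w q t r = pochRatio p q t v r * pochRatio p q t w r := by
  unfold coef pochRatio; rw [div_mul_div_comm]

lemma pochRatio_succ (a : ℂ) (r : ℕ) : pochRatio p q t a (r + 1) =
    pochRatio p q t a r * (theta p (a * q ^ r) / theta p (q * a / t * q ^ r)) := by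
  simp only [pochRatio, thetaPoch, Finset.prod_range_succ]
  rw [div_mul_div_comm]

/-- Peeling off the first factor rather than the last trades an increase of r for the shift a ↦ qa.
This is the source of the shifted parameters in the smaller identities. -/
lemma pochRatio_succ' (a : ℂ) (r : ℕ) : pochRatio p q t a (r + 1) =
    theta p a / theta p (q * a / t) * pochRatio p q t (q * a) r := by
  simp only [pochRatio, thetaPoch, Finset.prod_range_succ']
  rw [div_mul_div_comm, mul_comm (theta p a), mul_comm (theta p (q * a / t))]
  simp only [pow_succ', pow_zero, mul_one]
  congr 2
  · exact Finset.prod_congr rfl fun k _ => by ring_nf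
  · congr 1
    funext k
    ring_nf

end coefficients

section evaluation

variable {ι : Type*} {p v w q t : ℂ} {x : ι → ℂ} {S : Finset ι}

/-- Interaction with a variable equal to q turns the quotient θ(x/q)/θ(x/t) into its value at x/q,
which accounts for the rescaling of the remaining variables. -/
lemma wPair_at_q (h : Generic p v w q t x S) {i : ι} (hi : i ∈ S) :
    theta p (x i / q) / theta p (x i / t) * wPair p q t q (x i) =
      theta p (q⁻¹ * x i / q) / theta p (q⁻¹ * x i / t) := by
  have := h.q0; have := h.t0; have := h.x0 i hi
  have h1 : theta p (x i / q) ≠ 0 := h.single' hi 0 0 (-1) 0 (by simp; field_simp)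
  have h2 : theta p (x i / t) ≠ 0 := h.single' hi 0 0 0 (-1) (by simp; field_simp)
  unfold wPair
  rw [theta_of_mul_eq_one h.hp (show t * q / (q * x i) * (x i / t) = 1 by field_simp),
    theta_of_mul_eq_one h.hp (show q * q / x i * (q⁻¹ * x i / q) = 1 by field_simp),
    theta_of_mul_eq_one h.hp (show q / x i * (x i / q) = 1 by field_simp),
    theta_of_mul_eq_one h.hp (show t * q / x i * (q⁻¹ * x i / t) = 1 by field_simp)]
  field_simp

variable [DecidableEq ι]

/-- Only subsets containing z survive. In the coefficient, the v-part is peeled at its first factor,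
giving v ↦ qv; the w-part is peeled at its last, whose theta quotient cancels against the inside
weight of z. -/
lemma LSumInsert_at_q (h : Generic p v w q t x S) :
    LSumInsert p v w q t x S q =
      theta p (v * q / (t * w)) / theta p (v / w) * (theta p v / theta p (q * v / t)) *
        LSum p (q * v) w q t (fun i => q⁻¹ * x i) S := by
  have := h.q0; have := h.t0; have := h.w0; have := h.v0
  unfold LSumInsert LSum
  -- The outside weight of z contains θ(z/q) = θ(1) = 0.
  rw [subsetSum_zero (fun r => by
    simp [wLout, div_self h.q0, theta_one h.hp]), zero_add]
  rw [subsetSum_congr_scale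
    (theta p (v * q / (t * w)) / theta p (v / w) * (theta p v / theta p (q * v / t)))
    (fun _ => 1) (c' := coef p (q * v) w q t) (fun r => ?_) (fun r _ i hi => ?_)
    (fun r _ i hi => ?_) (fun i hi j hj _ => ?_), Finset.prod_const_one, mul_one]
  · rw [coef_eq_mul, coef_eq_mul, pochRatio_succ', pochRatio_succ]
    have h1 : theta p (w * q ^ r) ≠ 0 := h.const' 0 1 r 0 (by simp) (by simp)
    have h2 : theta p (q * w / t * q ^ r) ≠ 0 := h.const' 0 1 (r + 1) (-1)
      (by simp [zpow_add₀ h.q0]; field_simp) (by simp)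
    unfold wLin
    push_cast
    rw [theta_of_mul_eq_one h.hp (show t * q ^ (-((r : ℤ) + 1)) * q / (q * w) *
        (q * w / t * q ^ r) = 1 by simp [zpow_add₀ h.q0]; field_simp),
      theta_of_mul_eq_one h.hp (show q ^ (-((r : ℤ) + 1)) * q / w *
        (w * q ^ r) = 1 by simp [zpow_add₀ h.q0]; field_simp),
      show v * q / (q * w) = v / w by field_simp]
    generalize theta p (q * w / t * q ^ r) = c at h2
    field_simp
  · simp only [one_mul]
    unfold wLin
    push_cast
    rw [neg_add, zpow_add₀ h.q0, zpow_neg_one,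
      show q * v * (q⁻¹ * x i) / (t * w) = v * x i / (t * w) by field_simp,
      show q * v * (q⁻¹ * x i) / (q * w) = v * x i / (q * w) by field_simp]
    simp only [mul_assoc]
  · rw [one_mul]
    unfold wLout
    push_cast
    have h4 := wPair_at_q h hi
    rw [neg_add, zpow_add₀ h.q0, zpow_neg_one, mul_div_mul_comm (theta p _) (theta p _),
      mul_div_mul_comm (theta p _) (theta p _), ← h4]
    simp only [mul_assoc]
    rw [mul_left_comm, mul_comm (wPair p q t q (x i))]
    ring
  · exact (wPair_mul_mul _ (inv_ne_zero h.q0) _ _).symm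

/-- Here θ(z/q) sits in the inside weight, so only subsets omitting z survive, and the resulting
prefactor is the one found for L. -/
lemma RSumInsert_at_q (h : Generic p v w q t x S) :
    RSumInsert p v w q t x S q =
      theta p (v * q / (t * w)) / theta p (v / w) * (theta p v / theta p (q * v / t)) *
        RSum p (q * v) w q t (fun i => q⁻¹ * x i) S := by
  have := h.q0; have := h.t0; have := h.w0; have := h.v0
  unfold RSumInsert RSum
  rw [subsetSum_zero (c := fun r => coef p v w q t (r + 1) * wRin p v q t (r + 1) q) (fun r => by
    simp [wRin, div_self h.q0, theta_one h.hp]), add_zero]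
  rw [subsetSum_congr_scale
    (theta p (v * q / (t * w)) / theta p (v / w) * (theta p v / theta p (q * v / t)))
    (fun _ => 1) (c' := coef p (q * v) w q t) (fun r => ?_) (fun r _ i hi => ?_)
    (fun r _ i hi => ?_) (fun i hi j hj _ => ?_), Finset.prod_const_one, mul_one]
  · have h3 : pochRatio p q t v r * (theta p (q ^ r * v * q / q) / theta p (q ^ r * v * q / t)) =
        theta p v / theta p (q * v / t) * pochRatio p q t (q * v) r := by
      rw [← pochRatio_succ', pochRatio_succ,
        show q ^ r * v * q / q = v * q ^ r by field_simp,
        show q ^ r * v * q / t = q * v / t * q ^ r by ring]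
    rw [coef_eq_mul, coef_eq_mul]
    unfold wRout
    rw [← div_mul_div_comm, show v * q / (q * w) = v / w by field_simp]
    linear_combination theta p (v * q / (t * w)) / theta p (v / w) * pochRatio p q t w r * h3
  · rw [one_mul]
    unfold wRin
    have h4 := wPair_at_q h hi
    have e1 : q ^ r * (q * v) * (q⁻¹ * x i) / t ^ 2 = q ^ r * v * x i / t ^ 2 := by field_simp
    have e2 : q ^ r * (q * v) * (q⁻¹ * x i) / (t * q) = q ^ r * v * x i / (t * q) := by field_simp
    rw [e1, e2, ← div_mul_div_comm, mul_div_mul_comm, mul_right_comm, mul_assoc (q / t), h4]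
    ring
  · rw [one_mul]
    unfold wRout
    rw [show q * v * (q⁻¹ * x i) / (t * w) = v * x i / (t * w) by field_simp,
      show q * v * (q⁻¹ * x i) / (q * w) = v * x i / (q * w) by field_simp,
      show q ^ r * (q * v) * (q⁻¹ * x i) / t = q ^ r * v * x i / t by field_simp,
      show q ^ r * (q * v) * (q⁻¹ * x i) / q = q ^ r * v * x i / q by field_simp]
  · exact (wPair_mul_mul _ (inv_ne_zero h.q0) _ _).symm

end evaluation

/-! ### Residues at z = t -/

section residue

variable {ι : Type*} {p v w q t : ℂ} {x : ι → ℂ} {S : Finset ι}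

lemma wPair_at_t (h : Generic p v w q t x S) {i : ι} (hi : i ∈ S) :
    wPair p q t (x i) t * (theta p (q * x i / q) / theta p (q * x i / t)) =
      theta p (x i / q) / theta p (x i / t) := by
  have := h.q0; have := h.t0; have := h.x0 i hi
  have h1 : theta p (x i) ≠ 0 := h.single' hi 0 0 0 0 (by simp)
  have h2 : theta p (q * x i / t) ≠ 0 := h.single' hi 0 0 1 (-1) (by simp; field_simp)
  unfold wPair
  rw [show t * x i / (q * t) = x i / q by field_simp, show t * x i / t = x i by field_simp,
    show q * x i / q = x i by field_simp]
  generalize theta p (q * x i / t) = c at h2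
  field_simp

variable [DecidableEq ι]

/-- Only the outside weight of z is singular at t. Its residue shifts w to qw in the coefficient,
and the interactions with z rescale x to qx at the price of a product over all of S. -/
lemma tendsto_LSumInsert_at_t (h : Generic p v w q t x S) :
    Tendsto (fun z => theta p (z / t) * LSumInsert p v w q t x S z) (𝓝[≠] t)
      (𝓝 (theta p (t / q) * (q / t) * (theta p w / theta p (q * w / t)) *
        (∏ i ∈ S, wPair p q t (x i) t) * LSum p v (q * w) q t (fun i => q * x i) S)) := by
  have := h.q0; have := h.t0; have := h.w0; have := h.v0
  set K := theta p (t / q) * (q / t) * (theta p w / theta p (q * w / t)) with hK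
  have main : Tendsto (fun z => subsetSum
      (fun r => theta p (z / t) * (coef p v w q t r * wLout p w q t r z))
      (fun r i => wLin p v w q t r (x i) * wPair p q t (x i) z)
      (fun r j => wLout p w q t r (x j)) (fun i j => wPair p q t (x i) (x j)) S) (𝓝[≠] t)
      (𝓝 (subsetSum (fun r => K * coef p v (q * w) q t r)
        (fun r i => wLin p v w q t r (x i) * wPair p q t (x i) t)
        (fun r j => wLout p w q t r (x j)) (fun i j => wPair p q t (x i) (x j)) S)) := by
    refine tendsto_subsetSum (fun I _ => ?_) (fun I hI i hi => ?_)
      (fun I _ j _ => tendsto_const_nhds) (fun I _ i _ j _ => tendsto_const_nhds)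
    · generalize I.card = r
      have hqr : q ^ (-(r : ℤ)) ≠ 0 := zpow_ne_zero _ h.q0
      have h0 : theta p (q ^ (-(r : ℤ)) * t / (q * w)) ≠ 0 :=
        h.const' 0 (-1) (-r - 1) 1 (by simp [zpow_sub₀ h.q0]; field_simp) (by simp)
      refine tendsto_theta_mul (g := fun z => coef p v w q t r * (theta p (z / q) *
          theta p (q ^ (-(r : ℤ)) * z / (t * w)) / theta p (q ^ (-(r : ℤ)) * z / (q * w))))
        h.hp h.t0 (.mul continuousAt_const (.div (.mul
          (analyticAt_theta_div h.hp h.q0 h.t0).continuousAt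
          (analyticAt_theta_mul_div h.hp hqr (by positivity) h.t0).continuousAt)
          (analyticAt_theta_mul_div h.hp hqr (by positivity) h.t0).continuousAt h0))
        (fun z _ => ?_) ?_
      · unfold wLout
        ring
      · rw [coef_eq_mul, coef_eq_mul]
        have h1 : theta p (w * q ^ r) ≠ 0 := h.const' 0 1 r 0 (by simp) (by simp)
        have h2 : theta p (q * w / t * q ^ r) ≠ 0 := h.const' 0 1 (r + 1) (-1)
          (by simp [zpow_add₀ h.q0]; field_simp) (by simp)
        -- Equating the two ways of peeling converts the quotient θ(w q^r)/θ(q w q^r/t) left by the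
        -- residue into the shift w ↦ qw.
        have h3 := (pochRatio_succ (p := p) (q := q) (t := t) w r).symm.trans
          (pochRatio_succ' w r)
        rw [theta_of_mul_eq_one h.hp (show q ^ (-(r : ℤ)) * t / (t * w) * (w * q ^ r) = 1 by
            simp; field_simp),
          theta_of_mul_eq_one h.hp (show q ^ (-(r : ℤ)) * t / (q * w) * (q * w / t * q ^ r) = 1 by
            simp; field_simp)]
        rw [hK, mul_assoc _ _ (pochRatio p q t v r * _), mul_left_comm _ (pochRatio p q t v r),
          ← h3]
        generalize theta p (q * w / t * q ^ r) = c at *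
        field_simp
    · have hi := hI hi
      refine (((wPair_regular_right h.hp h.q0 h.t0 (h.x0 i hi) h.t0).2 ?_ ?_).const_mul
        _).tendsto.mono_left nhdsWithin_le_nhds
      · exact h.single' hi 0 0 0 (-1) (by simp; field_simp)
      · exact h.single' hi 0 0 0 0 (by simp; field_simp)
  have rest : ContinuousAt (fun z => subsetSum
      (fun r => coef p v w q t (r + 1) * wLin p v w q t (r + 1) z)
      (fun r i => wLin p v w q t (r + 1) (x i))
      (fun r j => wLout p w q t (r + 1) (x j) * wPair p q t z (x j))
      (fun i j => wPair p q t (x i) (x j)) S) t := by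
    refine tendsto_subsetSum (fun I _ => ?_) (fun I _ i _ => tendsto_const_nhds)
      (fun I hI j hj => ?_) (fun I _ i _ j _ => tendsto_const_nhds)
    · refine ((wLin_regular h.hp h.v0 h.w0 h.q0 h.t0 _ h.t0).2 ?_ ?_).const_mul _
      · exact h.const' 1 (-1) (-1) 1 (by simp; field_simp) (by simp)
      · exact h.const' 0 (-1) (-(I.card + 1 : ℕ)) 1 (by simp; field_simp) (by simp)
    · have hj := (Finset.mem_sdiff.mp hj).1
      have := h.x0 j hj
      refine ((wPair_regular_left h.hp h.q0 h.t0 (h.x0 j hj) h.t0).2 ?_ ?_).const_mul _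
      · exact h.single_inv hj 0 0 0 (-1) (by simp; field_simp)
      · exact h.single_inv hj 0 0 0 (-2) (by simp; field_simp)
  have total := main.add (tendsto_theta_mul_of_continuousAt h.hp h.t0 rest)
  have e : subsetSum (fun r => K * coef p v (q * w) q t r)
        (fun r i => wLin p v w q t r (x i) * wPair p q t (x i) t)
        (fun r j => wLout p w q t r (x j)) (fun i j => wPair p q t (x i) (x j)) S =
      (K * ∏ i ∈ S, wPair p q t (x i) t) * LSum p v (q * w) q t (fun i => q * x i) S := by
    refine subsetSum_congr_scale _ _ (fun r => rfl) (fun r _ i hi => ?_)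
      (fun r _ i hi => ?_) (fun i hi j hj _ => (wPair_mul_mul _ h.q0 _ _).symm)
    · rw [mul_comm]
      unfold wLin
      rw [show v * (q * x i) / (t * (q * w)) = v * x i / (t * w) by field_simp,
        show t * q ^ (-(r : ℤ)) * (q * x i) / (q * (q * w)) = t * q ^ (-(r : ℤ)) * x i / (q * w) by
          field_simp,
        show v * (q * x i) / (q * (q * w)) = v * x i / (q * w) by field_simp,
        show q ^ (-(r : ℤ)) * (q * x i) / (q * w) = q ^ (-(r : ℤ)) * x i / w by field_simp]
    · have h4 := wPair_at_t h hi
      unfold wLout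
      rw [show q ^ (-(r : ℤ)) * (q * x i) / (t * (q * w)) = q ^ (-(r : ℤ)) * x i / (t * w) by
          field_simp,
        show q ^ (-(r : ℤ)) * (q * x i) / (q * (q * w)) = q ^ (-(r : ℤ)) * x i / (q * w) by
          field_simp,
        mul_div_mul_comm (theta p _) (theta p _), ← h4, mul_div_mul_comm (theta p _) (theta p _),
        mul_assoc]
  rw [add_zero, e] at total
  refine total.congr fun z => ?_
  rw [LSumInsert, mul_add, mul_subsetSum, mul_subsetSum]

/-- In R the inside weight of z is the singular one; the residue has the same prefactor as for L. -/
lemma tendsto_RSumInsert_at_t (h : Generic p v w q t x S) :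
    Tendsto (fun z => theta p (z / t) * RSumInsert p v w q t x S z) (𝓝[≠] t)
      (𝓝 (theta p (t / q) * (q / t) * (theta p w / theta p (q * w / t)) *
        (∏ i ∈ S, wPair p q t (x i) t) * RSum p v (q * w) q t (fun i => q * x i) S)) := by
  have := h.q0; have := h.t0; have := h.w0; have := h.v0
  set K := theta p (t / q) * (q / t) * (theta p w / theta p (q * w / t)) with hK
  have main : Tendsto (fun z => subsetSum
      (fun r => theta p (z / t) * (coef p v w q t (r + 1) * wRin p v q t (r + 1) z))
      (fun r i => wRin p v q t (r + 1) (x i))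
      (fun r j => wRout p v w q t (r + 1) (x j) * wPair p q t (x j) z)
      (fun i j => wPair p q t (x j) (x i)) S) (𝓝[≠] t)
      (𝓝 (subsetSum (fun r => K * coef p v (q * w) q t r)
        (fun r i => wRin p v q t (r + 1) (x i))
        (fun r j => wRout p v w q t (r + 1) (x j) * wPair p q t (x j) t)
        (fun i j => wPair p q t (x j) (x i)) S)) := by
    refine tendsto_subsetSum (fun I _ => ?_) (fun I _ i _ => tendsto_const_nhds)
      (fun I hI j hj => ?_) (fun I _ i _ j _ => tendsto_const_nhds)
    · generalize I.card = r
      have h0 : theta p (q ^ (r + 1) * v * t / (t * q)) ≠ 0 :=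
        h.const' 1 0 r 0 (by simp [pow_succ]; field_simp) (by simp)
      refine tendsto_theta_mul (g := fun z => coef p v w q t (r + 1) * (q / t * (theta p (z / q) *
          theta p (q ^ (r + 1) * v * z / t ^ 2) / theta p (q ^ (r + 1) * v * z / (t * q)))))
        h.hp h.t0 (.mul continuousAt_const (.mul continuousAt_const (.div (.mul
          (analyticAt_theta_div h.hp h.q0 h.t0).continuousAt
          (analyticAt_theta_mul_div h.hp (by positivity) (by positivity) h.t0).continuousAt)
          (analyticAt_theta_mul_div h.hp (by positivity) (by positivity) h.t0).continuousAt h0)))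
        (fun z _ => ?_) ?_
      · unfold wRin
        ring
      · have h1 : theta p (v * q ^ r) ≠ 0 := h.const' 1 0 r 0 (by simp) (by simp)
        have h2 : theta p (q * v / t * q ^ r) ≠ 0 := h.const' 1 0 (r + 1) (-1)
          (by simp [zpow_add₀ h.q0]; field_simp) (by simp)
        rw [coef_eq_mul, coef_eq_mul, pochRatio_succ v, pochRatio_succ' w,
          show q ^ (r + 1) * v * t / (t * q) = v * q ^ r by rw [pow_succ]; field_simp,
          show q ^ (r + 1) * v * t / t ^ 2 = q * v / t * q ^ r by rw [pow_succ]; field_simp, hK]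
        generalize theta p (q * v / t * q ^ r) = c at *
        field_simp
    · have hj := (Finset.mem_sdiff.mp hj).1
      refine (((wPair_regular_right h.hp h.q0 h.t0 (h.x0 j hj) h.t0).2 ?_ ?_).const_mul
        _).tendsto.mono_left nhdsWithin_le_nhds
      · exact h.single' hj 0 0 0 (-1) (by simp; field_simp)
      · exact h.single' hj 0 0 0 0 (by simp; field_simp)
  have rest : ContinuousAt (fun z => subsetSum
      (fun r => coef p v w q t r * wRout p v w q t r z)
      (fun r i => wRin p v q t r (x i) * wPair p q t z (x i))
      (fun r j => wRout p v w q t r (x j))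
      (fun i j => wPair p q t (x j) (x i)) S) t := by
    refine tendsto_subsetSum (fun I _ => ?_) (fun I hI i hi => ?_)
      (fun I _ j _ => tendsto_const_nhds) (fun I _ i _ j _ => tendsto_const_nhds)
    · refine ((wRout_regular h.hp h.v0 h.w0 h.q0 h.t0 _ h.t0).2 ?_ ?_).const_mul _
      · exact h.const' 1 (-1) (-1) 1 (by simp; field_simp) (by simp)
      · exact h.const' 1 0 I.card 0 (by simp; field_simp) (by simp)
    · have hj := hI hi
      have := h.x0 i hj
      refine ((wPair_regular_left h.hp h.q0 h.t0 (h.x0 i hj) h.t0).2 ?_ ?_).const_mul _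
      · exact h.single_inv hj 0 0 0 (-1) (by simp; field_simp)
      · exact h.single_inv hj 0 0 0 (-2) (by simp; field_simp)
  have total := (tendsto_theta_mul_of_continuousAt h.hp h.t0 rest).add main
  have e : subsetSum (fun r => K * coef p v (q * w) q t r)
        (fun r i => wRin p v q t (r + 1) (x i))
        (fun r j => wRout p v w q t (r + 1) (x j) * wPair p q t (x j) t)
        (fun i j => wPair p q t (x j) (x i)) S =
      (K * ∏ i ∈ S, wPair p q t (x i) t) * RSum p v (q * w) q t (fun i => q * x i) S := by
    refine subsetSum_congr_scale _ _ (fun r => rfl) (fun r _ i hi => ?_)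
      (fun r _ i hi => ?_) (fun i hi j hj _ => (wPair_mul_mul _ h.q0 _ _).symm)
    · have h4 := wPair_at_t h hi
      unfold wRin
      rw [show q ^ (r + 1) * v * x i / t ^ 2 = q ^ r * v * (q * x i) / t ^ 2 by ring,
        show q ^ (r + 1) * v * x i / (t * q) = q ^ r * v * (q * x i) / (t * q) by ring,
        mul_assoc q, mul_assoc t, mul_div_mul_comm q, mul_div_mul_comm (theta p _) (theta p _),
        ← h4, mul_assoc q, mul_assoc t, mul_div_mul_comm q, mul_div_mul_comm (theta p _) (theta p _)]
      ring
    · rw [mul_comm]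
      unfold wRout
      rw [show v * (q * x i) / (t * (q * w)) = v * x i / (t * w) by field_simp,
        show v * (q * x i) / (q * (q * w)) = v * x i / (q * w) by field_simp,
        show q ^ (r + 1) * v * x i / q = q ^ r * v * (q * x i) / q by ring,
        show q ^ (r + 1) * v * x i / t = q ^ r * v * (q * x i) / t by ring]
  rw [zero_add, e] at total
  refine total.congr fun z => ?_
  rw [RSumInsert, mul_add, mul_subsetSum, mul_subsetSum]

end residue

/-! ### Residues of the interaction of z with another variable x_m -/

section pairPoles

variable {p q t : ℂ}

lemma tendsto_wPair_right_at_mul (hp : ‖p‖ < 1) (hq : q ≠ 0) (ht : t ≠ 0) {y : ℂ} (hy : y ≠ 0)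
    (h0 : theta p t⁻¹ ≠ 0) :
    Tendsto (fun z => theta p (z / (t * y)) * wPair p q t y z) (𝓝[≠] (t * y))
      (𝓝 (-(theta p q⁻¹ * theta p (q / t) / theta p t⁻¹))) := by
  have hz : t * y ≠ 0 := mul_ne_zero ht hy
  refine tendsto_theta_mul (g := fun z => -(z / (t * y)) * (theta p (t * y / (q * z)) *
    theta p (q * y / z) / theta p (y / z))) hp hz (.mul (by fun_prop) (.div (.mul
      (analyticAt_theta_div_mul hp hz hq hz).continuousAt
      (analyticAt_theta_const_div hp (by positivity) hz).continuousAt)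
      (analyticAt_theta_const_div hp hy hz).continuousAt ?_)) (fun z hz' => ?_) ?_
  · rwa [show y / (t * y) = t⁻¹ by field_simp]
  · unfold wPair
    rw [theta_of_mul_eq_one hp (show t * y / z * (z / (t * y)) = 1 by field_simp)]
    field_simp
  · rw [show y / (t * y) = t⁻¹ by field_simp, show t * y / (q * (t * y)) = q⁻¹ by field_simp,
      show q * y / (t * y) = q / t by field_simp, div_self hz]
    ring

lemma tendsto_wPair_left_at_self (hp : ‖p‖ < 1) (hq : q ≠ 0) (ht : t ≠ 0) {y : ℂ} (hy : y ≠ 0)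
    (h0 : theta p t ≠ 0) :
    Tendsto (fun z => theta p (z / y) * wPair p q t z y) (𝓝[≠] y)
      (𝓝 (theta p (t / q) * theta p q / theta p t)) := by
  refine tendsto_theta_mul (g := fun z => theta p (t * z / (q * y)) *
    theta p (q * z / y) / theta p (t * z / y)) hp hy (.div (.mul
      (analyticAt_theta_mul_div hp ht (by positivity) hy).continuousAt
      (analyticAt_theta_mul_div hp hq hy hy).continuousAt)
      (analyticAt_theta_mul_div hp ht hy hy).continuousAt ?_) (fun z hz' => ?_) ?_
  · rwa [show t * y / y = t by field_simp]
  · unfold wPair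
    ring
  · rw [show t * y / y = t by field_simp, show t * y / (q * y) = t / q by field_simp,
      show q * y / y = q by field_simp]

lemma tendsto_wPair_right_at_self (hp : ‖p‖ < 1) (hq : q ≠ 0) (ht : t ≠ 0) {y : ℂ} (hy : y ≠ 0)
    (h0 : theta p t ≠ 0) :
    Tendsto (fun z => theta p (z / y) * wPair p q t y z) (𝓝[≠] y)
      (𝓝 (-(theta p (t / q) * theta p q / theta p t))) := by
  refine tendsto_theta_mul (g := fun z => -(z / y) * (theta p (t * y / (q * z)) *
    theta p (q * y / z) / theta p (t * y / z))) hp hy (.mul (by fun_prop) (.div (.mul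
      (analyticAt_theta_div_mul hp (by positivity) hq hy).continuousAt
      (analyticAt_theta_const_div hp (by positivity) hy).continuousAt)
      (analyticAt_theta_const_div hp (by positivity) hy).continuousAt ?_)) (fun z hz' => ?_) ?_
  · rwa [show t * y / y = t by field_simp]
  · unfold wPair
    rw [theta_of_mul_eq_one hp (show y / z * (z / y) = 1 by field_simp)]
    field_simp
  · rw [show t * y / y = t by field_simp, show t * y / (q * y) = t / q by field_simp,
      show q * y / y = q by field_simp, div_self hy]
    ring

/-- This reflection makes the interactions of a third variable with x_m and with t x_m equal, inside
or outside the subset, so the residues at t x_m have a common factor for each remaining variable. -/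
lemma wPair_mul_eq (hp : ‖p‖ < 1) (hq : q ≠ 0) (ht : t ≠ 0) {y z : ℂ} (hy : y ≠ 0) (hz : z ≠ 0) :
    wPair p q t z (t * y) = wPair p q t y z := by
  unfold wPair
  rw [theta_of_mul_eq_one hp (show t * z / (q * (t * y)) * (q * y / z) = 1 by field_simp),
    theta_of_mul_eq_one hp (show q * z / (t * y) * (t * y / (q * z)) = 1 by field_simp),
    theta_of_mul_eq_one hp (show z / (t * y) * (t * y / z) = 1 by field_simp),
    theta_of_mul_eq_one hp (show t * z / (t * y) * (y / z) = 1 by field_simp)]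
  field_simp

end pairPoles

section residue

variable {ι : Type*} [DecidableEq ι] {p v w q t : ℂ} {x : ι → ℂ} {S : Finset ι} {m : ι}

variable (p v w q t x) in
lemma LSumInsert_insert (hm : m ∉ S) (z : ℂ) : LSumInsert p v w q t x (insert m S) z =
    (subsetSum (fun r => coef p v w q t r * wLout p w q t r z * wLout p w q t r (x m))
      (fun r i => wLin p v w q t r (x i) * wPair p q t (x i) z * wPair p q t (x i) (x m))
      (fun r j => wLout p w q t r (x j)) (fun i j => wPair p q t (x i) (x j)) S +
    subsetSum (fun r => coef p v w q t (r + 1) * wLout p w q t (r + 1) z *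
        (wLin p v w q t (r + 1) (x m) * wPair p q t (x m) z))
      (fun r i => wLin p v w q t (r + 1) (x i) * wPair p q t (x i) z)
      (fun r j => wLout p w q t (r + 1) (x j) * wPair p q t (x m) (x j))
      (fun i j => wPair p q t (x i) (x j)) S) +
    (subsetSum (fun r => coef p v w q t (r + 1) * wLin p v w q t (r + 1) z *
        (wLout p w q t (r + 1) (x m) * wPair p q t z (x m)))
      (fun r i => wLin p v w q t (r + 1) (x i) * wPair p q t (x i) (x m))
      (fun r j => wLout p w q t (r + 1) (x j) * wPair p q t z (x j))
      (fun i j => wPair p q t (x i) (x j)) S +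
    subsetSum (fun r => coef p v w q t (r + 1 + 1) * wLin p v w q t (r + 1 + 1) z *
        wLin p v w q t (r + 1 + 1) (x m))
      (fun r i => wLin p v w q t (r + 1 + 1) (x i))
      (fun r j => wLout p w q t (r + 1 + 1) (x j) * wPair p q t z (x j) * wPair p q t (x m) (x j))
      (fun i j => wPair p q t (x i) (x j)) S) := by
  rw [LSumInsert, subsetSum_insert _ _ _ _ hm, subsetSum_insert _ _ _ _ hm]

variable (p v w q t x) in
lemma RSumInsert_insert (hm : m ∉ S) (z : ℂ) : RSumInsert p v w q t x (insert m S) z =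
    (subsetSum (fun r => coef p v w q t r * wRout p v w q t r z * wRout p v w q t r (x m))
      (fun r i => wRin p v q t r (x i) * wPair p q t z (x i) * wPair p q t (x m) (x i))
      (fun r j => wRout p v w q t r (x j)) (fun i j => wPair p q t (x j) (x i)) S +
    subsetSum (fun r => coef p v w q t (r + 1) * wRout p v w q t (r + 1) z *
        (wRin p v q t (r + 1) (x m) * wPair p q t z (x m)))
      (fun r i => wRin p v q t (r + 1) (x i) * wPair p q t z (x i))
      (fun r j => wRout p v w q t (r + 1) (x j) * wPair p q t (x j) (x m))
      (fun i j => wPair p q t (x j) (x i)) S) +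
    (subsetSum (fun r => coef p v w q t (r + 1) * wRin p v q t (r + 1) z *
        (wRout p v w q t (r + 1) (x m) * wPair p q t (x m) z))
      (fun r i => wRin p v q t (r + 1) (x i) * wPair p q t (x m) (x i))
      (fun r j => wRout p v w q t (r + 1) (x j) * wPair p q t (x j) z)
      (fun i j => wPair p q t (x j) (x i)) S +
    subsetSum (fun r => coef p v w q t (r + 1 + 1) * wRin p v q t (r + 1 + 1) z *
        wRin p v q t (r + 1 + 1) (x m))
      (fun r i => wRin p v q t (r + 1 + 1) (x i))
      (fun r j => wRout p v w q t (r + 1 + 1) (x j) * wPair p q t (x j) z * wPair p q t (x j) (x m))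
      (fun i j => wPair p q t (x j) (x i)) S) := by
  rw [RSumInsert, subsetSum_insert _ _ _ _ hm, subsetSum_insert _ _ _ _ hm]

lemma pochRatio_mul_succ (r : ℕ) : coef p v w q t (r + 1) =
    theta p v / theta p (q * v / t) * (theta p w / theta p (q * w / t)) *
      coef p (q * v) (q * w) q t r := by
  rw [coef_eq_mul, coef_eq_mul, pochRatio_succ', pochRatio_succ']; ring

set_option maxHeartbeats 1000000 in
-- The singular factor is the interaction of x_m inside with z outside. In the residue the
-- r-dependent thetas of these two variables cancel, so both drop out of the sum and only v and w
-- are shifted.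
lemma tendsto_LSumInsert_at_mul (hm : m ∉ S) (h : Generic p v w q t x (insert m S)) :
    Tendsto (fun z => theta p (z / (t * x m)) * LSumInsert p v w q t x (insert m S) z)
      (𝓝[≠] (t * x m))
      (𝓝 (-(theta p q⁻¹ * theta p (q / t) / theta p t⁻¹) * (q / t * theta p (t * x m / q) *
          theta p (v * x m / (t * w)) / (theta p (x m) * theta p (v * x m / (q * w)))) *
          (theta p v / theta p (q * v / t) * (theta p w / theta p (q * w / t))) *
          (∏ i ∈ S, wPair p q t (x i) (t * x m)) * LSum p (q * v) (q * w) q t x S)) := by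
  have hq := h.q0; have ht := h.t0; have hw := h.w0; have hv := h.v0
  have mS : m ∈ insert m S := Finset.mem_insert_self _ _
  have sub : ∀ i ∈ S, i ∈ insert m S := fun i => Finset.mem_insert_of_mem
  have hne : ∀ i ∈ S, i ≠ m := fun i hi e => hm (e ▸ hi)
  have hy := h.x0 m mS
  have hz : t * x m ≠ 0 := mul_ne_zero ht hy
  set ρ := -(theta p q⁻¹ * theta p (q / t) / theta p t⁻¹) with hρ
  have cOut : ∀ r, ContinuousAt (wLout p w q t r) (t * x m) := fun r =>
    (wLout_regular h.hp hw hq ht r hz).2 (h.single' mS 0 0 0 0 (by simp; field_simp))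
      (h.single' mS 0 (-1) (-r - 1) 1 (by simp [zpow_sub₀ hq]; field_simp))
  have cIn : ∀ r, ContinuousAt (wLin p v w q t r) (t * x m) := fun r =>
    (wLin_regular h.hp hv hw hq ht r hz).2 (h.single' mS 1 (-1) (-1) 1 (by simp; field_simp))
      (h.single' mS 0 (-1) (-r) 1 (by simp; field_simp))
  have cRight : ∀ i ∈ S, ContinuousAt (fun z => wPair p q t (x i) z) (t * x m) := fun i hi =>
    (wPair_regular_right h.hp hq ht (h.x0 i (sub i hi)) hz).2
      (h.pair' (sub i hi) mS (hne i hi) 0 0 0 (-1) (by simp; field_simp))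
      (h.pair' (sub i hi) mS (hne i hi) 0 0 0 0 (by simp; field_simp))
  have cLeft : ∀ i ∈ S, ContinuousAt (fun z => wPair p q t z (x i)) (t * x m) := fun i hi =>
    (wPair_regular_left h.hp hq ht (h.x0 i (sub i hi)) hz).2
      (h.pair' mS (sub i hi) (hne i hi).symm 0 0 0 1 (by simp))
      (h.pair' mS (sub i hi) (hne i hi).symm 0 0 0 2 (by simp; ring))
  have cSelf : ContinuousAt (fun z => wPair p q t z (x m)) (t * x m) :=
    (wPair_regular_left h.hp hq ht hy hz).2
      (h.const' 0 0 0 1 (by simp; field_simp) (by simp))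
      (h.const' 0 0 0 2 (by simp; field_simp) (by simp))
  have ht' : theta p t⁻¹ ≠ 0 := h.const' 0 0 0 (-1) (by simp) (by simp)
  have main := tendsto_mul_subsetSum (l := 𝓝[≠] (t * x m)) (S := S) (fun z => theta p (z / (t * x m)))
    (c := fun z r => coef p v w q t (r + 1) * wLout p w q t (r + 1) z *
        (wLin p v w q t (r + 1) (x m) * wPair p q t (x m) z))
    (A := fun z r i => wLin p v w q t (r + 1) (x i) * wPair p q t (x i) z)
    (B := fun z r j => wLout p w q t (r + 1) (x j) * wPair p q t (x m) (x j))
    (X := fun z i j => wPair p q t (x i) (x j))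
    (c' := fun r => coef p v w q t (r + 1) * wLout p w q t (r + 1) (t * x m) *
        wLin p v w q t (r + 1) (x m) * ρ)
    (A' := fun r i => wLin p v w q t (r + 1) (x i) * wPair p q t (x i) (t * x m))
    (B' := fun r j => wLout p w q t (r + 1) (x j) * wPair p q t (x m) (x j))
    (X' := fun i j => wPair p q t (x i) (x j))
    (fun I _ => by
      refine ((((cOut (I.card + 1)).tendsto.mono_left nhdsWithin_le_nhds).const_mul
        (coef p v w q t (I.card + 1))).mul_const (wLin p v w q t (I.card + 1) (x m))).mul
        (tendsto_wPair_right_at_mul h.hp hq ht hy ht') |>.congr fun z => ?_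
      ring)
    (fun I hI i hi => ((cRight i (hI hi)).tendsto.mono_left nhdsWithin_le_nhds).const_mul _)
    (fun I _ j _ => tendsto_const_nhds) (fun I _ i _ j _ => tendsto_const_nhds)
  have r1 : ContinuousAt (fun z => subsetSum
      (fun r => coef p v w q t r * wLout p w q t r z * wLout p w q t r (x m))
      (fun r i => wLin p v w q t r (x i) * wPair p q t (x i) z * wPair p q t (x i) (x m))
      (fun r j => wLout p w q t r (x j)) (fun i j => wPair p q t (x i) (x j)) S) (t * x m) :=
    tendsto_subsetSum (fun I _ => ((cOut _).const_mul _).mul_const _)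
      (fun I hI i hi => ((cRight i (hI hi)).const_mul _).mul_const _)
      (fun I _ j _ => tendsto_const_nhds) (fun I _ i _ j _ => tendsto_const_nhds)
  have r2 : ContinuousAt (fun z => subsetSum
      (fun r => coef p v w q t (r + 1) * wLin p v w q t (r + 1) z *
        (wLout p w q t (r + 1) (x m) * wPair p q t z (x m)))
      (fun r i => wLin p v w q t (r + 1) (x i) * wPair p q t (x i) (x m))
      (fun r j => wLout p w q t (r + 1) (x j) * wPair p q t z (x j))
      (fun i j => wPair p q t (x i) (x j)) S) (t * x m) :=
    tendsto_subsetSum (fun I _ => ((cIn _).const_mul _).mul (cSelf.const_mul _))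
      (fun I _ i _ => tendsto_const_nhds)
      (fun I hI j hj => (cLeft j (Finset.mem_sdiff.mp hj).1).const_mul _)
      (fun I _ i _ j _ => tendsto_const_nhds)
  have r3 : ContinuousAt (fun z => subsetSum
      (fun r => coef p v w q t (r + 1 + 1) * wLin p v w q t (r + 1 + 1) z *
        wLin p v w q t (r + 1 + 1) (x m))
      (fun r i => wLin p v w q t (r + 1 + 1) (x i))
      (fun r j => wLout p w q t (r + 1 + 1) (x j) * wPair p q t z (x j) * wPair p q t (x m) (x j))
      (fun i j => wPair p q t (x i) (x j)) S) (t * x m) :=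
    tendsto_subsetSum (fun I _ => ((cIn _).const_mul _).mul_const _)
      (fun I _ i _ => tendsto_const_nhds)
      (fun I hI j hj => ((cLeft j (Finset.mem_sdiff.mp hj).1).const_mul _).mul_const _)
      (fun I _ i _ j _ => tendsto_const_nhds)
  -- Of the four cases for the membership of z and x_m, three are regular and contribute 0.
  have total := ((tendsto_theta_mul_of_continuousAt h.hp hz r1).add main).add
    ((tendsto_theta_mul_of_continuousAt h.hp hz r2).add
      (tendsto_theta_mul_of_continuousAt h.hp hz r3))
  rw [zero_add, add_zero, add_zero] at total
  rw [subsetSum_congr_scale (ρ * (q / t * theta p (t * x m / q) *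
          theta p (v * x m / (t * w)) / (theta p (x m) * theta p (v * x m / (q * w)))) *
          (theta p v / theta p (q * v / t) * (theta p w / theta p (q * w / t))))
      (fun i => wPair p q t (x i) (t * x m)) (c' := coef p (q * v) (q * w) q t)
      (A' := fun r i => wLin p (q * v) (q * w) q t r (x i))
      (B' := fun r j => wLout p (q * w) q t r (x j)) (X' := fun i j => wPair p q t (x i) (x j))
      (fun r => ?_) (fun r _ i hi => ?_)
      (fun r _ i hi => ?_) (fun i hi j hj _ => rfl)] at total
  · refine total.congr fun z => ?_
    rw [LSumInsert_insert p v w q t x hm]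
    rw [mul_add, mul_add, mul_add]
  · rw [pochRatio_mul_succ]
    have h1 : theta p (t * q ^ (-((r + 1 : ℕ) : ℤ)) * x m / (q * w)) ≠ 0 :=
      h.single' mS 0 (-1) (-(r + 1 : ℕ) - 1) 1 (by simp only [zpow_sub₀ hq]; simp; field_simp)
    have h2 : theta p (q ^ (-((r + 1 : ℕ) : ℤ)) * x m / w) ≠ 0 :=
      h.single' mS 0 (-1) (-(r + 1 : ℕ)) 0 (by simp; field_simp)
    unfold wLin wLout
    rw [show q ^ (-((r + 1 : ℕ) : ℤ)) * (t * x m) / (t * w) =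
        q ^ (-((r + 1 : ℕ) : ℤ)) * x m / w by field_simp,
      show t * x m / t = x m by field_simp,
      show q ^ (-((r + 1 : ℕ) : ℤ)) * (t * x m) / (q * w) =
        t * q ^ (-((r + 1 : ℕ) : ℤ)) * x m / (q * w) by ring]
    generalize theta p (t * q ^ (-((r + 1 : ℕ) : ℤ)) * x m / (q * w)) = c1 at h1
    generalize theta p (q ^ (-((r + 1 : ℕ) : ℤ)) * x m / w) = c2 at h2
    field_simp
  · rw [mul_comm]
    unfold wLin
    push_cast
    rw [neg_add, zpow_add₀ hq, zpow_neg_one,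
      show q * v * x i / (t * (q * w)) = v * x i / (t * w) by field_simp,
      show q * v * x i / (q * (q * w)) = v * x i / (q * w) by field_simp,
      show t * (q ^ (-(r : ℤ)) * q⁻¹) * x i / (q * w) = t * q ^ (-(r : ℤ)) * x i / (q * (q * w)) by
        field_simp,
      show q ^ (-(r : ℤ)) * q⁻¹ * x i / w = q ^ (-(r : ℤ)) * x i / (q * w) by field_simp]
  · rw [mul_comm, wPair_mul_eq h.hp hq ht hy (h.x0 i (sub i hi))]
    unfold wLout
    push_cast
    rw [neg_add, zpow_add₀ hq, zpow_neg_one,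
      show q ^ (-(r : ℤ)) * q⁻¹ * x i / (t * w) = q ^ (-(r : ℤ)) * x i / (t * (q * w)) by
        field_simp,
      show q ^ (-(r : ℤ)) * q⁻¹ * x i / (q * w) = q ^ (-(r : ℤ)) * x i / (q * (q * w)) by
        field_simp]

set_option maxHeartbeats 1000000 in
-- The interaction in R is reversed, so here z is inside and x_m outside; the prefactor agrees with
-- that of L.
lemma tendsto_RSumInsert_at_mul (hm : m ∉ S) (h : Generic p v w q t x (insert m S)) :
    Tendsto (fun z => theta p (z / (t * x m)) * RSumInsert p v w q t x (insert m S) z)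
      (𝓝[≠] (t * x m))
      (𝓝 (-(theta p q⁻¹ * theta p (q / t) / theta p t⁻¹) * (q / t * theta p (t * x m / q) *
          theta p (v * x m / (t * w)) / (theta p (x m) * theta p (v * x m / (q * w)))) *
          (theta p v / theta p (q * v / t) * (theta p w / theta p (q * w / t))) *
          (∏ i ∈ S, wPair p q t (x i) (t * x m)) * RSum p (q * v) (q * w) q t x S)) := by
  have hq := h.q0; have ht := h.t0; have hw := h.w0; have hv := h.v0
  have mS : m ∈ insert m S := Finset.mem_insert_self _ _
  have sub : ∀ i ∈ S, i ∈ insert m S := fun i => Finset.mem_insert_of_mem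
  have hne : ∀ i ∈ S, i ≠ m := fun i hi e => hm (e ▸ hi)
  have hy := h.x0 m mS
  have hz : t * x m ≠ 0 := mul_ne_zero ht hy
  set ρ := -(theta p q⁻¹ * theta p (q / t) / theta p t⁻¹) with hρ
  have cOut : ∀ r, ContinuousAt (wRout p v w q t r) (t * x m) := fun r =>
    (wRout_regular h.hp hv hw hq ht r hz).2 (h.single' mS 1 (-1) (-1) 1 (by simp; field_simp))
      (h.single' mS 1 0 r 0 (by simp; field_simp))
  have cIn : ∀ r, ContinuousAt (wRin p v q t r) (t * x m) := fun r =>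
    (wRin_regular h.hp hv hq ht r hz).2 (h.single' mS 0 0 0 0 (by simp; field_simp))
      (h.single' mS 1 0 (r - 1) 0 (by simp [zpow_sub₀ hq]; field_simp))
  have cRight : ∀ i ∈ S, ContinuousAt (fun z => wPair p q t (x i) z) (t * x m) := fun i hi =>
    (wPair_regular_right h.hp hq ht (h.x0 i (sub i hi)) hz).2
      (h.pair' (sub i hi) mS (hne i hi) 0 0 0 (-1) (by simp; field_simp))
      (h.pair' (sub i hi) mS (hne i hi) 0 0 0 0 (by simp; field_simp))
  have cLeft : ∀ i ∈ S, ContinuousAt (fun z => wPair p q t z (x i)) (t * x m) := fun i hi =>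
    (wPair_regular_left h.hp hq ht (h.x0 i (sub i hi)) hz).2
      (h.pair' mS (sub i hi) (hne i hi).symm 0 0 0 1 (by simp))
      (h.pair' mS (sub i hi) (hne i hi).symm 0 0 0 2 (by simp; ring))
  have cSelf : ContinuousAt (fun z => wPair p q t z (x m)) (t * x m) :=
    (wPair_regular_left h.hp hq ht hy hz).2
      (h.const' 0 0 0 1 (by simp; field_simp) (by simp))
      (h.const' 0 0 0 2 (by simp; field_simp) (by simp))
  have ht' : theta p t⁻¹ ≠ 0 := h.const' 0 0 0 (-1) (by simp) (by simp)
  have main := tendsto_mul_subsetSum (l := 𝓝[≠] (t * x m)) (S := S) (fun z => theta p (z / (t * x m)))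
    (c := fun z r => coef p v w q t (r + 1) * wRin p v q t (r + 1) z *
        (wRout p v w q t (r + 1) (x m) * wPair p q t (x m) z))
    (A := fun _ r i => wRin p v q t (r + 1) (x i) * wPair p q t (x m) (x i))
    (B := fun z r j => wRout p v w q t (r + 1) (x j) * wPair p q t (x j) z)
    (X := fun _ i j => wPair p q t (x j) (x i))
    (c' := fun r => coef p v w q t (r + 1) * wRin p v q t (r + 1) (t * x m) *
        wRout p v w q t (r + 1) (x m) * ρ)
    (A' := fun r i => wRin p v q t (r + 1) (x i) * wPair p q t (x m) (x i))
    (B' := fun r j => wRout p v w q t (r + 1) (x j) * wPair p q t (x j) (t * x m))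
    (X' := fun i j => wPair p q t (x j) (x i))
    (fun I _ => by
      refine ((((cIn (I.card + 1)).tendsto.mono_left nhdsWithin_le_nhds).const_mul
        (coef p v w q t (I.card + 1))).mul_const (wRout p v w q t (I.card + 1) (x m))).mul
        (tendsto_wPair_right_at_mul h.hp hq ht hy ht') |>.congr fun z => ?_
      ring)
    (fun I _ i _ => tendsto_const_nhds)
    (fun I _ j hj => ((cRight j (Finset.mem_sdiff.mp hj).1).tendsto.mono_left
      nhdsWithin_le_nhds).const_mul _) (fun I _ i _ j _ => tendsto_const_nhds)
  have r1 : ContinuousAt (fun z => subsetSum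
      (fun r => coef p v w q t r * wRout p v w q t r z * wRout p v w q t r (x m))
      (fun r i => wRin p v q t r (x i) * wPair p q t z (x i) * wPair p q t (x m) (x i))
      (fun r j => wRout p v w q t r (x j)) (fun i j => wPair p q t (x j) (x i)) S) (t * x m) :=
    tendsto_subsetSum (fun I _ => ((cOut _).const_mul _).mul_const _)
      (fun I hI i hi => ((cLeft i (hI hi)).const_mul _).mul_const _)
      (fun I _ j _ => tendsto_const_nhds) (fun I _ i _ j _ => tendsto_const_nhds)
  have r2 : ContinuousAt (fun z => subsetSum
      (fun r => coef p v w q t (r + 1) * wRout p v w q t (r + 1) z *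
        (wRin p v q t (r + 1) (x m) * wPair p q t z (x m)))
      (fun r i => wRin p v q t (r + 1) (x i) * wPair p q t z (x i))
      (fun r j => wRout p v w q t (r + 1) (x j) * wPair p q t (x j) (x m))
      (fun i j => wPair p q t (x j) (x i)) S) (t * x m) :=
    tendsto_subsetSum (fun I _ => ((cOut _).const_mul _).mul (cSelf.const_mul _))
      (fun I hI i hi => (cLeft i (hI hi)).const_mul _)
      (fun I _ j _ => tendsto_const_nhds)
      (fun I _ i _ j _ => tendsto_const_nhds)
  have r3 : ContinuousAt (fun z => subsetSum
      (fun r => coef p v w q t (r + 1 + 1) * wRin p v q t (r + 1 + 1) z *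
        wRin p v q t (r + 1 + 1) (x m))
      (fun r i => wRin p v q t (r + 1 + 1) (x i))
      (fun r j => wRout p v w q t (r + 1 + 1) (x j) * wPair p q t (x j) z *
        wPair p q t (x j) (x m))
      (fun i j => wPair p q t (x j) (x i)) S) (t * x m) :=
    tendsto_subsetSum (fun I _ => ((cIn _).const_mul _).mul_const _)
      (fun I _ i _ => tendsto_const_nhds)
      (fun I hI j hj => ((cRight j (Finset.mem_sdiff.mp hj).1).const_mul _).mul_const _)
      (fun I _ i _ j _ => tendsto_const_nhds)
  have total := ((tendsto_theta_mul_of_continuousAt h.hp hz r1).add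
    (tendsto_theta_mul_of_continuousAt h.hp hz r2)).add
    (main.add (tendsto_theta_mul_of_continuousAt h.hp hz r3))
  rw [zero_add, add_zero, zero_add] at total
  rw [subsetSum_congr_scale (ρ * (q / t * theta p (t * x m / q) *
          theta p (v * x m / (t * w)) / (theta p (x m) * theta p (v * x m / (q * w)))) *
          (theta p v / theta p (q * v / t) * (theta p w / theta p (q * w / t))))
      (fun i => wPair p q t (x i) (t * x m)) (c' := coef p (q * v) (q * w) q t)
      (A' := fun r i => wRin p (q * v) q t r (x i))
      (B' := fun r j => wRout p (q * v) (q * w) q t r (x j))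
      (X' := fun i j => wPair p q t (x j) (x i))
      (fun r => ?_) (fun r _ i hi => ?_)
      (fun r _ i hi => ?_) (fun i hi j hj _ => rfl)] at total
  · refine total.congr fun z => ?_
    rw [RSumInsert_insert p v w q t x hm]
    rw [mul_add, mul_add, mul_add]
  · rw [pochRatio_mul_succ]
    have h1 : theta p (q ^ (r + 1) * v * x m / t) ≠ 0 :=
      h.single' mS 1 0 (r + 1) (-1) (by simp [zpow_add₀ hq, pow_succ]; field_simp)
    have h2 : theta p (q ^ (r + 1) * v * x m / q) ≠ 0 :=
      h.single' mS 1 0 r 0 (by simp [pow_succ]; field_simp)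
    unfold wRin wRout
    rw [show q ^ (r + 1) * v * (t * x m) / t ^ 2 = q ^ (r + 1) * v * x m / t by field_simp,
      show t * x m / t = x m by field_simp,
      show q ^ (r + 1) * v * (t * x m) / (t * q) = q ^ (r + 1) * v * x m / q by field_simp]
    generalize theta p (q ^ (r + 1) * v * x m / t) = c1 at h1
    generalize theta p (q ^ (r + 1) * v * x m / q) = c2 at h2
    field_simp
  · rw [mul_comm, wPair_mul_eq h.hp hq ht hy (h.x0 i (sub i hi))]
    unfold wRin
    rw [pow_succ, mul_assoc (q ^ r)]
  · rw [mul_comm]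
    unfold wRout
    rw [show q * v * x i / (t * (q * w)) = v * x i / (t * w) by field_simp,
      show q * v * x i / (q * (q * w)) = v * x i / (q * w) by field_simp,
      pow_succ, mul_assoc (q ^ r)]

set_option maxHeartbeats 1000000 in
-- Singular terms have exactly one of z, x_m in the subset. At z = x_m the two cases are exchanged
-- by swapping equal variables, while θ(x_m/z) and θ(z/x_m) have opposite residues.
lemma noPole_LSumInsert_at_self (hm : m ∉ S) (h : Generic p v w q t x (insert m S)) :
    NoPole (LSumInsert p v w q t x (insert m S)) (x m) := by
  have hq := h.q0; have ht := h.t0; have hw := h.w0; have hv := h.v0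
  have mS : m ∈ insert m S := Finset.mem_insert_self _ _
  have sub : ∀ i ∈ S, i ∈ insert m S := fun i => Finset.mem_insert_of_mem
  have hne : ∀ i ∈ S, i ≠ m := fun i hi e => hm (e ▸ hi)
  have hz := h.x0 m mS
  refine NoPole.of_theta h.hp hz ?_
  set ρ := theta p (t / q) * theta p q / theta p t with hρ
  have cOut : ∀ r, ContinuousAt (wLout p w q t r) (x m) := fun r =>
    (wLout_regular h.hp hw hq ht r hz).2 (h.single' mS 0 0 0 (-1) (by simp; field_simp))
      (h.single' mS 0 (-1) (-r - 1) 0 (by simp [zpow_sub₀ hq]; field_simp))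
  have cIn : ∀ r, ContinuousAt (wLin p v w q t r) (x m) := fun r =>
    (wLin_regular h.hp hv hw hq ht r hz).2 (h.single' mS 1 (-1) (-1) 0 (by simp; field_simp))
      (h.single' mS 0 (-1) (-r) 0 (by simp; field_simp))
  have cRight : ∀ i ∈ S, ContinuousAt (fun z => wPair p q t (x i) z) (x m) := fun i hi =>
    (wPair_regular_right h.hp hq ht (h.x0 i (sub i hi)) hz).2
      (h.pair' (sub i hi) mS (hne i hi) 0 0 0 0 (by simp))
      (h.pair' (sub i hi) mS (hne i hi) 0 0 0 1 (by simp))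
  have cLeft : ∀ i ∈ S, ContinuousAt (fun z => wPair p q t z (x i)) (x m) := fun i hi =>
    (wPair_regular_left h.hp hq ht (h.x0 i (sub i hi)) hz).2
      (h.pair' mS (sub i hi) (hne i hi).symm 0 0 0 0 (by simp))
      (h.pair' mS (sub i hi) (hne i hi).symm 0 0 0 1 (by simp))
  have ht' : theta p t ≠ 0 := h.const' 0 0 0 1 (by simp) (by simp)
  have main1 := tendsto_mul_subsetSum (l := 𝓝[≠] (x m)) (S := S) (fun z => theta p (z / x m))
    (c := fun z r => coef p v w q t (r + 1) * wLout p w q t (r + 1) z *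
        (wLin p v w q t (r + 1) (x m) * wPair p q t (x m) z))
    (A := fun z r i => wLin p v w q t (r + 1) (x i) * wPair p q t (x i) z)
    (B := fun z r j => wLout p w q t (r + 1) (x j) * wPair p q t (x m) (x j))
    (X := fun z i j => wPair p q t (x i) (x j))
    (c' := fun r => coef p v w q t (r + 1) * wLout p w q t (r + 1) (x m) *
        wLin p v w q t (r + 1) (x m) * -ρ)
    (A' := fun r i => wLin p v w q t (r + 1) (x i) * wPair p q t (x i) (x m))
    (B' := fun r j => wLout p w q t (r + 1) (x j) * wPair p q t (x m) (x j))
    (X' := fun i j => wPair p q t (x i) (x j))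
    (fun I _ => by
      refine ((((cOut (I.card + 1)).tendsto.mono_left nhdsWithin_le_nhds).const_mul
        (coef p v w q t (I.card + 1))).mul_const (wLin p v w q t (I.card + 1) (x m))).mul
        (tendsto_wPair_right_at_self h.hp hq ht hz ht') |>.congr fun z => ?_
      ring)
    (fun I hI i hi => ((cRight i (hI hi)).tendsto.mono_left nhdsWithin_le_nhds).const_mul _)
    (fun I _ j _ => tendsto_const_nhds) (fun I _ i _ j _ => tendsto_const_nhds)
  have main2 := tendsto_mul_subsetSum (l := 𝓝[≠] (x m)) (S := S) (fun z => theta p (z / x m))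
    (c := fun z r => coef p v w q t (r + 1) * wLin p v w q t (r + 1) z *
        (wLout p w q t (r + 1) (x m) * wPair p q t z (x m)))
    (A := fun _ r i => wLin p v w q t (r + 1) (x i) * wPair p q t (x i) (x m))
    (B := fun z r j => wLout p w q t (r + 1) (x j) * wPair p q t z (x j))
    (X := fun _ i j => wPair p q t (x i) (x j))
    (c' := fun r => coef p v w q t (r + 1) * wLin p v w q t (r + 1) (x m) *
        wLout p w q t (r + 1) (x m) * ρ)
    (A' := fun r i => wLin p v w q t (r + 1) (x i) * wPair p q t (x i) (x m))
    (B' := fun r j => wLout p w q t (r + 1) (x j) * wPair p q t (x m) (x j))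
    (X' := fun i j => wPair p q t (x i) (x j))
    (fun I _ => by
      refine ((((cIn (I.card + 1)).tendsto.mono_left nhdsWithin_le_nhds).const_mul
        (coef p v w q t (I.card + 1))).mul_const (wLout p w q t (I.card + 1) (x m))).mul
        (tendsto_wPair_left_at_self h.hp hq ht hz ht') |>.congr fun z => ?_
      ring)
    (fun I _ i _ => tendsto_const_nhds)
    (fun I _ j hj => ((cLeft j (Finset.mem_sdiff.mp hj).1).tendsto.mono_left
      nhdsWithin_le_nhds).const_mul _) (fun I _ i _ j _ => tendsto_const_nhds)
  have r1 : ContinuousAt (fun z => subsetSum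
      (fun r => coef p v w q t r * wLout p w q t r z * wLout p w q t r (x m))
      (fun r i => wLin p v w q t r (x i) * wPair p q t (x i) z * wPair p q t (x i) (x m))
      (fun r j => wLout p w q t r (x j)) (fun i j => wPair p q t (x i) (x j)) S) (x m) :=
    tendsto_subsetSum (fun I _ => ((cOut _).const_mul _).mul_const _)
      (fun I hI i hi => ((cRight i (hI hi)).const_mul _).mul_const _)
      (fun I _ j _ => tendsto_const_nhds) (fun I _ i _ j _ => tendsto_const_nhds)
  have r3 : ContinuousAt (fun z => subsetSum
      (fun r => coef p v w q t (r + 1 + 1) * wLin p v w q t (r + 1 + 1) z *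
        wLin p v w q t (r + 1 + 1) (x m))
      (fun r i => wLin p v w q t (r + 1 + 1) (x i))
      (fun r j => wLout p w q t (r + 1 + 1) (x j) * wPair p q t z (x j) * wPair p q t (x m) (x j))
      (fun i j => wPair p q t (x i) (x j)) S) (x m) :=
    tendsto_subsetSum (fun I _ => ((cIn _).const_mul _).mul_const _)
      (fun I _ i _ => tendsto_const_nhds)
      (fun I hI j hj => ((cLeft j (Finset.mem_sdiff.mp hj).1).const_mul _).mul_const _)
      (fun I _ i _ j _ => tendsto_const_nhds)
  have total := ((tendsto_theta_mul_of_continuousAt h.hp hz r1).add main1).add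
    (main2.add (tendsto_theta_mul_of_continuousAt h.hp hz r3))
  rw [zero_add, add_zero, subsetSum_congr_scale (-1) (fun _ => 1) (fun r => ?_)
    (fun r _ i _ => (one_mul _).symm) (fun r _ i _ => (one_mul _).symm) (fun _ _ _ _ _ => rfl),
    Finset.prod_const_one, mul_one, neg_one_mul, neg_add_cancel] at total
  · refine total.congr fun z => ?_
    rw [LSumInsert_insert p v w q t x hm]
    rw [mul_add, mul_add, mul_add]
  · ring

end residue

/-! ### Cancellation of the poles of L at z = w q^(s+1) -/

section shiftedPoles

variable {ι : Type*} {p v w q t : ℂ} {x : ι → ℂ} {S : Finset ι}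

/-- A variable w q^(s+1) outside the subset affects an inside element exactly as raising the
cardinality from s to s + 1 does. This matches a subset with the same subset enlarged by z. -/
lemma wLin_mul_wPair (h : Generic p v w q t x S) (s : ℕ) {i : ι} (hi : i ∈ S) :
    wLin p v w q t s (x i) * wPair p q t (x i) (w * q ^ (s + 1)) =
      wLin p v w q t (s + 1) (x i) := by
  have hq := h.q0; have ht := h.t0; have hw := h.w0; have hv := h.v0
  have h1 : theta p (t * q ^ (-(s : ℤ)) * x i / (q * w)) ≠ 0 :=
    h.single' hi 0 (-1) (-s - 1) 1 (by simp [zpow_sub₀ hq]; field_simp)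
  have h2 : theta p (q ^ (-(s : ℤ)) * x i / w) ≠ 0 :=
    h.single' hi 0 (-1) (-s) 0 (by simp [pow_succ]; field_simp)
  unfold wLin wPair
  push_cast
  rw [neg_add, zpow_add₀ hq, zpow_neg_one,
    show t * x i / (q * (w * q ^ (s + 1))) = t * (q ^ (-(s : ℤ)) * q⁻¹) * x i / (q * w) by
      simp [pow_succ]; field_simp,
    show q * x i / (w * q ^ (s + 1)) = q ^ (-(s : ℤ)) * x i / w by simp [pow_succ]; field_simp,
    show x i / (w * q ^ (s + 1)) = q ^ (-(s : ℤ)) * q⁻¹ * x i / w by simp [pow_succ]; field_simp,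
    show t * x i / (w * q ^ (s + 1)) = t * q ^ (-(s : ℤ)) * x i / (q * w) by simp [pow_succ]; field_simp]
  generalize theta p (t * q ^ (-(s : ℤ)) * x i / (q * w)) = c1 at h1
  generalize theta p (q ^ (-(s : ℤ)) * x i / w) = c2 at h2
  field_simp

/-- The counterpart for outside elements: with z inside, its interaction lowers the cardinality in
their weights from s + 1 back to s. -/
lemma wLout_mul_wPair (h : Generic p v w q t x S) (s : ℕ) {i : ι} (hi : i ∈ S) :
    wLout p w q t (s + 1) (x i) * wPair p q t (w * q ^ (s + 1)) (x i) =
      wLout p w q t s (x i) := by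
  have hq := h.q0; have ht := h.t0; have hw := h.w0; have hv := h.v0
  have hx := h.x0 i hi
  have h1 : theta p (q ^ (-(s : ℤ)) * q⁻¹ * x i / (t * w)) ≠ 0 :=
    h.single' hi 0 (-1) (-s - 1) (-1) (by simp [zpow_sub₀ hq]; field_simp)
  have h2 : theta p (q ^ (-(s : ℤ)) * q⁻¹ * x i / (q * w)) ≠ 0 :=
    h.single' hi 0 (-1) (-s - 2) 0 (by simp [zpow_sub₀ hq]; field_simp)
  unfold wLout wPair
  push_cast
  rw [neg_add, zpow_add₀ hq, zpow_neg_one,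
    theta_of_mul_eq_one h.hp (show t * (w * q ^ (s + 1)) / (q * x i) *
      (q ^ (-(s : ℤ)) * x i / (t * w)) = 1 by simp [pow_succ]; field_simp),
    theta_of_mul_eq_one h.hp (show q * (w * q ^ (s + 1)) / x i *
      (q ^ (-(s : ℤ)) * q⁻¹ * x i / (q * w)) = 1 by simp [pow_succ]; field_simp),
    theta_of_mul_eq_one h.hp (show w * q ^ (s + 1) / x i *
      (q ^ (-(s : ℤ)) * x i / (q * w)) = 1 by simp [pow_succ]; field_simp),
    theta_of_mul_eq_one h.hp (show t * (w * q ^ (s + 1)) / x i *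
      (q ^ (-(s : ℤ)) * q⁻¹ * x i / (t * w)) = 1 by simp [pow_succ]; field_simp)]
  generalize theta p (q ^ (-(s : ℤ)) * q⁻¹ * x i / (t * w)) = c1 at h1
  generalize theta p (q ^ (-(s : ℤ)) * q⁻¹ * x i / (q * w)) = c2 at h2
  field_simp

variable [DecidableEq ι]

set_option maxHeartbeats 1000000 in
-- Singular terms come only from subsets of size s omitting z and from these with z adjoined, and
-- their residues are opposite.
lemma noPole_LSumInsert_at_shift (h : Generic p v w q t x S) (s : ℕ) :
    NoPole (LSumInsert p v w q t x S) (w * q ^ (s + 1)) := by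
  have hq := h.q0; have ht := h.t0; have hw := h.w0; have hv := h.v0
  have hz : w * q ^ (s + 1) ≠ 0 := by positivity
  refine NoPole.of_theta h.hp hz ?_
  set z₀ := w * q ^ (s + 1) with hz₀
  set ρ₁ := theta p (w * q ^ s) * theta p (q / t) / theta p (z₀ / t) with hρ₁
  set ρ₂ := q / t * (theta p (v * q ^ (s + 1) / t) * theta p (t / q) / theta p (v * q ^ s)) with hρ₂
  have hzt : theta p (z₀ / t) ≠ 0 :=
    h.const' 0 1 (s + 1) (-1) (by simp [hz₀, zpow_add₀ hq, pow_succ]; field_simp) (by simp)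
  have hzv : theta p (v * z₀ / (q * w)) ≠ 0 :=
    h.const' 1 0 s 0 (by simp [hz₀, pow_succ]; field_simp) (by simp)
  have main1 := tendsto_mul_subsetSum (l := 𝓝[≠] z₀) (S := S) (fun z => theta p (z / z₀))
    (c := fun z r => coef p v w q t r * wLout p w q t r z)
    (A := fun z r i => wLin p v w q t r (x i) * wPair p q t (x i) z)
    (B := fun z r j => wLout p w q t r (x j))
    (X := fun z i j => wPair p q t (x i) (x j))
    -- For r ≠ s the relevant denominator is θ at a nonzero power of q, nonzero by genericity, so
    -- multiplication by θ(z/z₀) gives the limit 0.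
    (c' := fun r => if r = s then coef p v w q t r * ρ₁ else 0)
    (A' := fun r i => wLin p v w q t r (x i) * wPair p q t (x i) z₀)
    (B' := fun r j => wLout p w q t r (x j))
    (X' := fun i j => wPair p q t (x i) (x j))
    (fun I _ => by
      generalize I.card = r
      split_ifs with hr
      · subst hr
        refine ((tendsto_theta_mul (f := wLout p w q t r) (g := fun z => theta p (z / q) *
          theta p (q ^ (-(r : ℤ)) * z / (t * w)) / theta p (z / t)) (ρ := ρ₁) h.hp hz
          (.div (.mul (analyticAt_theta_div h.hp hq hz).continuousAt
            (analyticAt_theta_mul_div h.hp (zpow_ne_zero _ hq) (by positivity) hz).continuousAt)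
            (analyticAt_theta_div h.hp ht hz).continuousAt hzt)
          (fun z _ => ?_) ?_).const_mul (coef p v w q t r)).congr fun z => by ring
        · unfold wLout
          rw [show q ^ (-(r : ℤ)) * z / (q * w) = z / z₀ by simp [hz₀, pow_succ]; field_simp]
          ring
        · rw [show z₀ / q = w * q ^ r by rw [hz₀, pow_succ]; field_simp,
            show q ^ (-(r : ℤ)) * z₀ / (t * w) = q / t by simp [hz₀, pow_succ]; field_simp]
      · refine tendsto_theta_mul_of_continuousAt h.hp hz
          (((wLout_regular h.hp hw hq ht r hz).2 hzt ?_).const_mul _)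
        exact h.const' 0 0 (s - r) 0 (by simp [hz₀, zpow_sub₀ hq, pow_succ]; field_simp) (by
          simp only [ne_eq, not_true_eq_false, false_or, or_false]; omega))
    (fun I hI i hi => (((wPair_regular_right h.hp hq ht (h.x0 i (hI hi)) hz).2
      (h.single' (hI hi) 0 (-1) (-s - 1) 0 (by simp [hz₀, zpow_sub₀ hq, pow_succ]; field_simp))
      (h.single' (hI hi) 0 (-1) (-s - 1) 1
        (by simp [hz₀, zpow_sub₀ hq, pow_succ]; field_simp))).tendsto.mono_left
        nhdsWithin_le_nhds).const_mul _)
    (fun I _ j _ => tendsto_const_nhds) (fun I _ i _ j _ => tendsto_const_nhds)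
  have main2 := tendsto_mul_subsetSum (l := 𝓝[≠] z₀) (S := S) (fun z => theta p (z / z₀))
    (c := fun z r => coef p v w q t (r + 1) * wLin p v w q t (r + 1) z)
    (A := fun z r i => wLin p v w q t (r + 1) (x i))
    (B := fun z r j => wLout p w q t (r + 1) (x j) * wPair p q t z (x j))
    (X := fun z i j => wPair p q t (x i) (x j))
    (c' := fun r => if r = s then coef p v w q t (r + 1) * ρ₂ else 0)
    (A' := fun r i => wLin p v w q t (r + 1) (x i))
    (B' := fun r j => wLout p w q t (r + 1) (x j) * wPair p q t z₀ (x j))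
    (X' := fun i j => wPair p q t (x i) (x j))
    (fun I _ => by
      generalize I.card = r
      split_ifs with hr
      · subst hr
        refine ((tendsto_theta_mul (f := wLin p v w q t (r + 1))
          (g := fun z => q / t * (theta p (v * z / (t * w)) *
          theta p (t * q ^ (-((r + 1 : ℕ) : ℤ)) * z / (q * w)) / theta p (v * z / (q * w))))
          (ρ := ρ₂) h.hp hz
          (.mul continuousAt_const (.div (.mul
            (analyticAt_theta_mul_div h.hp hv (by positivity) hz).continuousAt
            (analyticAt_theta_mul_div h.hp (mul_ne_zero ht (zpow_ne_zero _ hq)) (by positivity)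
              hz).continuousAt)
            (analyticAt_theta_mul_div h.hp hv (by positivity) hz).continuousAt hzv))
          (fun z _ => ?_) ?_).const_mul (coef p v w q t (r + 1))).congr fun z => by ring
        · unfold wLin
          rw [show q ^ (-((r + 1 : ℕ) : ℤ)) * z / w = z / z₀ by
            rw [zpow_neg, zpow_natCast, hz₀, pow_succ]; field_simp]
          ring
        · rw [show v * z₀ / (t * w) = v * q ^ (r + 1) / t by rw [hz₀]; field_simp,
            show v * z₀ / (q * w) = v * q ^ r by rw [hz₀, pow_succ]; field_simp,
            show t * q ^ (-((r + 1 : ℕ) : ℤ)) * z₀ / (q * w) = t / q by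
              rw [zpow_neg, zpow_natCast, hz₀, pow_succ]; field_simp]
      · refine tendsto_theta_mul_of_continuousAt h.hp hz
          (((wLin_regular h.hp hv hw hq ht _ hz).2 hzv ?_).const_mul _)
        exact h.const' 0 0 (s - r) 0 (by
          rw [zpow_neg, zpow_natCast]; simp [hz₀, zpow_sub₀ hq, pow_succ]; field_simp) (by
          simp only [ne_eq, not_true_eq_false, false_or, or_false]; omega))
    (fun I _ i _ => tendsto_const_nhds)
    (fun I _ j hj => by
      have hj := (Finset.mem_sdiff.mp hj).1
      have := h.x0 j hj
      exact (((wPair_regular_left h.hp hq ht (h.x0 j hj) hz).2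
        (h.single_inv hj 0 (-1) (-s - 1) 0 (by simp [hz₀, zpow_sub₀ hq, pow_succ]; field_simp))
        (h.single_inv hj 0 (-1) (-s - 1) (-1)
          (by simp [hz₀, zpow_sub₀ hq, pow_succ]; field_simp))).tendsto.mono_left
          nhdsWithin_le_nhds).const_mul _)
    (fun I _ i _ j _ => tendsto_const_nhds)
  have total := main1.add main2
  rw [subsetSum_congr_scale (-1) (fun _ => 1)
    (c' := fun r => if r = s then coef p v w q t (r + 1) * ρ₂ else 0) (fun r => ?_)
    (A' := fun r i => wLin p v w q t (r + 1) (x i))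
    (B' := fun r j => wLout p w q t (r + 1) (x j) * wPair p q t z₀ (x j))
    (X' := fun i j => wPair p q t (x i) (x j))
    (fun r hr i hi => ?_) (fun r hr i hi => ?_) (fun _ _ _ _ _ => rfl),
    Finset.prod_const_one, mul_one, neg_one_mul, neg_add_cancel] at total
  · refine total.congr fun z => ?_
    rw [LSumInsert, mul_add]
  · split_ifs with hr
    · subst hr
      have e1 : q * w / t * q ^ r = z₀ / t := by rw [hz₀]; ring
      have e2 : q * v / t * q ^ r = v * q ^ (r + 1) / t := by ring
      have h1 : theta p (v * q ^ (r + 1) / t) ≠ 0 :=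
        h.const' 1 0 (r + 1) (-1) (by simp [zpow_add₀ hq, pow_succ]; field_simp) (by simp)
      have h2 : theta p (v * q ^ r) ≠ 0 := h.const' 1 0 r 0 (by simp) (by simp)
      -- The ratio of consecutive coefficients cancels the theta quotients of ρ₁ and ρ₂; the sign −1
      -- comes from θ(q/t) = −(q/t) θ(t/q).
      rw [coef_succ, e1, e2, hρ₁, hρ₂,
        theta_of_mul_eq_one h.hp (show q / t * (t / q) = 1 by field_simp)]
      generalize theta p (v * q ^ (r + 1) / t) = c1 at *
      generalize theta p (z₀ / t) = c2 at *
      generalize theta p (v * q ^ r) = c3 at *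
      field_simp
    · simp
  · obtain rfl : r = s := by by_contra hr'; simp [hr'] at hr
    rw [one_mul]; exact wLin_mul_wPair h r hi
  · obtain rfl : r = s := by by_contra hr'; simp [hr'] at hr
    rw [one_mul]; exact (wLout_mul_wPair h r hi).symm

end shiftedPoles

/-! ### The induction for generic parameters -/

section generic

variable {ι : Type*} [DecidableEq ι] {p v w q t : ℂ} {x : ι → ℂ} {S : Finset ι} {m : ι}

/-- The difference of the two sums as a function of one distinguished variable. -/
noncomputable def sumDiff (p v w q t : ℂ) (x : ι → ℂ) (S : Finset ι) (z : ℂ) : ℂ :=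
  LSumInsert p v w q t x S z - RSumInsert p v w q t x S z

lemma RSumInsert_dual (h : Generic p v w q t x S) {z : ℂ} (hz : z ≠ 0) :
    RSumInsert p v⁻¹ w⁻¹ q⁻¹ t⁻¹ (fun i => q⁻¹ * t⁻¹ * v * w⁻¹ * x i) S
      (q⁻¹ * t⁻¹ * v * w⁻¹ * z) = LSumInsert p v w q t x S z := by
  have hq := h.q0; have ht := h.t0; have hw := h.w0; have hv := h.v0
  rw [← LSumInsert_dual h.hp h.dual.v0 h.dual.w0 h.dual.q0 h.dual.t0 h.dual.x0 (by positivity)]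
  simp only [inv_inv]
  have e : ∀ y, q * t * v⁻¹ * w * (q⁻¹ * t⁻¹ * v * w⁻¹ * y) = y := fun y => by field_simp
  simp only [e]

/-- Duality exchanges the two sums, so the difference is antisymmetric and each pole argument also
serves the dual pole. -/
lemma sumDiff_dual (h : Generic p v w q t x S) {z : ℂ} (hz : z ≠ 0) :
    sumDiff p v w q t x S z = -sumDiff p v⁻¹ w⁻¹ q⁻¹ t⁻¹
      (fun i => q⁻¹ * t⁻¹ * v * w⁻¹ * x i) S (q⁻¹ * t⁻¹ * v * w⁻¹ * z) := by
  rw [sumDiff, sumDiff, RSumInsert_dual h hz,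
    LSumInsert_dual h.hp h.v0 h.w0 h.q0 h.t0 h.x0 hz]
  ring

lemma NoPole.sumDiff_of_dual (h : Generic p v w q t x S) {z z' : ℂ} (hz : z ≠ 0)
    (hz' : q⁻¹ * t⁻¹ * v * w⁻¹ * z = z')
    (hn : NoPole (sumDiff p v⁻¹ w⁻¹ q⁻¹ t⁻¹ (fun i => q⁻¹ * t⁻¹ * v * w⁻¹ * x i) S) z') :
    NoPole (sumDiff p v w q t x S) z := by
  subst hz'
  refine NoPole.comp_mul (f := fun z => -sumDiff p v⁻¹ w⁻¹ q⁻¹ t⁻¹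
    (fun i => q⁻¹ * t⁻¹ * v * w⁻¹ * x i) S z) (k := q⁻¹ * t⁻¹ * v * w⁻¹) ?_ hz
    (fun z hz => sumDiff_dual h hz) hn.neg
  simp [h.v0, h.w0, h.q0, h.t0]

lemma NoPole.of_theta_sub (hp : ‖p‖ < 1) {f g : ℂ → ℂ} {s ρ : ℂ} (hs : s ≠ 0)
    (hf : Tendsto (fun z => theta p (z / s) * f z) (𝓝[≠] s) (𝓝 ρ))
    (hg : Tendsto (fun z => theta p (z / s) * g z) (𝓝[≠] s) (𝓝 ρ)) :
    NoPole (fun z => f z - g z) s := by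
  refine NoPole.of_theta hp hs ?_
  have := hf.sub hg
  rw [sub_self] at this
  exact this.congr fun z => by ring

lemma noPole_sumDiff_at_t (h : Generic p v w q t x S)
    (ih : LSum p v (q * w) q t (fun i => q * x i) S = RSum p v (q * w) q t (fun i => q * x i) S) :
    NoPole (sumDiff p v w q t x S) t :=
  NoPole.of_theta_sub h.hp h.t0 (tendsto_LSumInsert_at_t h) (ih ▸ tendsto_RSumInsert_at_t h)

lemma noPole_sumDiff_at_mul (hm : m ∉ S) (h : Generic p v w q t x (insert m S))
    (ih : LSum p (q * v) (q * w) q t x S = RSum p (q * v) (q * w) q t x S) :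
    NoPole (sumDiff p v w q t x (insert m S)) (t * x m) :=
  NoPole.of_theta_sub h.hp (mul_ne_zero h.t0 (h.x0 m (Finset.mem_insert_self _ _)))
    (tendsto_LSumInsert_at_mul hm h) (ih ▸ tendsto_RSumInsert_at_mul hm h)

lemma noPole_sumDiff_at_self (hm : m ∉ S) (h : Generic p v w q t x (insert m S)) :
    NoPole (sumDiff p v w q t x (insert m S)) (x m) := by
  have hx := h.x0 m (Finset.mem_insert_self _ _)
  refine (noPole_LSumInsert_at_self hm h).sub ?_
  refine NoPole.comp_mul (k := q⁻¹ * t⁻¹ * v * w⁻¹) ?_ hx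
    (fun z hz => (LSumInsert_dual h.hp h.v0 h.w0 h.q0 h.t0 h.x0 hz).symm)
    (noPole_LSumInsert_at_self hm h.dual)
  simp [h.v0, h.w0, h.q0, h.t0]

lemma noPole_sumDiff_at_shift (h : Generic p v w q t x S) (s : ℕ) :
    NoPole (sumDiff p v w q t x S) (w * q ^ (s + 1)) := by
  have hq := h.q0; have ht := h.t0; have hw := h.w0; have hv := h.v0
  refine (noPole_LSumInsert_at_shift h s).sub (.of_continuousAt
    (continuousAt_RSumInsert h.hp hv hw hq ht h.x0 (by positivity) ?_ ?_ (fun r => ?_)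
    (fun i hi => ?_) (fun i hi => ?_) (fun i hi => ?_)))
  · exact h.const' 0 1 (s + 1) (-1) (by simp [zpow_add₀ hq, pow_succ]; field_simp) (by simp)
  · exact h.const' 1 0 s 0 (by simp [pow_succ]; field_simp) (by simp)
  · exact h.const' 1 1 (r + s + 1) (-1) (by simp [zpow_add₀ hq, pow_succ]; field_simp) (by simp)
  all_goals have hx := h.x0 i hi
  · exact h.single_inv hi 0 (-1) (-s - 1) 0 (by simp [zpow_sub₀ hq, pow_succ]; field_simp)
  · exact h.single_inv hi 0 (-1) (-s - 1) (-1) (by simp [zpow_sub₀ hq, pow_succ]; field_simp)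
  · exact h.single_inv hi 0 (-1) (-s - 1) 1 (by simp [zpow_sub₀ hq, pow_succ]; field_simp)

lemma sumDiff_mul_left (h : Generic p v w q t x S) : ∀ z ≠ 0,
    sumDiff p v w q t x S (p * z) = sumDiff p v w q t x S z := fun z hz => by
  rw [sumDiff, sumDiff, LSumInsert_mul_left h.hp h.p0 h.v0 h.w0 h.q0 h.t0 h.x0 hz,
    RSumInsert_mul_left h.hp h.p0 h.v0 h.w0 h.q0 h.t0 h.x0 hz]

/-- A vanishing denominator θ(z/s) says that z is a power of p times s, so periodicity reduces the
question to s itself. -/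
lemma NoPole.sumDiff_of_theta_eq_zero (h : Generic p v w q t x S) {s z u : ℂ} (hs : s ≠ 0)
    (hz : z ≠ 0) (hu : theta p u = 0) (hus : u = z / s) (hn : NoPole (sumDiff p v w q t x S) s) :
    NoPole (sumDiff p v w q t x S) z := by
  obtain ⟨k, hk⟩ := exists_zpow_of_theta_eq_zero h.hp h.p0 (div_ne_zero hz hs) (hus ▸ hu)
  have := hn.zpow_mul h.p0 (sumDiff_mul_left h) hs k
  rwa [← hk, div_mul_cancel₀ _ hs] at this

/-- Each candidate pole is one of the computed ones or its dual image; away from all of them both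
sums are continuous. The induction hypothesis ranges over all parameters because the residues shift
them and the duality inverts them. -/
lemma noPole_sumDiff (h : Generic p v w q t x S)
    (ih : ∀ T ⊆ S, ∀ {v w q t : ℂ} {x : ι → ℂ}, Generic p v w q t x T →
      LSum p v w q t x T = RSum p v w q t x T) {z : ℂ} (hz : z ≠ 0) :
    NoPole (sumDiff p v w q t x S) z := by
  have at_t : ∀ {v w q t : ℂ} {x : ι → ℂ}, Generic p v w q t x S →
      NoPole (sumDiff p v w q t x S) t := fun h =>
    noPole_sumDiff_at_t h (ih S subset_rfl (by simpa using h.shift 0 1 1))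
  have at_mul : ∀ {v w q t : ℂ} {x : ι → ℂ}, Generic p v w q t x S → ∀ i ∈ S,
      NoPole (sumDiff p v w q t x S) (t * x i) := fun h i hi => by
    have e := Finset.insert_erase hi
    have := noPole_sumDiff_at_mul (S := S.erase i) (Finset.notMem_erase i S) (by rwa [e])
      (ih (S.erase i) (Finset.erase_subset _ _)
        (by simpa using (h.shift 1 1 0).mono (Finset.erase_subset i S)))
    rwa [e] at this
  have at_self : ∀ i ∈ S, NoPole (sumDiff p v w q t x S) (x i) := fun i hi => by
    have e := Finset.insert_erase hi
    have := noPole_sumDiff_at_self (S := S.erase i) (Finset.notMem_erase i S) (by rwa [e])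
    rwa [e] at this
  have hq := h.q0; have ht := h.t0; have hw := h.w0; have hv := h.v0
  by_cases h1 : theta p (z / t) = 0
  · exact NoPole.sumDiff_of_theta_eq_zero h ht hz h1 rfl (at_t h)
  by_cases h2 : theta p (v * z / (q * w)) = 0
  -- The duality maps qw/v to t⁻¹, the pole at t of the dual difference.
  · refine NoPole.sumDiff_of_theta_eq_zero h (s := q * w / v) (by positivity) hz h2
      (by field_simp) (NoPole.sumDiff_of_dual h (by positivity) ?_ (at_t h.dual))
    field_simp
  by_cases h3 : ∃ r : ℕ, theta p (q ^ (-(r : ℤ)) * z / (q * w)) = 0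
  · obtain ⟨r, hr⟩ := h3
    exact NoPole.sumDiff_of_theta_eq_zero h (by positivity) hz hr
      (by simp [pow_succ]; field_simp) (noPole_sumDiff_at_shift h r)
  by_cases h4 : ∃ r : ℕ, theta p (q ^ r * v * z / t) = 0
  · obtain ⟨r, hr⟩ := h4
    -- The dual image is w⁻¹ (q⁻¹)^(r+1), a shifted pole for the dual parameters.
    refine NoPole.sumDiff_of_theta_eq_zero h (s := t / (v * q ^ r)) (by positivity) hz hr
      (by field_simp) (NoPole.sumDiff_of_dual h (by positivity) ?_
      (noPole_sumDiff_at_shift h.dual r))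
    simp [pow_succ]; field_simp
  by_cases h5 : ∃ i ∈ S, theta p (z / x i) = 0
  · obtain ⟨i, hi, h5⟩ := h5
    exact NoPole.sumDiff_of_theta_eq_zero h (h.x0 i hi) hz h5 rfl (at_self i hi)
  by_cases h6 : ∃ i ∈ S, theta p (t * z / x i) = 0
  · obtain ⟨i, hi, h6⟩ := h6
    have hx := h.x0 i hi
    refine NoPole.sumDiff_of_theta_eq_zero h (s := x i / t) (by positivity) hz h6
      (by field_simp) (NoPole.sumDiff_of_dual h (by positivity) ?_ (at_mul h.dual i hi))
    field_simp
  by_cases h7 : ∃ i ∈ S, theta p (z / (t * x i)) = 0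
  · obtain ⟨i, hi, h7⟩ := h7
    exact NoPole.sumDiff_of_theta_eq_zero h (mul_ne_zero ht (h.x0 i hi)) hz h7 rfl (at_mul h i hi)
  push Not at h3 h4 h5 h6 h7
  exact .of_continuousAt ((continuousAt_LSumInsert h.hp hv hw hq ht h.x0 hz h1 h2 h3 h5 h6 h7).sub
    (continuousAt_RSumInsert h.hp hv hw hq ht h.x0 hz h1 h2 h4 h5 h6 h7))

lemma continuousAt_sumDiff_q (h : Generic p v w q t x S) :
    ContinuousAt (sumDiff p v w q t x S) q := by
  have hq := h.q0; have ht := h.t0; have hw := h.w0; have hv := h.v0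
  have h1 : theta p (q / t) ≠ 0 := h.const' 0 0 1 (-1) (by simp; field_simp) (by simp)
  have h2 : theta p (v * q / (q * w)) ≠ 0 :=
    h.const' 1 (-1) 0 0 (by simp; field_simp) (by simp)
  have h3 : ∀ r : ℕ, theta p (q ^ (-(r : ℤ)) * q / (q * w)) ≠ 0 := fun r =>
    h.const' 0 (-1) (-r) 0 (by simp; field_simp) (by simp)
  have h4 : ∀ r : ℕ, theta p (q ^ r * v * q / t) ≠ 0 := fun r =>
    h.const' 1 0 (r + 1) (-1) (by simp [zpow_add₀ hq]; field_simp) (by simp)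
  have h5 : ∀ i ∈ S, theta p (q / x i) ≠ 0 := fun i hi => by
    have hx := h.x0 i hi
    exact h.single_inv hi 0 0 (-1) 0 (by simp; field_simp)
  have h6 : ∀ i ∈ S, theta p (t * q / x i) ≠ 0 := fun i hi => by
    have hx := h.x0 i hi
    exact h.single_inv hi 0 0 (-1) (-1) (by simp; field_simp)
  have h7 : ∀ i ∈ S, theta p (q / (t * x i)) ≠ 0 := fun i hi => by
    have hx := h.x0 i hi
    exact h.single_inv hi 0 0 (-1) 1 (by simp; field_simp)
  exact (continuousAt_LSumInsert h.hp hv hw hq ht h.x0 hq h1 h2 h3 h5 h6 h7).sub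
    (continuousAt_RSumInsert h.hp hv hw hq ht h.x0 hq h1 h2 h4 h5 h6 h7)

/-- Needed so that the constant found for the continued difference is its actual value at x_m. -/
lemma continuousAt_sumDiff_var (hm : m ∉ S) (h : Generic p v w q t x (insert m S)) :
    ContinuousAt (sumDiff p v w q t x S) (x m) := by
  have hq := h.q0; have ht := h.t0; have hw := h.w0; have hv := h.v0
  have mS : m ∈ insert m S := Finset.mem_insert_self _ _
  have sub : ∀ i ∈ S, i ∈ insert m S := fun i => Finset.mem_insert_of_mem
  have hne : ∀ i ∈ S, m ≠ i := fun i hi e => hm (e ▸ hi)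
  have hx : ∀ i ∈ S, x i ≠ 0 := fun i hi => h.x0 i (sub i hi)
  have h1 : theta p (x m / t) ≠ 0 := h.single' mS 0 0 0 (-1) (by simp; field_simp)
  have h2 : theta p (v * x m / (q * w)) ≠ 0 := h.single' mS 1 (-1) (-1) 0 (by simp; field_simp)
  have h3 : ∀ r : ℕ, theta p (q ^ (-(r : ℤ)) * x m / (q * w)) ≠ 0 := fun r =>
    h.single' mS 0 (-1) (-r - 1) 0 (by simp [zpow_sub₀ hq]; field_simp)
  have h4 : ∀ r : ℕ, theta p (q ^ r * v * x m / t) ≠ 0 := fun r =>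
    h.single' mS 1 0 r (-1) (by simp; field_simp)
  have h5 : ∀ i ∈ S, theta p (x m / x i) ≠ 0 := fun i hi =>
    h.pair' mS (sub i hi) (hne i hi) 0 0 0 0 (by simp)
  have h6 : ∀ i ∈ S, theta p (t * x m / x i) ≠ 0 := fun i hi =>
    h.pair' mS (sub i hi) (hne i hi) 0 0 0 1 (by simp)
  have h7 : ∀ i ∈ S, theta p (x m / (t * x i)) ≠ 0 := fun i hi => by
    have := hx i hi
    exact h.pair' mS (sub i hi) (hne i hi) 0 0 0 (-1) (by simp; field_simp)
  exact (continuousAt_LSumInsert h.hp hv hw hq ht hx (h.x0 m mS) h1 h2 h3 h5 h6 h7).sub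
    (continuousAt_RSumInsert h.hp hv hw hq ht hx (h.x0 m mS) h1 h2 h4 h5 h6 h7)

/-- The identity for parameters in general position. -/
theorem LSum_eq_RSum_of_generic (S : Finset ι) : ∀ {v w q t : ℂ} {x : ι → ℂ},
    Generic p v w q t x S → LSum p v w q t x S = RSum p v w q t x S := by
  induction S using Finset.strongInduction with
  | H S IH =>
  intro v w q t x h
  rcases S.eq_empty_or_nonempty with rfl | ⟨a, ha⟩
  · simp [LSum, RSum, subsetSum]
  set T := S.erase a with hT
  have haT : a ∉ T := Finset.notMem_erase a S
  have e : insert a T = S := Finset.insert_erase ha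
  have hTS : T ⊂ S := Finset.erase_ssubset ha
  have ih : ∀ T' ⊆ T, ∀ {v w q t : ℂ} {x : ι → ℂ}, Generic p v w q t x T' →
      LSum p v w q t x T' = RSum p v w q t x T' := fun T' hT' => IH T' (hT'.trans_ssubset hTS)
  have hg : Generic p v w q t x T := h.mono hTS.subset
  -- The difference for the other variables is constant in z; its value at z = x_a is compared with
  -- that at z = q.
  have key := eq_of_mul_periodic h.hp h.p0 (f := sumDiff p v w q t x T)
    (fun z hz => (meromorphicAt_LSumInsert h.hp h.v0 h.w0 h.q0 h.t0 hg.x0 hz).sub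
      (meromorphicAt_RSumInsert h.hp h.v0 h.w0 h.q0 h.t0 hg.x0 hz))
    (sumDiff_mul_left hg) (fun z hz => noPole_sumDiff hg ih hz) (h.x0 a ha) h.q0
    (continuousAt_sumDiff_var haT (by rwa [e])) (continuousAt_sumDiff_q hg)
  have hq0 : sumDiff p v w q t x T q = 0 := by
    rw [sumDiff, LSumInsert_at_q hg, RSumInsert_at_q hg,
      ih T subset_rfl (by simpa using hg.shift 1 0 (-1)), sub_self]
  rw [hq0, sumDiff, sub_eq_zero] at key
  rw [← e, LSum_insert p v w q t x haT, RSum_insert p v w q t x haT, key]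

end generic

/-! ### Joint continuity of both sums at well-defined points -/

section continuity

variable {α : Type*} [TopologicalSpace α] {a : α} {pf vf wf qf tf yf zf : α → ℂ}

lemma continuousAt_theta_comp (hp : ‖pf a‖ < 1) (hpf : ContinuousAt pf a)
    (hzf : ContinuousAt zf a) (hz : zf a ≠ 0) : ContinuousAt (fun s => theta (pf s) (zf s)) a :=
  ContinuousAt.comp (f := fun s => (pf s, zf s)) (x := a)
    (g := fun y : ℂ × ℂ => theta y.1 y.2) (continuousAt_theta hp hz) (hpf.prodMk hzf)

lemma continuousAt_thetaPoch (hp : ‖pf a‖ < 1) (hpf : ContinuousAt pf a)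
    (hqf : ContinuousAt qf a) (hzf : ContinuousAt zf a) (hq : qf a ≠ 0) (hz : zf a ≠ 0) (m : ℕ) :
    ContinuousAt (fun s => thetaPoch (qf s) (pf s) (zf s) m) a := by
  unfold thetaPoch
  exact tendsto_finsetProd _ fun k _ =>
    continuousAt_theta_comp hp hpf (hzf.mul (hqf.pow k)) (mul_ne_zero hz (pow_ne_zero k hq))

lemma continuousAt_coef (hp : ‖pf a‖ < 1) (hpf : ContinuousAt pf a) (hvf : ContinuousAt vf a)
    (hwf : ContinuousAt wf a) (hqf : ContinuousAt qf a) (htf : ContinuousAt tf a)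
    (hv : vf a ≠ 0) (hw : wf a ≠ 0) (hq : qf a ≠ 0) (ht : tf a ≠ 0) (r : ℕ)
    (h1 : thetaPoch (qf a) (pf a) (qf a * vf a / tf a) r ≠ 0)
    (h2 : thetaPoch (qf a) (pf a) (qf a * wf a / tf a) r ≠ 0) :
    ContinuousAt (fun s => coef (pf s) (vf s) (wf s) (qf s) (tf s) r) a := by
  unfold coef
  exact ((continuousAt_thetaPoch hp hpf hqf hvf hq hv r).mul
    (continuousAt_thetaPoch hp hpf hqf hwf hq hw r)).div
    ((continuousAt_thetaPoch hp hpf hqf ((hqf.mul hvf).div htf ht) hq (by simp [*]) r).mul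
    (continuousAt_thetaPoch hp hpf hqf ((hqf.mul hwf).div htf ht) hq (by simp [*]) r))
    (mul_ne_zero h1 h2)

lemma continuousAt_wLin (hp : ‖pf a‖ < 1) (hpf : ContinuousAt pf a) (hvf : ContinuousAt vf a)
    (hwf : ContinuousAt wf a) (hqf : ContinuousAt qf a) (htf : ContinuousAt tf a)
    (hzf : ContinuousAt zf a) (hv : vf a ≠ 0) (hw : wf a ≠ 0) (hq : qf a ≠ 0) (ht : tf a ≠ 0)
    (hz : zf a ≠ 0) (r : ℕ)
    (h1 : theta (pf a) (vf a * zf a / (qf a * wf a)) ≠ 0)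
    (h2 : theta (pf a) (qf a ^ (-(r : ℤ)) * zf a / wf a) ≠ 0) :
    ContinuousAt (fun s => wLin (pf s) (vf s) (wf s) (qf s) (tf s) r (zf s)) a := by
  have hqr : ContinuousAt (fun s => qf s ^ (-(r : ℤ))) a := hqf.zpow₀ _ (Or.inl hq)
  have hq' : qf a ^ (-(r : ℤ)) ≠ 0 := zpow_ne_zero _ hq
  unfold wLin
  refine ((hqf.mul (continuousAt_theta_comp hp hpf ?_ ?_)).mul
    (continuousAt_theta_comp hp hpf ?_ ?_)).div ((htf.mul (continuousAt_theta_comp hp hpf ?_ ?_)).mul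
    (continuousAt_theta_comp hp hpf ?_ ?_)) (mul_ne_zero (mul_ne_zero ht h1) h2)
  · exact (hvf.mul hzf).div (htf.mul hwf) (mul_ne_zero ht hw)
  · simp [*]
  · exact ((htf.mul hqr).mul hzf).div (hqf.mul hwf) (mul_ne_zero hq hw)
  · simp [*, -zpow_neg, -zpow_natCast]
  · exact (hvf.mul hzf).div (hqf.mul hwf) (mul_ne_zero hq hw)
  · simp [*]
  · exact (hqr.mul hzf).div hwf hw
  · simp [*, -zpow_neg, -zpow_natCast]

lemma continuousAt_wLout (hp : ‖pf a‖ < 1) (hpf : ContinuousAt pf a)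
    (hwf : ContinuousAt wf a) (hqf : ContinuousAt qf a) (htf : ContinuousAt tf a)
    (hzf : ContinuousAt zf a) (hw : wf a ≠ 0) (hq : qf a ≠ 0) (ht : tf a ≠ 0)
    (hz : zf a ≠ 0) (r : ℕ) (h1 : theta (pf a) (zf a / tf a) ≠ 0)
    (h2 : theta (pf a) (qf a ^ (-(r : ℤ)) * zf a / (qf a * wf a)) ≠ 0) :
    ContinuousAt (fun s => wLout (pf s) (wf s) (qf s) (tf s) r (zf s)) a := by
  have hqr : ContinuousAt (fun s => qf s ^ (-(r : ℤ))) a := hqf.zpow₀ _ (Or.inl hq)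
  have hq' : qf a ^ (-(r : ℤ)) ≠ 0 := zpow_ne_zero _ hq
  unfold wLout
  refine ((continuousAt_theta_comp hp hpf ?_ ?_).mul
    (continuousAt_theta_comp hp hpf ?_ ?_)).div ((continuousAt_theta_comp hp hpf ?_ ?_).mul
    (continuousAt_theta_comp hp hpf ?_ ?_)) (mul_ne_zero h1 h2)
  · exact hzf.div hqf hq
  · simp [*]
  · exact (hqr.mul hzf).div (htf.mul hwf) (mul_ne_zero ht hw)
  · simp [*, -zpow_neg, -zpow_natCast]
  · exact hzf.div htf ht
  · simp [*]
  · exact (hqr.mul hzf).div (hqf.mul hwf) (mul_ne_zero hq hw)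
  · simp [*, -zpow_neg, -zpow_natCast]

lemma continuousAt_wRin (hp : ‖pf a‖ < 1) (hpf : ContinuousAt pf a) (hvf : ContinuousAt vf a)
    (hqf : ContinuousAt qf a) (htf : ContinuousAt tf a)
    (hzf : ContinuousAt zf a) (hv : vf a ≠ 0) (hq : qf a ≠ 0) (ht : tf a ≠ 0)
    (hz : zf a ≠ 0) (r : ℕ) (h1 : theta (pf a) (zf a / tf a) ≠ 0)
    (h2 : theta (pf a) (qf a ^ r * vf a * zf a / (tf a * qf a)) ≠ 0) :
    ContinuousAt (fun s => wRin (pf s) (vf s) (qf s) (tf s) r (zf s)) a := by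
  unfold wRin
  refine ((hqf.mul (continuousAt_theta_comp hp hpf ?_ ?_)).mul
    (continuousAt_theta_comp hp hpf ?_ ?_)).div ((htf.mul (continuousAt_theta_comp hp hpf ?_ ?_)).mul
    (continuousAt_theta_comp hp hpf ?_ ?_)) (mul_ne_zero (mul_ne_zero ht h1) h2)
  · exact hzf.div hqf hq
  · simp [*]
  · exact (((hqf.pow r).mul hvf).mul hzf).div (htf.pow 2) (pow_ne_zero 2 ht)
  · simp [*]
  · exact hzf.div htf ht
  · simp [*]
  · exact (((hqf.pow r).mul hvf).mul hzf).div (htf.mul hqf) (mul_ne_zero ht hq)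
  · simp [*]

lemma continuousAt_wRout (hp : ‖pf a‖ < 1) (hpf : ContinuousAt pf a) (hvf : ContinuousAt vf a)
    (hwf : ContinuousAt wf a) (hqf : ContinuousAt qf a) (htf : ContinuousAt tf a)
    (hzf : ContinuousAt zf a) (hv : vf a ≠ 0) (hw : wf a ≠ 0) (hq : qf a ≠ 0) (ht : tf a ≠ 0)
    (hz : zf a ≠ 0) (r : ℕ) (h1 : theta (pf a) (vf a * zf a / (qf a * wf a)) ≠ 0)
    (h2 : theta (pf a) (qf a ^ r * vf a * zf a / tf a) ≠ 0) :
    ContinuousAt (fun s => wRout (pf s) (vf s) (wf s) (qf s) (tf s) r (zf s)) a := by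
  unfold wRout
  refine ((continuousAt_theta_comp hp hpf ?_ ?_).mul
    (continuousAt_theta_comp hp hpf ?_ ?_)).div ((continuousAt_theta_comp hp hpf ?_ ?_).mul
    (continuousAt_theta_comp hp hpf ?_ ?_)) (mul_ne_zero h1 h2)
  · exact (hvf.mul hzf).div (htf.mul hwf) (mul_ne_zero ht hw)
  · simp [*]
  · exact (((hqf.pow r).mul hvf).mul hzf).div hqf hq
  · simp [*]
  · exact (hvf.mul hzf).div (hqf.mul hwf) (mul_ne_zero hq hw)
  · simp [*]
  · exact (((hqf.pow r).mul hvf).mul hzf).div htf ht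
  · simp [*]

lemma continuousAt_wPair (hp : ‖pf a‖ < 1) (hpf : ContinuousAt pf a)
    (hqf : ContinuousAt qf a) (htf : ContinuousAt tf a) (hyf : ContinuousAt yf a)
    (hzf : ContinuousAt zf a) (hq : qf a ≠ 0) (ht : tf a ≠ 0) (hy : yf a ≠ 0) (hz : zf a ≠ 0)
    (h1 : theta (pf a) (yf a / zf a) ≠ 0) (h2 : theta (pf a) (tf a * yf a / zf a) ≠ 0) :
    ContinuousAt (fun s => wPair (pf s) (qf s) (tf s) (yf s) (zf s)) a := by
  unfold wPair
  refine ((continuousAt_theta_comp hp hpf ?_ ?_).mul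
    (continuousAt_theta_comp hp hpf ?_ ?_)).div ((continuousAt_theta_comp hp hpf ?_ ?_).mul
    (continuousAt_theta_comp hp hpf ?_ ?_)) (mul_ne_zero h1 h2)
  · exact (htf.mul hyf).div (hqf.mul hzf) (mul_ne_zero hq hz)
  · simp [*]
  · exact (hqf.mul hyf).div hzf hz
  · simp [*]
  · exact hyf.div hzf hz
  · simp [*]
  · exact (htf.mul hyf).div hzf hz
  · simp [*]

variable {n : ℕ} {xf : α → Fin n → ℂ}

lemma continuousAt_LSum (hp : ‖pf a‖ < 1) (hpf : ContinuousAt pf a) (hvf : ContinuousAt vf a)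
    (hwf : ContinuousAt wf a) (hqf : ContinuousAt qf a) (htf : ContinuousAt tf a)
    (hxf : ∀ i, ContinuousAt (fun s => xf s i) a)
    (hv : vf a ≠ 0) (hw : wf a ≠ 0) (hq : qf a ≠ 0) (ht : tf a ≠ 0) (hx : ∀ i, xf a i ≠ 0)
    (h : LWellDefined (xf a) (vf a) (wf a) (qf a) (tf a) (pf a)) :
    ContinuousAt (fun s => LSum (pf s) (vf s) (wf s) (qf s) (tf s) (xf s) Finset.univ) a := by
  unfold LSum
  refine tendsto_subsetSum ?_ ?_ ?_ ?_
  · intro I _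
    obtain ⟨h1, h2, -⟩ := h I.card I rfl
    exact continuousAt_coef hp hpf hvf hwf hqf htf hv hw hq ht _ h1 h2
  · intro I _ i hi
    obtain ⟨-, -, h3, -⟩ := h I.card I rfl
    exact continuousAt_wLin hp hpf hvf hwf hqf htf (hxf i) hv hw hq ht (hx i) _
      (h3 i hi).1 (h3 i hi).2
  · intro I _ j hj
    obtain ⟨-, -, -, h4, -⟩ := h I.card I rfl
    have hj' := (Finset.mem_sdiff.1 hj).2
    exact continuousAt_wLout hp hpf hwf hqf htf (hxf j) hw hq ht (hx j) _
      (h4 j hj').1 (h4 j hj').2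
  · intro I _ i hi j hj
    obtain ⟨-, -, -, -, h5⟩ := h I.card I rfl
    have hj' := (Finset.mem_sdiff.1 hj).2
    exact continuousAt_wPair hp hpf hqf htf (hxf i) (hxf j) hq ht (hx i) (hx j)
      (h5 i hi j hj').1 (h5 i hi j hj').2

lemma continuousAt_RSum (hp : ‖pf a‖ < 1) (hpf : ContinuousAt pf a) (hvf : ContinuousAt vf a)
    (hwf : ContinuousAt wf a) (hqf : ContinuousAt qf a) (htf : ContinuousAt tf a)
    (hxf : ∀ i, ContinuousAt (fun s => xf s i) a)
    (hv : vf a ≠ 0) (hw : wf a ≠ 0) (hq : qf a ≠ 0) (ht : tf a ≠ 0) (hx : ∀ i, xf a i ≠ 0)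
    (h : RWellDefined (xf a) (vf a) (wf a) (qf a) (tf a) (pf a)) :
    ContinuousAt (fun s => RSum (pf s) (vf s) (wf s) (qf s) (tf s) (xf s) Finset.univ) a := by
  unfold RSum
  refine tendsto_subsetSum ?_ ?_ ?_ ?_
  · intro I _
    obtain ⟨h1, h2, -⟩ := h I.card I rfl
    exact continuousAt_coef hp hpf hvf hwf hqf htf hv hw hq ht _ h1 h2
  · intro I _ i hi
    obtain ⟨-, -, h3, -⟩ := h I.card I rfl
    exact continuousAt_wRin hp hpf hvf hqf htf (hxf i) hv hq ht (hx i) _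
      (h3 i hi).1 (h3 i hi).2
  · intro I _ j hj
    obtain ⟨-, -, -, h4, -⟩ := h I.card I rfl
    have hj' := (Finset.mem_sdiff.1 hj).2
    exact continuousAt_wRout hp hpf hvf hwf hqf htf (hxf j) hv hw hq ht (hx j) _
      (h4 j hj').1 (h4 j hj').2
  · intro I _ i hi j hj
    obtain ⟨-, -, -, -, h5⟩ := h I.card I rfl
    have hj' := (Finset.mem_sdiff.1 hj).2
    exact continuousAt_wPair hp hpf hqf htf (hxf j) (hxf i) hq ht (hx j) (hx i)
      (h5 i hi j hj').1 (h5 i hi j hj').2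

end continuity

/-! ### Density of generic parameters -/

section density

/-- For c ≠ 0 the polynomial must take a value in log c + 2πiℤ, and a nonconstant polynomial takes
each value finitely often; c = 0 is impossible. -/
lemma countable_setOf_exp_eval_eq {P : Polynomial ℂ} {m : ℕ} (hm : m ≠ 0) (hP : P.coeff m ≠ 0)
    (c : ℂ) : {s : ℂ | Complex.exp (P.eval s) = c}.Countable := by
  have hfin (y : ℂ) : {s : ℂ | P.eval s = y}.Finite := by
    have h0 : P - Polynomial.C y ≠ 0 := fun h => hP (by
      have := congrArg (fun Q : Polynomial ℂ => Q.coeff m) h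
      simpa [Polynomial.coeff_C, hm] using this)
    refine (Polynomial.finite_setOfPred_isRoot h0).subset fun s hs => ?_
    simpa [Polynomial.IsRoot, sub_eq_zero] using hs
  by_cases hc : c = 0
  · simp [hc, Complex.exp_ne_zero]
  · refine (Set.countable_iUnion fun k : ℤ =>
      (hfin (Complex.log c + k * (2 * Real.pi * Complex.I))).countable).mono fun s hs => ?_
    rw [Set.mem_ofPred_eq, ← Complex.exp_log hc, Complex.exp_eq_exp_iff_exists_int] at hs
    simpa using hs

variable {n : ℕ} {p : ℂ}

lemma countable_setOf_theta_exp_eq_zero (hp : ‖p‖ < 1) (p0 : p ≠ 0) {P : Polynomial ℂ} {m : ℕ}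
    (hm : m ≠ 0) (hP : P.coeff m ≠ 0) {c : ℂ} (hc : c ≠ 0) :
    {s : ℂ | theta p (c * Complex.exp (P.eval s)) = 0}.Countable := by
  refine (Set.countable_iUnion fun k : ℤ =>
    countable_setOf_exp_eval_eq hm hP (c⁻¹ * p ^ k)).mono fun s hs => ?_
  obtain ⟨k, hk⟩ := exists_zpow_of_theta_eq_zero hp p0 (mul_ne_zero hc (Complex.exp_ne_zero _)) hs
  rw [Set.mem_iUnion]
  exact ⟨k, by rw [Set.mem_ofPred_eq, ← hk, inv_mul_cancel_left₀ hc]⟩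

/-- Multiplying the parameters by the exponentials of distinct powers of `s` gives generic
parameters outside a countable set. -/
lemma countable_setOf_not_generic {v w q t : ℂ} {x : Fin n → ℂ} (hp : ‖p‖ < 1) (p0 : p ≠ 0)
    (hv : v ≠ 0) (hw : w ≠ 0) (hq : q ≠ 0) (ht : t ≠ 0) (hx : ∀ i, x i ≠ 0) :
    {s : ℂ | ¬ Generic p (v * Complex.exp s) (w * Complex.exp (s ^ 2)) (q * Complex.exp (s ^ 3))
      (t * Complex.exp (s ^ 4)) (fun i => x i * Complex.exp (s ^ (5 + (i : ℕ))))
      Finset.univ}.Countable := by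
  -- M is the exponent picked up by the monomial v^a w^b q^c t^d along the curve. Distinct powers of
  -- s prevent cancellation, so each genericity condition involves a nonconstant polynomial.
  let M (a b c d : ℤ) : Polynomial ℂ := Polynomial.C (a : ℂ) * Polynomial.X ^ 1 +
    Polynomial.C (b : ℂ) * Polynomial.X ^ 2 + Polynomial.C (c : ℂ) * Polynomial.X ^ 3 +
    Polynomial.C (d : ℂ) * Polynomial.X ^ 4
  have hM (a b c d : ℤ) (s : ℂ) : Complex.exp ((M a b c d).eval s) = Complex.exp s ^ a *
      Complex.exp (s ^ 2) ^ b * Complex.exp (s ^ 3) ^ c * Complex.exp (s ^ 4) ^ d := by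
    simp [M, Complex.exp_add, Complex.exp_int_mul]
  have h0 (a b c d : ℤ) : v ^ a * w ^ b * q ^ c * t ^ d ≠ 0 := by
    simp only [ne_eq, mul_eq_zero, not_or]
    exact ⟨⟨⟨zpow_ne_zero _ hv, zpow_ne_zero _ hw⟩, zpow_ne_zero _ hq⟩, zpow_ne_zero _ ht⟩
  have hM5 (a b c d : ℤ) (i : ℕ) : (M a b c d).coeff (5 + i) = 0 := by
    simp only [M, Polynomial.coeff_add, Polynomial.coeff_C_mul_X_pow]
    rw [if_neg (by omega), if_neg (by omega), if_neg (by omega), if_neg (by omega)]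
    simp
  have B1 (a b c d : ℤ) (h : a ≠ 0 ∨ b ≠ 0 ∨ c ≠ 0 ∨ d ≠ 0) : {s : ℂ | theta p
      (v ^ a * w ^ b * q ^ c * t ^ d * Complex.exp ((M a b c d).eval s)) = 0}.Countable := by
    rcases h with h | h | h | h
    · exact countable_setOf_theta_exp_eq_zero hp p0 (m := 1) (by norm_num)
        (by simpa only [M, Polynomial.coeff_add, Polynomial.coeff_C_mul_X_pow, Nat.reduceEqDiff,
          if_true, if_false, add_zero, zero_add, ne_eq, Int.cast_eq_zero] using h) (h0 a b c d)
    · exact countable_setOf_theta_exp_eq_zero hp p0 (m := 2) (by norm_num)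
        (by simpa only [M, Polynomial.coeff_add, Polynomial.coeff_C_mul_X_pow, Nat.reduceEqDiff,
          if_true, if_false, add_zero, zero_add, ne_eq, Int.cast_eq_zero] using h) (h0 a b c d)
    · exact countable_setOf_theta_exp_eq_zero hp p0 (m := 3) (by norm_num)
        (by simpa only [M, Polynomial.coeff_add, Polynomial.coeff_C_mul_X_pow, Nat.reduceEqDiff,
          if_true, if_false, add_zero, zero_add, ne_eq, Int.cast_eq_zero] using h) (h0 a b c d)
    · exact countable_setOf_theta_exp_eq_zero hp p0 (m := 4) (by norm_num)
        (by simpa only [M, Polynomial.coeff_add, Polynomial.coeff_C_mul_X_pow, Nat.reduceEqDiff,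
          if_true, if_false, add_zero, zero_add, ne_eq, Int.cast_eq_zero] using h) (h0 a b c d)
  have B2 (i : Fin n) (a b c d : ℤ) : {s : ℂ | theta p (v ^ a * w ^ b * q ^ c * t ^ d * x i *
      Complex.exp ((M a b c d + Polynomial.X ^ (5 + (i : ℕ))).eval s)) = 0}.Countable :=
    countable_setOf_theta_exp_eq_zero hp p0 (m := 5 + (i : ℕ)) (by omega)
      (by simp [hM5]) (mul_ne_zero (h0 a b c d) (hx i))
  have B3 (i j : Fin n) (hij : i ≠ j) (a b c d : ℤ) :
      {s : ℂ | theta p (v ^ a * w ^ b * q ^ c * t ^ d * x i / x j *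
      Complex.exp ((M a b c d + Polynomial.X ^ (5 + (i : ℕ)) -
        Polynomial.X ^ (5 + (j : ℕ))).eval s)) = 0}.Countable :=
    countable_setOf_theta_exp_eq_zero hp p0 (m := 5 + (i : ℕ)) (by omega)
      (by
        have : (i : ℕ) ≠ j := fun h => hij (Fin.ext h)
        simp [hM5, Polynomial.coeff_X_pow, this])
      (div_ne_zero (mul_ne_zero (h0 a b c d) (hx i)) (hx j))
  -- There are only countably many exponent tuples, hence countably many conditions.
  have C1 := Set.countable_iUnion fun e : {e : ℤ × ℤ × ℤ × ℤ //
    e.1 ≠ 0 ∨ e.2.1 ≠ 0 ∨ e.2.2.1 ≠ 0 ∨ e.2.2.2 ≠ 0} => B1 _ _ _ _ e.2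
  have C2 := Set.countable_iUnion fun e : Fin n × ℤ × ℤ × ℤ × ℤ =>
    B2 e.1 e.2.1 e.2.2.1 e.2.2.2.1 e.2.2.2.2
  have C3 := Set.countable_iUnion fun e : {e : Fin n × Fin n // e.1 ≠ e.2} × ℤ × ℤ × ℤ × ℤ =>
    B3 e.1.1.1 e.1.1.2 e.1.2 e.2.1 e.2.2.1 e.2.2.2.1 e.2.2.2.2
  refine ((C1.union C2).union C3).mono fun s hs => ?_
  by_contra hc
  simp only [Set.mem_union, Set.mem_iUnion, not_or, not_exists, Set.mem_ofPred_eq] at hc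
  obtain ⟨⟨hc1, hc2⟩, hc3⟩ := hc
  refine hs ⟨hp, p0, mul_ne_zero hv (Complex.exp_ne_zero _), mul_ne_zero hw (Complex.exp_ne_zero _),
    mul_ne_zero hq (Complex.exp_ne_zero _), mul_ne_zero ht (Complex.exp_ne_zero _),
    fun i _ => mul_ne_zero (hx i) (Complex.exp_ne_zero _), ?_, ?_, ?_⟩
  · intro a b c d h
    have := hc1 ⟨(a, b, c, d), h⟩
    rw [hM] at this
    convert this using 2
    simp only [mul_zpow]
    ring
  · intro i _ a b c d
    have := hc2 (i, a, b, c, d)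
    rw [Polynomial.eval_add, Complex.exp_add, hM, Polynomial.eval_pow, Polynomial.eval_X] at this
    convert this using 2
    simp only [mul_zpow]
    ring
  · intro i _ j _ hij a b c d
    have := hc3 (⟨(i, j), hij⟩, a, b, c, d)
    rw [Polynomial.eval_sub, Polynomial.eval_add, Complex.exp_sub, Complex.exp_add, hM,
      Polynomial.eval_pow, Polynomial.eval_X, Polynomial.eval_pow, Polynomial.eval_X] at this
    convert this using 2
    simp only [mul_zpow]
    ring

lemma mem_closure_setOf_generic {v w q t : ℂ} {x : Fin n → ℂ} (hp : ‖p‖ < 1)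
    (hv : v ≠ 0) (hw : w ≠ 0) (hq : q ≠ 0) (ht : t ≠ 0) (hx : ∀ i, x i ≠ 0) :
    (p, v, w, q, t, x) ∈ closure {y : ℂ × ℂ × ℂ × ℂ × ℂ × (Fin n → ℂ) |
      Generic y.1 y.2.1 y.2.2.1 y.2.2.2.1 y.2.2.2.2.1 y.2.2.2.2.2 Finset.univ} := by
  set G := {y : ℂ × ℂ × ℂ × ℂ × ℂ × (Fin n → ℂ) |
      Generic y.1 y.2.1 y.2.2.1 y.2.2.2.1 y.2.2.2.2.1 y.2.2.2.2.2 Finset.univ}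
  have key {p' : ℂ} (hp' : ‖p'‖ < 1) (p0 : p' ≠ 0) : (p', v, w, q, t, x) ∈ closure G := by
    let f : ℂ → ℂ × ℂ × ℂ × ℂ × ℂ × (Fin n → ℂ) := fun s => (p', v * Complex.exp s,
      w * Complex.exp (s ^ 2), q * Complex.exp (s ^ 3), t * Complex.exp (s ^ 4),
      fun i => x i * Complex.exp (s ^ (5 + (i : ℕ))))
    have hf : Continuous f := by fun_prop
    have hd := (countable_setOf_not_generic hp' p0 hv hw hq ht hx).dense_compl ℂ
    have h0 : f 0 = (p', v, w, q, t, x) := by simp [f]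
    rw [← h0]
    -- The complement of a countable set is dense in ℂ, so s = 0, where the curve passes through the
    -- given parameters, is a limit of generic values.
    exact map_mem_closure hf (hd 0) fun s hs => not_not.1 hs
  rcases ne_or_eq p 0 with h | rfl
  · exact key hp h
  -- The nome 0 is never generic, so it is approached through nonzero nomes, each already in the
  -- closure.
  · rw [← closure_closure]
    have hg : Continuous fun s : ℂ => (s, v, w, q, t, x) := by fun_prop
    have hd : (0 : ℂ) ∈ closure (Metric.ball (0 : ℂ) 1 ∩ {0}ᶜ) :=
      (dense_compl_singleton (0 : ℂ)).open_subset_closure_inter Metric.isOpen_ball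
        (Metric.mem_ball_self one_pos)
    exact map_mem_closure (f := fun s : ℂ => (s, v, w, q, t, x)) hg hd fun s hs => key (mem_ball_zero_iff.1 hs.1) hs.2

end density

/-- Both sums are continuous at the given point and agree on the generic set, whose closure contains
it, so uniqueness of limits gives equality. -/
theorem LSum_eq_RSum_of_wellDefined {n : ℕ} {p v w q t : ℂ} {x : Fin n → ℂ} (hp : ‖p‖ < 1)
    (hv : v ≠ 0) (hw : w ≠ 0) (hq : q ≠ 0) (ht : t ≠ 0) (hx : ∀ i, x i ≠ 0)
    (hL : LWellDefined x v w q t p) (hR : RWellDefined x v w q t p) :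
    LSum p v w q t x Finset.univ = RSum p v w q t x Finset.univ := by
  let pt : ℂ × ℂ × ℂ × ℂ × ℂ × (Fin n → ℂ) := (p, v, w, q, t, x)
  let G := {y : ℂ × ℂ × ℂ × ℂ × ℂ × (Fin n → ℂ) |
    Generic y.1 y.2.1 y.2.2.1 y.2.2.2.1 y.2.2.2.2.1 y.2.2.2.2.2 Finset.univ}
  have hG : (𝓝[G] pt).NeBot :=
    mem_closure_iff_nhdsWithin_neBot.1 (mem_closure_setOf_generic hp hv hw hq ht hx)
  have cL := continuousAt_LSum (a := pt) (pf := fun y => y.1) (vf := fun y => y.2.1)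
    (wf := fun y => y.2.2.1) (qf := fun y => y.2.2.2.1) (tf := fun y => y.2.2.2.2.1)
    (xf := fun y => y.2.2.2.2.2) hp (by fun_prop) (by fun_prop) (by fun_prop) (by fun_prop)
    (by fun_prop) (fun i => by fun_prop) hv hw hq ht hx hL
  have cR := continuousAt_RSum (a := pt) (pf := fun y => y.1) (vf := fun y => y.2.1)
    (wf := fun y => y.2.2.1) (qf := fun y => y.2.2.2.1) (tf := fun y => y.2.2.2.2.1)
    (xf := fun y => y.2.2.2.2.2) hp (by fun_prop) (by fun_prop) (by fun_prop) (by fun_prop)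
    (by fun_prop) (fun i => by fun_prop) hv hw hq ht hx hR
  refine tendsto_nhds_unique_of_eventuallyEq (l := 𝓝[G] pt) (cL.mono_left nhdsWithin_le_nhds)
    (cR.mono_left nhdsWithin_le_nhds) ?_
  filter_upwards [self_mem_nhdsWithin] with y hy using LSum_eq_RSum_of_generic _ hy

end ThetaIdentity

theorem theorem1 (n : ℕ) (p v w q t : ℂ) (x : Fin n → ℂ)
    (hp : ‖p‖ < 1) (hv : v ≠ 0) (hw : w ≠ 0) (hq : q ≠ 0) (ht : t ≠ 0)
    (hx : ∀ i, x i ≠ 0)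
    (hL : ThetaIdentity.LWellDefined x v w q t p)
    (hR : ThetaIdentity.RWellDefined x v w q t p) :
    ThetaIdentity.L x v w q t p = ThetaIdentity.R x v w q t p ∧
    ThetaIdentity.L x v w q t p =
      ThetaIdentity.L (fun i => q⁻¹ * t⁻¹ * v * w⁻¹ * x i) v⁻¹ w⁻¹ q⁻¹ t⁻¹ p := by
  have h : ThetaIdentity.L x v w q t p = ThetaIdentity.R x v w q t p := by
    rw [ThetaIdentity.L_eq_LSum, ThetaIdentity.R_eq_RSum]
    exact ThetaIdentity.LSum_eq_RSum_of_wellDefined hp hv hw hq ht hx hL hR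
  refine ⟨h, ?_⟩
  -- The symmetry of L is the identity combined with the termwise duality, which rewrites R as the
  -- transformed L.
  rw [h, ThetaIdentity.R_eq_RSum, ThetaIdentity.L_eq_LSum]
  exact (ThetaIdentity.LSum_dual hp hv hw hq ht fun i _ => hx i).symm
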